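/- Let $G\rightrightarrows M$ be a Lie groupoid ($G$, $M$ smooth manifolds) with source $\alpha$, target $\beta$ (both submersions), units $\epsilon:M\to G$, inversion $i$, and product $gh$ defined on $G_2=\{(g,h):\beta(g)=\alpha(h)\}$. Write $V\alpha=\ker T\alpha$, $V\beta=\ker T\beta$, $A_xG=V_{\epsilon(x)}\alpha$, and let $l_g(h)=gh$, $r_g(h)=hg$ be the translations between the fibres of $\alpha$, respectively of $\beta$. The vector bundle $\mathcal P^\tau G\cong V\beta\oplus_G V\alpha\to G$ is a Lie algebroid, with anchor $(X,Y)\mapsto X+Y$, as the Lie algebroid of the groupoid $G_\beta\star G_\alpha=\{(g,h,s)\in G^3:\beta(g)=\beta(h),\ \alpha(h)=\alpha(s)\}\rightrightarrows G$ with source $(g,h,s)\mapsto g$, target $(g,h,s)\mapsto s$, units $(g,g,g)$ and product $(g,h,s)(s,h',s')=(g,h's^{-1}h,s')$, where the vector $(0,X,Z)$ at $(g,g,g)$ is identified with $(X,Z-X)\in V_g\beta\oplus V_g\alpha$. Let $d$ be the differential of this Lie algebroid. Let $L:G\to\mathbb R$ be a smooth function (a discrete Lagrangian). For $(X,Y)\in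 V_g\beta\oplus V_g\alpha$ put $$\Theta_L^-(g)(X,Y)=-X(L),\qquad \Theta_L^+(g)(X,Y)=Y(L),\qquad \Omega_L=-d\Theta_L^-\ (=-d\Theta_L^+).$$ A smooth map $\xi:G\to G$ is a second order operator if $\beta(g)=\alpha(\xi(g))$ for all $g\in G$. It is a discrete Lagrangian evolution operator for $L$ if, in addition, for every $g\in G$ the differential of $L\circ l_g+L\circ r_{\xi(g)}\circ i$ at $\epsilon(\beta(g))$ vanishes on $A_{\beta(g)}G$. For a second order operator $\xi$, the prolongation $\mathcal P^\tau\xi:V\beta\oplus_GV\alpha\to V\beta\oplus_GV\alpha$ over $\xi$ is $$\mathcal P^\tau_g\xi(X,Y)=\big(w,\;T_g\xi(X+Y)-w\big),\qquad w=T_{\epsilon(\beta(g))}(r_{\xi(g)}\circ i)\,\big(T_g l_{g^{-1}}(Y)\big)\in V_{\xi(g)}\beta .$$ **Theorem.** Let $\xi:G\to G$ be a map. (i) $\xi$ is a discrete Lagrangian evolution operator for $L$ if and only if $\xi$ is a second order operator and $(\mathcal P^\tau\xi,\xi)^*\Theta_L^-=\Theta_L^+$. (ii) $\xi$ is a discrete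 Lagrangian evolution operator for $L$ if and only if $\xi$ is a second order operator and $(\mathcal P^\tau\xi,\xi)^*\Theta_L^--\Theta_L^-=dL$. (iii) If $\xi$ is a discrete Lagrangian evolution operator for $L$, then $(\mathcal P^\tau\xi,\xi)^*\Omega_L=\Omega_L$. -/

import Mathlib

open scoped Manifold ContDiff

/-- A Lie groupoid `G ⇉ M`: `src = α`, `tgt = β`, `unit = ε`, `inv = i`, and `mul g h = gh`, which is
meaningful only for composable pairs, i.e. when `β g = α h` (all values elsewhere are irrelevant).
`G` and `M` are smooth manifolds without boundary, all structural maps are smooth, and `α`, `β` are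
submersions.  Smoothness of `mul` on the submanifold `G₂ ⊆ G × G` of composable pairs is
expressed in the usual way, by the existence of local smooth extensions. -/
structure LieGroupoid (EG EM G M : Type*)
    [NormedAddCommGroup EG] [NormedSpace ℝ EG] [NormedAddCommGroup EM] [NormedSpace ℝ EM]
    [TopologicalSpace G] [ChartedSpace EG G] [TopologicalSpace M] [ChartedSpace EM M] where
  src : G → M
  tgt : G → M
  unit : M → G
  inv : G → G
  mul : G → G → G
  src_mul : ∀ g h, tgt g = src h → src (mul g h) = src g
  tgt_mul : ∀ g h, tgt g = src h → tgt (mul g h) = tgt h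
  mul_assoc : ∀ g h k, tgt g = src h → tgt h = src k → mul g (mul h k) = mul (mul g h) k
  src_unit : ∀ x, src (unit x) = x
  tgt_unit : ∀ x, tgt (unit x) = x
  unit_mul : ∀ g, mul (unit (src g)) g = g
  mul_unit : ∀ g, mul g (unit (tgt g)) = g
  src_inv : ∀ g, src (inv g) = tgt g
  tgt_inv : ∀ g, tgt (inv g) = src g
  inv_mul : ∀ g, mul (inv g) g = unit (tgt g)
  mul_inv : ∀ g, mul g (inv g) = unit (src g)
  contMDiff_src : ContMDiff 𝓘(ℝ, EG) 𝓘(ℝ, EM) ∞ src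
  contMDiff_tgt : ContMDiff 𝓘(ℝ, EG) 𝓘(ℝ, EM) ∞ tgt
  contMDiff_unit : ContMDiff 𝓘(ℝ, EM) 𝓘(ℝ, EG) ∞ unit
  contMDiff_inv : ContMDiff 𝓘(ℝ, EG) 𝓘(ℝ, EG) ∞ inv
  submersion_src : ∀ g, Function.Surjective (mfderiv 𝓘(ℝ, EG) 𝓘(ℝ, EM) src g)
  submersion_tgt : ∀ g, Function.Surjective (mfderiv 𝓘(ℝ, EG) 𝓘(ℝ, EM) tgt g)
  smooth_mul : ∀ g h, tgt g = src h → ∃ (U : Set (G × G)) (f : G × G → G),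
    IsOpen U ∧ (g, h) ∈ U ∧
    ContMDiffOn (𝓘(ℝ, EG).prod 𝓘(ℝ, EG)) 𝓘(ℝ, EG) ∞ f U ∧
    ∀ p ∈ U, tgt p.1 = src p.2 → f p = mul p.1 p.2

namespace LieGroupoid

noncomputable section

variable {EG EM G M : Type*}
    [NormedAddCommGroup EG] [NormedSpace ℝ EG] [NormedAddCommGroup EM] [NormedSpace ℝ EM]
    [TopologicalSpace G] [ChartedSpace EG G] [TopologicalSpace M] [ChartedSpace EM M]
    (Γ : LieGroupoid EG EM G M)

/-- `V_g α = ker T_g α`. -/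
def Vsrc (g : G) : Submodule ℝ (TangentSpace 𝓘(ℝ, EG) g) :=
  LinearMap.ker (mfderiv 𝓘(ℝ, EG) 𝓘(ℝ, EM) Γ.src g).toLinearMap

/-- `V_g β = ker T_g β`. -/
def Vtgt (g : G) : Submodule ℝ (TangentSpace 𝓘(ℝ, EG) g) :=
  LinearMap.ker (mfderiv 𝓘(ℝ, EG) 𝓘(ℝ, EM) Γ.tgt g).toLinearMap

/-- The fibre `A_x G = V_{ε(x)} α` of the Lie algebroid of `G`. -/
def A (x : M) : Submodule ℝ (TangentSpace 𝓘(ℝ, EG) (Γ.unit x)) := Γ.Vsrc (Γ.unit x)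

/-! ### Tangent maps of translations

The translations live on fibres of `α` or `β`, so their tangent maps are derivatives within these
fibres.  A derivative within a submanifold is determined exactly on the tangent vectors of
the submanifold; below, the maps are only applied to such vectors. -/

/-- `T_h l_g : V_h α → V_{gh} α`, for `l_g : α⁻¹(β g) → α⁻¹(α g)`, `l_g k = gk`. -/
def Tl (g h : G) : TangentSpace 𝓘(ℝ, EG) h →L[ℝ] TangentSpace 𝓘(ℝ, EG) (Γ.mul g h) :=
  mfderivWithin 𝓘(ℝ, EG) 𝓘(ℝ, EG) (fun k => Γ.mul g k) (Γ.src ⁻¹' {Γ.tgt g}) h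

/-- `T_h r_g : V_h β → V_{hg} β`, for `r_g : β⁻¹(α g) → β⁻¹(β g)`, `r_g k = kg`. -/
def Tr (g h : G) : TangentSpace 𝓘(ℝ, EG) h →L[ℝ] TangentSpace 𝓘(ℝ, EG) (Γ.mul h g) :=
  mfderivWithin 𝓘(ℝ, EG) 𝓘(ℝ, EG) (fun k => Γ.mul k g) (Γ.tgt ⁻¹' {Γ.src g}) h

/-- `T_{ε(α h)} (r_h ∘ i) : A_{α h} G → V_h β`, where `(r_h ∘ i) k = k⁻¹ h` for `k ∈ α⁻¹(α h)`. -/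
def Tri (h : G) : TangentSpace 𝓘(ℝ, EG) (Γ.unit (Γ.src h)) →L[ℝ] TangentSpace 𝓘(ℝ, EG) h :=
  mfderivWithin 𝓘(ℝ, EG) 𝓘(ℝ, EG) (fun k => Γ.mul (Γ.inv k) h) (Γ.src ⁻¹' {Γ.src h})
    (Γ.unit (Γ.src h))

/-! ### The Lie algebroid `π^τ : P^τ G ≅ Vβ ⊕ Vα → G`

Elements of the fibre over `g` are pairs `(X, Y)` of tangent vectors at `g` with `X ∈ V_g β` and
`Y ∈ V_g α`. Cochains are written on all pairs, but are only compared on this fibre. -/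

/-- The fibre `V_g β ⊕ V_g α` of `P^τ G` over `g`. -/
def fibre (g : G) : Submodule ℝ (TangentSpace 𝓘(ℝ, EG) g × TangentSpace 𝓘(ℝ, EG) g) :=
  (Γ.Vtgt g).prod (Γ.Vsrc g)

/-- The anchor `(X, Y) ↦ X + Y`. -/
def anchor (g : G) :
    TangentSpace 𝓘(ℝ, EG) g × TangentSpace 𝓘(ℝ, EG) g →L[ℝ] TangentSpace 𝓘(ℝ, EG) g :=
  ContinuousLinearMap.fst ℝ (TangentSpace 𝓘(ℝ, EG) g) (TangentSpace 𝓘(ℝ, EG) g) +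
    ContinuousLinearMap.snd ℝ (TangentSpace 𝓘(ℝ, EG) g) (TangentSpace 𝓘(ℝ, EG) g)

/-- `σ` is a smooth global section of `P^τ G`. -/
structure IsSection [IsManifold 𝓘(ℝ, EG) ∞ G]
    (σ : ∀ g : G, TangentSpace 𝓘(ℝ, EG) g × TangentSpace 𝓘(ℝ, EG) g) : Prop where
  mem : ∀ g, σ g ∈ Γ.fibre g
  smooth_fst : ContMDiff 𝓘(ℝ, EG) 𝓘(ℝ, EG).tangent ∞
    (fun g => (⟨g, (σ g).1⟩ : TangentBundle 𝓘(ℝ, EG) G))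
  smooth_snd : ContMDiff 𝓘(ℝ, EG) 𝓘(ℝ, EG).tangent ∞
    (fun g => (⟨g, (σ g).2⟩ : TangentBundle 𝓘(ℝ, EG) G))

/-- The Lie groupoid `G_β ⋆ G_α ⇉ G` (as a submanifold of `G × G × G`), with source
`(g, h, s) ↦ g`, target `(g, h, s) ↦ s`, units `(g, g, g)` and multiplication
`(g, h, s) (s, h', s') = (g, h' s⁻¹ h, s')`.  Its Lie algebroid is identified with
`Vβ ⊕ Vα` by `(0, X, Z) ↦ (X, Z - X)` on `V_{(g,g,g)}`. -/
def star : Set (G × G × G) :=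
  {p | Γ.tgt p.1 = Γ.tgt p.2.1 ∧ Γ.src p.2.1 = Γ.src p.2.2}

/-- The left-invariant vector field on `G_β ⋆ G_α` of a section `(X, Y)` of `Vβ ⊕ Vα`: at
`(g, h, s)` it is the image of `(0, X_s, X_s + Y_s)` under left translation
`(s, h', s') ↦ (g, h' s⁻¹ h, s')`. -/
def leftInvariant (σ : ∀ g : G, TangentSpace 𝓘(ℝ, EG) g × TangentSpace 𝓘(ℝ, EG) g)
    (p : G × G × G) :
    TangentSpace (𝓘(ℝ, EG).prod (𝓘(ℝ, EG).prod 𝓘(ℝ, EG))) p :=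
  ((0 : EG), (Γ.Tr (Γ.mul (Γ.inv p.2.2) p.2.1) p.2.2 (σ p.2.2).1 : EG),
    ((σ p.2.2).1 + (σ p.2.2).2 : EG))

/-- The bracket of sections of `P^τ G`: the Lie bracket, on the submanifold `G_β ⋆ G_α`, of the
corresponding left-invariant vector fields, restricted to the units. -/
def bracket (σ σ' : ∀ g : G, TangentSpace 𝓘(ℝ, EG) g × TangentSpace 𝓘(ℝ, EG) g) (g : G) :
    TangentSpace 𝓘(ℝ, EG) g × TangentSpace 𝓘(ℝ, EG) g :=
  let B : EG × EG × EG :=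
    VectorField.mlieBracketWithin (𝓘(ℝ, EG).prod (𝓘(ℝ, EG).prod 𝓘(ℝ, EG)))
      (Γ.leftInvariant σ) (Γ.leftInvariant σ') Γ.star (g, g, g)
  ((B.2.1 : EG), (B.2.2 - B.2.1 : EG))

/-- The differential of a function: `(d f)(σ) = ρ(σ) f`. -/
def d₀ (f : G → ℝ) (g : G) :
    TangentSpace 𝓘(ℝ, EG) g × TangentSpace 𝓘(ℝ, EG) g →L[ℝ] ℝ :=
  (mfderiv 𝓘(ℝ, EG) 𝓘(ℝ, ℝ) f g).comp (anchor g)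

/-- `ρ(σ)(μ(σ')) - ρ(σ')(μ(σ)) - μ([σ, σ'])`, i.e. `(d μ)(σ, σ')` on sections. -/
def dSections (μ : ∀ g : G, TangentSpace 𝓘(ℝ, EG) g × TangentSpace 𝓘(ℝ, EG) g →L[ℝ] ℝ)
    (σ σ' : ∀ g : G, TangentSpace 𝓘(ℝ, EG) g × TangentSpace 𝓘(ℝ, EG) g) (g : G) : ℝ :=
  d₀ (fun k => μ k (σ' k)) g (σ g) - d₀ (fun k => μ k (σ k)) g (σ' g) - μ g (Γ.bracket σ σ' g)

/-- Some smooth global section of `P^τ G` with value `u` at `g`. -/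
def extend [IsManifold 𝓘(ℝ, EG) ∞ G] (g : G) (u : TangentSpace 𝓘(ℝ, EG) g × TangentSpace 𝓘(ℝ, EG) g) :
    ∀ k : G, TangentSpace 𝓘(ℝ, EG) k × TangentSpace 𝓘(ℝ, EG) k :=
  Classical.epsilon fun σ => Γ.IsSection σ ∧ σ g = u

/-- The differential `d μ` of a 1-section `μ`, as a 2-section: its value on two elements of the
fibre is computed with sections through them (the choice is immaterial, by tensoriality). -/
def d₁ [IsManifold 𝓘(ℝ, EG) ∞ G]
    (μ : ∀ g : G, TangentSpace 𝓘(ℝ, EG) g × TangentSpace 𝓘(ℝ, EG) g →L[ℝ] ℝ)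
    (g : G) (u v : TangentSpace 𝓘(ℝ, EG) g × TangentSpace 𝓘(ℝ, EG) g) : ℝ :=
  Γ.dSections μ (Γ.extend g u) (Γ.extend g v) g

/-! ### Discrete mechanics -/

/-- `Θ_L⁻(g)(X, Y) = -X(L)`. -/
def thetaMinus (L : G → ℝ) (g : G) :
    TangentSpace 𝓘(ℝ, EG) g × TangentSpace 𝓘(ℝ, EG) g →L[ℝ] ℝ :=
  -(mfderiv 𝓘(ℝ, EG) 𝓘(ℝ, ℝ) L g).comp
    (ContinuousLinearMap.fst ℝ (TangentSpace 𝓘(ℝ, EG) g) (TangentSpace 𝓘(ℝ, EG) g))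

/-- `Θ_L⁺(g)(X, Y) = Y(L)`. -/
def thetaPlus (L : G → ℝ) (g : G) :
    TangentSpace 𝓘(ℝ, EG) g × TangentSpace 𝓘(ℝ, EG) g →L[ℝ] ℝ :=
  (mfderiv 𝓘(ℝ, EG) 𝓘(ℝ, ℝ) L g).comp
    (ContinuousLinearMap.snd ℝ (TangentSpace 𝓘(ℝ, EG) g) (TangentSpace 𝓘(ℝ, EG) g))

/-- The Poincaré–Cartan 2-section `Ω_L = -d Θ_L⁻`. -/
def omega [IsManifold 𝓘(ℝ, EG) ∞ G] (L : G → ℝ) (g : G)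
    (u v : TangentSpace 𝓘(ℝ, EG) g × TangentSpace 𝓘(ℝ, EG) g) : ℝ :=
  -Γ.d₁ (thetaMinus L) g u v

/-- The discrete Euler–Lagrange operator `D_DEL L (g, h) = d (L ∘ l_g + L ∘ r_h ∘ i) (ε x)`, where
`x = β g = α h`; the function differentiated lives on `α⁻¹(x)`, and the result is
meant on `A_x G`. -/
def DEL (L : G → ℝ) (g h : G) : TangentSpace 𝓘(ℝ, EG) (Γ.unit (Γ.tgt g)) →L[ℝ] ℝ :=
  mfderivWithin 𝓘(ℝ, EG) 𝓘(ℝ, ℝ) (fun k => L (Γ.mul g k) + L (Γ.mul (Γ.inv k) h))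
    (Γ.src ⁻¹' {Γ.tgt g}) (Γ.unit (Γ.tgt g))

/-- `ξ` is a smooth second order operator: `graph ξ ⊆ G₂`. -/
structure IsSecondOrder (ξ : G → G) : Prop where
  smooth : ContMDiff 𝓘(ℝ, EG) 𝓘(ℝ, EG) ∞ ξ
  composable : ∀ g, Γ.tgt g = Γ.src (ξ g)

/-- `ξ` is a discrete Lagrangian evolution operator for `L`. -/
structure IsEvolutionOperator (L : G → ℝ) (ξ : G → G) : Prop extends Γ.IsSecondOrder ξ where
  eulerLagrange : ∀ g, ∀ v ∈ Γ.A (Γ.tgt g), Γ.DEL L g (ξ g) v = 0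

/-- `A_g(Φ^β) : V_g β ⊕ V_g α → P^β_g(AG) ⊆ A_{β g} G × T_g G`,
`(X, Y) ↦ (T_g l_{g⁻¹} Y, X + Y)`. -/
def APhiTgt (g : G) :
    TangentSpace 𝓘(ℝ, EG) g × TangentSpace 𝓘(ℝ, EG) g →L[ℝ]
      TangentSpace 𝓘(ℝ, EG) (Γ.unit (Γ.tgt g)) × TangentSpace 𝓘(ℝ, EG) g :=
  let T : TangentSpace 𝓘(ℝ, EG) g →L[ℝ] TangentSpace 𝓘(ℝ, EG) (Γ.unit (Γ.tgt g)) :=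
    Γ.Tl (Γ.inv g) g
  (T.comp (ContinuousLinearMap.snd ℝ (TangentSpace 𝓘(ℝ, EG) g)
    (TangentSpace 𝓘(ℝ, EG) g))).prod (anchor g)

/-- `A_h(Φ^α)⁻¹ : P^α_h(AG) ⊆ A_{α h} G × T_h G → V_h β ⊕ V_h α`,
`(v, Z) ↦ (T(r_h ∘ i) v, Z - T(r_h ∘ i) v)`. -/
def APhiSrcInv (h : G) :
    TangentSpace 𝓘(ℝ, EG) (Γ.unit (Γ.src h)) × TangentSpace 𝓘(ℝ, EG) h →L[ℝ]
      TangentSpace 𝓘(ℝ, EG) h × TangentSpace 𝓘(ℝ, EG) h :=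
  let R : TangentSpace 𝓘(ℝ, EG) (Γ.unit (Γ.src h)) × TangentSpace 𝓘(ℝ, EG) h →L[ℝ]
      TangentSpace 𝓘(ℝ, EG) h :=
    (Γ.Tri h).comp (ContinuousLinearMap.fst ℝ (TangentSpace 𝓘(ℝ, EG) (Γ.unit (Γ.src h)))
      (TangentSpace 𝓘(ℝ, EG) h))
  R.prod (ContinuousLinearMap.snd ℝ (TangentSpace 𝓘(ℝ, EG) (Γ.unit (Γ.src h)))
    (TangentSpace 𝓘(ℝ, EG) h) - R)

/-- `(Id, Tξ) : P^β_g(AG) → P^α_{ξ g}(AG)`, `(v, Z) ↦ (v, T_g ξ Z)`; the identity makes sense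
because `β g = α (ξ g)` for a second order operator `ξ`. -/
def idT (ξ : G → G) (g : G) :
    TangentSpace 𝓘(ℝ, EG) (Γ.unit (Γ.tgt g)) × TangentSpace 𝓘(ℝ, EG) g →L[ℝ]
      TangentSpace 𝓘(ℝ, EG) (Γ.unit (Γ.src (ξ g))) × TangentSpace 𝓘(ℝ, EG) (ξ g) :=
  let J : TangentSpace 𝓘(ℝ, EG) (Γ.unit (Γ.tgt g)) →L[ℝ]
      TangentSpace 𝓘(ℝ, EG) (Γ.unit (Γ.src (ξ g))) := ContinuousLinearMap.id ℝ EG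
  J.prodMap (mfderiv 𝓘(ℝ, EG) 𝓘(ℝ, EG) ξ g)

/-- The prolongation `P^τ ξ = A(Φ^α)⁻¹ ∘ (Id, Tξ) ∘ A(Φ^β)` of a second order operator. -/
def prolong (ξ : G → G) (g : G) :
    TangentSpace 𝓘(ℝ, EG) g × TangentSpace 𝓘(ℝ, EG) g →L[ℝ]
      TangentSpace 𝓘(ℝ, EG) (ξ g) × TangentSpace 𝓘(ℝ, EG) (ξ g) :=
  (Γ.APhiSrcInv (ξ g)).comp ((Γ.idT ξ g).comp (Γ.APhiTgt g))

/-- The pullback `(P^τ ξ, ξ)^* μ` of a 1-section. -/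
def pullback₁ (ξ : G → G)
    (μ : ∀ g : G, TangentSpace 𝓘(ℝ, EG) g × TangentSpace 𝓘(ℝ, EG) g →L[ℝ] ℝ) (g : G) :
    TangentSpace 𝓘(ℝ, EG) g × TangentSpace 𝓘(ℝ, EG) g →L[ℝ] ℝ :=
  (μ (ξ g)).comp (Γ.prolong ξ g)

/-- The pullback `(P^τ ξ, ξ)^* η` of a 2-section. -/
def pullback₂ (ξ : G → G)
    (η : ∀ g : G, TangentSpace 𝓘(ℝ, EG) g × TangentSpace 𝓘(ℝ, EG) g →
      TangentSpace 𝓘(ℝ, EG) g × TangentSpace 𝓘(ℝ, EG) g → ℝ) (g : G)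
    (u v : TangentSpace 𝓘(ℝ, EG) g × TangentSpace 𝓘(ℝ, EG) g) : ℝ :=
  η (ξ g) (Γ.prolong ξ g u) (Γ.prolong ξ g v)

end

end LieGroupoid

/-! Parts (i) and (ii) rest on one identity. For `Y` in `V_g α`, the Euler–Lagrange functional at
`(g, ξ g)` applied to `T l_{g⁻¹} Y` equals `dL(Y) + dL(w)`, where `w` is the first component of the
prolongation (`del_dl`). Since `-dL(w)` is the pullback of `Θ⁻` and `dL(Y)` is `Θ⁺`, the functional
vanishes on such vectors exactly when the two agree. As `T l_{g⁻¹}` maps `V_g α` onto `A_{β g} G`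
(`exists_dl_inv_eq`), this gives (i). Part (ii) follows from `dL = Θ⁺ - Θ⁻` (`d₀_eq`).

Part (iii) is not derived from commutation of `d` with the pullback, so the prolongation need not be
shown to be a morphism of Lie algebroids. Instead `Ω_L` is identified with a mixed second
derivative: if `N` represents `(h, s) ↦ L (h g⁻¹ s)` on the product of the `β`-fibre and the
`α`-fibre through `g`, then `Ω_L((X, Y), (X', Y')) = D²N(X', Y) - D²N(X, Y')`
(`exists_fibreRep_omega_eq`). In a chart, the left-invariant fields defining the bracket are partial
derivatives of the triple product `m = h' s⁻¹ h`. The terms of `dΘ⁻` that involve derivatives of the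
chosen sections then cancel against the bracket (`mixed_eq_of_transported`).

Invariance of these mixed derivatives (`IsEvolutionOperator.mixed_eq`) is a generating function
argument. Let `φ` parametrize the `β`-fibre through `g`, let `κ` parametrize the `α`-fibre through
`ε(β g)`, and put `γ(p) = φ(p₁) κ(p₂)`. The function `Φ(p, t) = L(φ(p₁) κ(t)) + L(κ(t)⁻¹ κ(p₂) ξ(γ
p))` is critical in `t` at `t = p₂` for every `p`, by the Euler–Lagrange equation at `γ(p)`.
Differentiating this in `p` makes `D²Φ((X, Y), Y')` symmetric under exchange of `(X, Y)` and `(X',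
Y')` (`fderiv_fderiv_symm_of_critical`). The two summands of `Φ` contribute the mixed derivatives at
`g` and at `ξ g`, and the symmetry is the asserted equality. -/

section

open Filter Topology

/-! ### Submersions between normed spaces: straightening, level sets, tangent fields. -/

section Calculus

variable {E F : Type*} [NormedAddCommGroup E] [NormedSpace ℝ E] [NormedAddCommGroup F] [NormedSpace ℝ F] [FiniteDimensional ℝ F]

/-- A submersion `b` admits a local straightening `Ψ`, tangent to the identity, such that `b`
becomes linear in the coordinates `Ψ`. -/
theorem exists_straightening {b : E → F} {y₀ : E} (hb : ContDiffAt ℝ ∞ b y₀)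
    (hs : Function.Surjective (fderiv ℝ b y₀)) :
    ∃ Ψ : E → E, (∀ y, ContDiffAt ℝ ∞ b y → ContDiffAt ℝ ∞ Ψ y) ∧ Ψ y₀ = 0 ∧
      HasFDerivAt Ψ (ContinuousLinearMap.id ℝ E) y₀ ∧
      ∀ y, fderiv ℝ b y₀ (Ψ y) = b y - b y₀ := by
  obtain ⟨R, hR⟩ := (fderiv ℝ b y₀).exists_rightInverse_of_surjective
    (LinearMap.range_eq_top.2 hs)
  have hR' : ∀ w, fderiv ℝ b y₀ (R w) = w := fun w => by
    simpa using congrArg (fun T : F →L[ℝ] F => T w) hR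
  -- The part of `y - y₀` in the range of `R` is replaced by `R (b y - b y₀)`. The derivative of `b`
  -- kills the remaining part and inverts `R`, so it sends the result to `b y - b y₀`.
  refine ⟨fun y => (y - y₀) - R (fderiv ℝ b y₀ (y - y₀)) + R (b y - b y₀), ?_, by simp, ?_, ?_⟩
  · intro y hy
    have : ContDiffAt ℝ ∞ (fun y => fderiv ℝ b y₀ (y - y₀)) y :=
      (fderiv ℝ b y₀).contDiff.contDiffAt.comp y (contDiffAt_id.sub contDiffAt_const)
    exact ((contDiffAt_id.sub contDiffAt_const).sub (R.contDiff.contDiffAt.comp y this)).add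
      (R.contDiff.contDiffAt.comp y (hy.sub contDiffAt_const))
  · have h1 : HasFDerivAt (fun y : E => y - y₀) (ContinuousLinearMap.id ℝ E) y₀ :=
      (hasFDerivAt_id y₀).sub_const y₀
    have h2 : HasFDerivAt (fun y => b y - b y₀) (fderiv ℝ b y₀) y₀ :=
      ((hb.differentiableAt (by simp)).hasFDerivAt).sub_const _
    have h3 := (h1.sub ((R.comp (fderiv ℝ b y₀)).hasFDerivAt.comp y₀ h1)).add
      (R.hasFDerivAt.comp y₀ h2)
    refine h3.congr_fderiv ?_
    ext v
    simp
  · intro y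
    simp [map_add, map_sub, hR']

/-- The level set of a submersion through `y₀` has a smooth local parametrization which is tangent
to the identity on the tangent space of the level set. -/
theorem exists_levelSet_param [CompleteSpace E] {b : E → F} {y₀ : E} (hb : ContDiffAt ℝ ∞ b y₀)
    (hs : Function.Surjective (fderiv ℝ b y₀)) :
    ∃ φ : E → E, ContDiffAt ℝ ∞ φ 0 ∧ φ 0 = y₀ ∧ (∀ᶠ v in 𝓝 0, b (φ v) = b y₀) ∧
      ∀ v, fderiv ℝ b y₀ v = 0 → fderiv ℝ φ 0 v = v := by
  obtain ⟨Ψ, hΨs, hΨ0, hΨ', hbΨ⟩ := exists_straightening hb hs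
  have hΨ := hΨs y₀ hb
  obtain ⟨R, hR⟩ := (fderiv ℝ b y₀).exists_rightInverse_of_surjective
    (LinearMap.range_eq_top.2 hs)
  have hR' : ∀ w, fderiv ℝ b y₀ (R w) = w := fun w => by
    simpa using congrArg (fun T : F →L[ℝ] F => T w) hR
  -- `P` is the projection onto the kernel of the derivative of `b` along the range of `R`. The
  -- parametrization is `Ψ⁻¹ ∘ P`, because `b` stays constant exactly where `Ψ` takes values in that
  -- kernel.
  let P : E →L[ℝ] E := ContinuousLinearMap.id ℝ E - R.comp (fderiv ℝ b y₀)
  have hΨe : HasFDerivAt Ψ ((ContinuousLinearEquiv.refl ℝ E : E ≃L[ℝ] E) : E →L[ℝ] E) y₀ := hΨ'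
  let e := hΨ.toOpenPartialHomeomorph Ψ hΨe (by simp)
  have he : (e : E → E) = Ψ := hΨ.toOpenPartialHomeomorph_coe hΨe (by simp)
  have hmem : y₀ ∈ e.source := hΨ.mem_toOpenPartialHomeomorph_source hΨe (by simp)
  have hy0 : e y₀ = 0 := by rw [he, hΨ0]
  have h0 : (0 : E) ∈ e.target := hy0 ▸ e.map_source hmem
  have hsymm0 : e.symm 0 = y₀ := by rw [← hy0, e.left_inv hmem]
  have hsm : ContDiffAt ℝ ∞ e.symm 0 := by
    refine e.contDiffAt_symm (f₀' := ContinuousLinearEquiv.refl ℝ E) h0 ?_ ?_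
    · rw [hsymm0, he]; exact hΨe
    · rw [hsymm0, he]; exact hΨ
  have hP0 : P 0 = 0 := map_zero P
  have hsmP : ContDiffAt ℝ ∞ e.symm (P 0) := by rw [hP0]; exact hsm
  refine ⟨fun v => e.symm (P v), hsmP.comp 0 P.contDiff.contDiffAt, by simp [hsymm0], ?_, ?_⟩
  · have : Tendsto P (𝓝 0) (𝓝 0) := by simpa using P.continuous.tendsto 0
    filter_upwards [this.eventually (e.open_target.mem_nhds h0)] with v hv
    have h := hbΨ (e.symm (P v))
    rw [← he, e.right_inv hv] at h
    have hP : fderiv ℝ b y₀ (P v) = 0 := by simp [P, hR']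
    rw [hP] at h
    exact (sub_eq_zero.1 h.symm)
  · intro v hv
    have hd : HasFDerivAt e.symm (ContinuousLinearMap.id ℝ E) (P 0) := by
      rw [hP0]
      have := e.hasFDerivAt_symm (f' := ContinuousLinearEquiv.refl ℝ E) h0
        (by rw [hsymm0, he]; exact hΨe)
      exact this
    have h := (HasFDerivAt.comp (g := e.symm) 0 hd P.hasFDerivAt).fderiv
    rw [Function.comp_def] at h
    rw [h]
    simp [P, hv]

/-- A vector tangent to a level set of a submersion extends to a smooth field of vectors
tangent to the level sets. -/
theorem exists_tangent_levelSet_extension [CompleteSpace E] {b : E → F} {y₀ : E}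
    (hb : ∀ᶠ y in 𝓝 y₀, ContDiffAt ℝ ∞ b y)
    (hs : Function.Surjective (fderiv ℝ b y₀)) {v : E} (hv : fderiv ℝ b y₀ v = 0) :
    ∃ X : E → E, X y₀ = v ∧ ∀ᶠ y in 𝓝 y₀, ContDiffAt ℝ ∞ X y ∧ fderiv ℝ b y (X y) = 0 := by
  obtain ⟨Ψ, hΨs, hΨ0, hΨ', hbΨ⟩ := exists_straightening hb.self_of_nhds hs
  have h1 : fderiv ℝ Ψ y₀ = 1 := hΨ'.fderiv
  have hΨ := hΨs y₀ hb.self_of_nhds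
  have hD : ∀ y, ContDiffAt ℝ ∞ b y → ContDiffAt ℝ ∞ (fderiv ℝ Ψ) y :=
    fun y hy => (hΨs y hy).fderiv_right (by simp)
  have hinv : ∀ y, ContDiffAt ℝ ∞ b y → IsUnit (fderiv ℝ Ψ y) →
      ContDiffAt ℝ ∞ (fun y => Ring.inverse (fderiv ℝ Ψ y)) y := by
    intro y hy hu
    refine ContDiffAt.comp (g := Ring.inverse) y ?_ (hD y hy)
    obtain ⟨u, hu⟩ := hu
    rw [← hu]
    exact contDiffAt_ringInverse ℝ u
  -- The constant field `v` is pulled back through `Ψ`. Since `b` is linear after `Ψ`, a vector that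
  -- `DΨ` sends to `v` is tangent to the level sets.
  refine ⟨fun y => Ring.inverse (fderiv ℝ Ψ y) v, by simp [h1], ?_⟩
  have hunit : ∀ᶠ y in 𝓝 y₀, IsUnit (fderiv ℝ Ψ y) := by
    refine (hD y₀ hb.self_of_nhds).continuousAt.eventually (Units.isOpen.mem_nhds ?_)
    rw [h1]; exact isUnit_one
  have hdiff : ∀ᶠ y in 𝓝 y₀, DifferentiableAt ℝ Ψ y :=
    ((hΨ.of_le (m := 1) (by simp)).eventually (by simp)).mono
      fun y hy => hy.differentiableAt (by simp)
  filter_upwards [hunit, hdiff, hb] with y hy hd hby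
  refine ⟨(hinv y hby hy).clm_apply contDiffAt_const, ?_⟩
  have h2 : fderiv ℝ b y = (fderiv ℝ b y₀).comp (fderiv ℝ Ψ y) := by
    have h3 : b = fun y => fderiv ℝ b y₀ (Ψ y) + b y₀ := by
      funext y; rw [hbΨ]; simp
    conv_lhs => rw [h3]
    rw [fderiv_add_const]
    exact ((fderiv ℝ b y₀).hasFDerivAt.comp y hd.hasFDerivAt).fderiv
  have h4 : fderiv ℝ Ψ y (Ring.inverse (fderiv ℝ Ψ y) v) = v := by
    have := Ring.mul_inverse_cancel _ hy
    simpa using congrArg (fun T : E →L[ℝ] E => T v) this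
  rw [h2, ContinuousLinearMap.comp_apply, h4, hv]

end Calculus

/-! ### Mixed second derivatives and families of critical points. -/

section SecondDerivative

variable {E₁ E₂ F₁ F₂ : Type*} [NormedAddCommGroup E₁] [NormedSpace ℝ E₁]
  [NormedAddCommGroup E₂] [NormedSpace ℝ E₂] [NormedAddCommGroup F₁] [NormedSpace ℝ F₁]
  [NormedAddCommGroup F₂] [NormedSpace ℝ F₂]

theorem ContDiffAt.hasFDerivAt_fderiv {f : E₁ → F₁} {x : E₁} (hf : ContDiffAt ℝ ∞ f x) :
    HasFDerivAt (fderiv ℝ f) (fderiv ℝ (fderiv ℝ f) x) x :=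
  ((hf.fderiv_right (m := ∞) (by simp)).differentiableAt (by simp)).hasFDerivAt

theorem ContDiffAt.eventually_differentiableAt {f : E₁ → F₁} {x : E₁}
    (hf : ContDiffAt ℝ ∞ f x) : ∀ᶠ y in 𝓝 x, DifferentiableAt ℝ f y :=
  ((hf.of_le (m := 1) (by simp)).eventually (by simp)).mono
    fun _ hy => hy.differentiableAt (by simp)

theorem ContDiffAt.fderiv_fderiv_comm {f : E₁ → ℝ} {x : E₁} (hf : ContDiffAt ℝ ∞ f x)
    (v w : E₁) : fderiv ℝ (fderiv ℝ f) x v w = fderiv ℝ (fderiv ℝ f) x w v :=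
  hf.isSymmSndFDerivAt (by simpa using WithTop.coe_le_coe.2 (le_top : (2 : ℕ∞) ≤ ⊤)) v w

/-- The mixed second derivative of `N (φ s, ψ t)` is the mixed second derivative of `N` evaluated on
the velocities of `φ` and `ψ`. -/
theorem fderiv_fderiv_comp_prodMap {N : F₁ × F₂ → ℝ} {φ : E₁ → F₁} {ψ : E₂ → F₂} {s₀ : E₁} {t₀ : E₂}
    (hN : ContDiffAt ℝ ∞ N (φ s₀, ψ t₀)) (hφ : ContDiffAt ℝ ∞ φ s₀) (hψ : ContDiffAt ℝ ∞ ψ t₀)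
    (a : E₁) (b : E₂) :
    fderiv ℝ (fderiv ℝ fun p : E₁ × E₂ => N (φ p.1, ψ p.2)) (s₀, t₀) (a, 0) (0, b) =
      fderiv ℝ (fderiv ℝ N) (φ s₀, ψ t₀) (fderiv ℝ φ s₀ a, 0) (0, fderiv ℝ ψ t₀ b) := by
  have hF : ContDiffAt ℝ ∞ (fun p : E₁ × E₂ => N (φ p.1, ψ p.2)) (s₀, t₀) :=
    hN.comp (f := fun p : E₁ × E₂ => (φ p.1, ψ p.2)) (s₀, t₀)
      ((hφ.comp (s₀, t₀) contDiffAt_fst).prodMk (hψ.comp (s₀, t₀) contDiffAt_snd))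
  have hι : HasFDerivAt (fun s : E₁ => (s, t₀)) (ContinuousLinearMap.inl ℝ E₁ E₂) s₀ :=
    (hasFDerivAt_id s₀).prodMk (hasFDerivAt_const t₀ s₀)
  have h1 : HasFDerivAt (fun s => fderiv ℝ (fun p : E₁ × E₂ => N (φ p.1, ψ p.2)) (s, t₀) (0, b))
      (((ContinuousLinearMap.apply ℝ ℝ ((0 : E₁), b))).comp ((fderiv ℝ (fderiv ℝ fun p : E₁ × E₂ =>
        N (φ p.1, ψ p.2)) (s₀, t₀)).comp (ContinuousLinearMap.inl ℝ E₁ E₂))) s₀ :=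
    (ContinuousLinearMap.apply ℝ ℝ ((0 : E₁), b)).hasFDerivAt.comp s₀
      (hF.hasFDerivAt_fderiv.comp s₀ hι)
  have hι' : HasFDerivAt (fun s : E₁ => (φ s, ψ t₀))
      ((ContinuousLinearMap.inl ℝ F₁ F₂).comp (fderiv ℝ φ s₀)) s₀ :=
    ((hφ.differentiableAt (by simp)).hasFDerivAt).prodMk (hasFDerivAt_const (ψ t₀) s₀)
  have h2 : HasFDerivAt (fun s => fderiv ℝ N (φ s, ψ t₀) (0, fderiv ℝ ψ t₀ b))
      (((ContinuousLinearMap.apply ℝ ℝ ((0 : F₁), fderiv ℝ ψ t₀ b))).comp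
        ((fderiv ℝ (fderiv ℝ N) (φ s₀, ψ t₀)).comp
          ((ContinuousLinearMap.inl ℝ F₁ F₂).comp (fderiv ℝ φ s₀)))) s₀ :=
    (ContinuousLinearMap.apply ℝ ℝ ((0 : F₁), fderiv ℝ ψ t₀ b)).hasFDerivAt.comp s₀
      (hN.hasFDerivAt_fderiv.comp s₀ hι')
  -- The derivative in the second slot is taken first, at fixed `t₀`. Afterwards `s` enters only
  -- through the point `φ s`, so no second derivative of `φ` or `ψ` arises.
  have h3 : (fun s => fderiv ℝ (fun p : E₁ × E₂ => N (φ p.1, ψ p.2)) (s, t₀) (0, b)) =ᶠ[𝓝 s₀]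
      fun s => fderiv ℝ N (φ s, ψ t₀) (0, fderiv ℝ ψ t₀ b) := by
    filter_upwards [hφ.eventually_differentiableAt,
      hι'.continuousAt.eventually hN.eventually_differentiableAt] with s hs hNs
    have h4 : HasFDerivAt (fun p : E₁ × E₂ => (φ p.1, ψ p.2))
        ((fderiv ℝ φ s).prodMap (fderiv ℝ ψ t₀)) (s, t₀) :=
      hs.hasFDerivAt.prodMap (s, t₀) (hψ.differentiableAt (by simp)).hasFDerivAt
    have h := (HasFDerivAt.comp (f := fun p : E₁ × E₂ => (φ p.1, ψ p.2)) (s, t₀)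
      hNs.hasFDerivAt h4).fderiv
    rw [Function.comp_def] at h
    rw [h]
    simp
  have h5 := (h1.congr_of_eventuallyEq h3.symm).unique h2
  simpa using congrArg (fun T : E₁ →L[ℝ] ℝ => T a) h5

/-- If `t ↦ Φ (σ, t)` is critical at `t = lam σ` for all `σ` near `0`, then the mixed second
derivatives of `Φ` are symmetric through `lam`. -/
theorem fderiv_fderiv_symm_of_critical {Φ : E₁ × E₂ → ℝ} (lam : E₁ →L[ℝ] E₂)
    (hΦ : ContDiffAt ℝ ∞ Φ 0)
    (hcrit : ∀ᶠ s in 𝓝 (0 : E₁), ∀ b : E₂, fderiv ℝ Φ (s, lam s) (0, b) = 0) (a a' : E₁) :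
    fderiv ℝ (fderiv ℝ Φ) 0 (a, 0) (0, lam a') = fderiv ℝ (fderiv ℝ Φ) 0 (a', 0) (0, lam a) := by
  -- Differentiating the critical equation along `s ↦ (s, lam s)` trades the mixed derivative for a
  -- pure second derivative in `t`, which is symmetric.
  have key : ∀ (a : E₁) (b : E₂), fderiv ℝ (fderiv ℝ Φ) 0 (a, 0) (0, b) =
      - fderiv ℝ (fderiv ℝ Φ) 0 (0, lam a) (0, b) := by
    intro a b
    have hι : HasFDerivAt (fun s : E₁ => (s, lam s))
        ((ContinuousLinearMap.id ℝ E₁).prod lam) 0 :=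
      (hasFDerivAt_id 0).prodMk lam.hasFDerivAt
    have hΦ' : HasFDerivAt (fderiv ℝ Φ) (fderiv ℝ (fderiv ℝ Φ) 0) ((0 : E₁), lam 0) := by
      rw [map_zero]; exact hΦ.hasFDerivAt_fderiv
    have h1 : HasFDerivAt (fun s => fderiv ℝ Φ (s, lam s) (0, b))
        ((ContinuousLinearMap.apply ℝ ℝ ((0 : E₁), b)).comp
          ((fderiv ℝ (fderiv ℝ Φ) 0).comp ((ContinuousLinearMap.id ℝ E₁).prod lam))) 0 :=
      (ContinuousLinearMap.apply ℝ ℝ ((0 : E₁), b)).hasFDerivAt.comp 0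
        (HasFDerivAt.comp (f := fun s : E₁ => (s, lam s)) 0 hΦ' hι)
    have h2 : (fun s => fderiv ℝ Φ (s, lam s) (0, b)) =ᶠ[𝓝 0] fun _ => (0 : ℝ) :=
      hcrit.mono fun s hs => hs b
    have h3 := (h1.congr_of_eventuallyEq h2.symm).unique (hasFDerivAt_const (0 : ℝ) (0 : E₁))
    have h4 := congrArg (fun T : E₁ →L[ℝ] ℝ => T a) h3
    have h5 : ((a, lam a) : E₁ × E₂) = (a, 0) + (0, lam a) := by simp
    simp only [ContinuousLinearMap.comp_apply, ContinuousLinearMap.prod_apply,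
      ContinuousLinearMap.id_apply, ContinuousLinearMap.apply_apply, h5, map_add, zero_apply] at h4
    linarith
  rw [key, key, hΦ.fderiv_fderiv_comm]

end SecondDerivative

/-! ### Derivatives valued in the model spaces, where equal base points need no transport;
parametrized fibres. -/

section Velocity

variable {E E₁ E₂ N P : Type*}
  [NormedAddCommGroup E] [NormedSpace ℝ E] [NormedAddCommGroup E₁] [NormedSpace ℝ E₁]
  [NormedAddCommGroup E₂] [NormedSpace ℝ E₂]
  [TopologicalSpace N] [ChartedSpace E₁ N] [TopologicalSpace P] [ChartedSpace E₂ P]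

/-- The derivative at `t` of a map from a normed space to a manifold, with values in the model
space. -/
noncomputable def vel (φ : E → N) (t : E) : E →L[ℝ] E₁ := mfderiv 𝓘(ℝ, E) 𝓘(ℝ, E₁) φ t

/-- The derivative at `g` of a map between manifolds, as a map between the model spaces. -/
noncomputable def dAt (F : N → P) (g : N) : E₁ →L[ℝ] E₂ := mfderiv 𝓘(ℝ, E₁) 𝓘(ℝ, E₂) F g

/-- The derivative at `g` within `S` of a map between manifolds, as a map between the model
spaces. -/
noncomputable def dWithin (F : N → P) (S : Set N) (g : N) : E₁ →L[ℝ] E₂ :=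
  mfderivWithin 𝓘(ℝ, E₁) 𝓘(ℝ, E₂) F S g

/-- `mfderiv` is by definition the derivative read in the preferred chart at the image point, so no
change of coordinates enters. -/
theorem hasFDerivAt_extChartAt_comp {φ : E → N} {t : E} {g : N} (hg : φ t = g)
    (hφ : MDifferentiableAt 𝓘(ℝ, E) 𝓘(ℝ, E₁) φ t) :
    HasFDerivAt (fun s => extChartAt 𝓘(ℝ, E₁) g (φ s)) (vel φ t) t := by
  subst hg
  have h : HasFDerivWithinAt (fun s => extChartAt 𝓘(ℝ, E₁) (φ t) (φ s)) (vel φ t)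
    (Set.range 𝓘(ℝ, E)) t := hφ.hasMFDerivAt.2
  simpa [hasFDerivWithinAt_univ] using h

theorem vel_eq_of_hasFDerivAt {φ : E → N} {t : E} {g : N} (hg : φ t = g)
    (hφ : MDifferentiableAt 𝓘(ℝ, E) 𝓘(ℝ, E₁) φ t) {A : E →L[ℝ] E₁}
    (h : HasFDerivAt (fun s => extChartAt 𝓘(ℝ, E₁) g (φ s)) A t) : vel φ t = A :=
  (hasFDerivAt_extChartAt_comp hg hφ).unique h

theorem Filter.EventuallyEq.vel_eq {φ φ' : E → N} {t : E} (h : φ =ᶠ[𝓝 t] φ') :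
    (vel φ t : E →L[ℝ] E₁) = vel φ' t := by
  have := h.mfderiv_eq (I := 𝓘(ℝ, E)) (I' := 𝓘(ℝ, E₁))
  exact this

/-- The chain rule for maps which are only differentiable within a set, along a map which takes values
in that set. -/
theorem mfderivWithin_vel {F : N → P} {S : Set N} {φ : E → N} {t : E} {g : N} (hg : φ t = g)
    (hF : MDifferentiableWithinAt 𝓘(ℝ, E₁) 𝓘(ℝ, E₂) F S g)
    (hφ : MDifferentiableAt 𝓘(ℝ, E) 𝓘(ℝ, E₁) φ t) (hS : ∀ᶠ s in 𝓝 t, φ s ∈ S) (v : E) :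
    dWithin F S g ((vel φ t : E →L[ℝ] E₁) v) = (vel (fun s => F (φ s)) t : E →L[ℝ] E₂) v := by
  subst hg
  have h1 : HasMFDerivWithinAt 𝓘(ℝ, E) 𝓘(ℝ, E₁) φ (φ ⁻¹' S) t (mfderiv 𝓘(ℝ, E) 𝓘(ℝ, E₁) φ t) :=
    hφ.hasMFDerivAt.hasMFDerivWithinAt
  have h2 := HasMFDerivWithinAt.comp t hF.hasMFDerivWithinAt h1 subset_rfl
  have h3 := (h2.hasMFDerivAt hS).mfderiv
  have h4 : (vel (F ∘ φ) t : E →L[ℝ] E₂) v = (mfderiv 𝓘(ℝ, E) 𝓘(ℝ, E₂) (F ∘ φ) t) v := rfl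
  rw [Function.comp_def] at h4 h3
  rw [h4, h3]
  rfl

theorem mfderiv_vel {F : N → P} {φ : E → N} {t : E} {g : N} (hg : φ t = g)
    (hF : MDifferentiableAt 𝓘(ℝ, E₁) 𝓘(ℝ, E₂) F g)
    (hφ : MDifferentiableAt 𝓘(ℝ, E) 𝓘(ℝ, E₁) φ t) (v : E) :
    dAt F g ((vel φ t : E →L[ℝ] E₁) v) = (vel (fun s => F (φ s)) t : E →L[ℝ] E₂) v := by
  have := mfderivWithin_vel (S := Set.univ) hg hF.mdifferentiableWithinAt hφ (by simp) v
  rw [← this]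
  simp only [dAt, dWithin, mfderivWithin_univ]

theorem vel_eq_fderiv (φ : E → E₁) (t : E) : vel φ t = fderiv ℝ φ t :=
  mfderiv_eq_fderiv

theorem vel_eq_zero_of_eventually_eq {φ : E → N} {t : E} {g : N} (h : ∀ᶠ s in 𝓝 t, φ s = g) :
    (vel φ t : E →L[ℝ] E₁) = 0 := by
  rw [Filter.EventuallyEq.vel_eq (show φ =ᶠ[𝓝 t] fun _ => g from h)]
  exact mfderiv_const

/-- The representation in charts of a map between manifolds. -/
theorem contDiffAt_chart_rep {p : N → P} {g : N}
    (hp : ContMDiffAt 𝓘(ℝ, E₁) 𝓘(ℝ, E₂) ∞ p g) :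
    ContDiffAt ℝ ∞ (fun y => extChartAt 𝓘(ℝ, E₂) (p g) (p ((extChartAt 𝓘(ℝ, E₁) g).symm y)))
      (extChartAt 𝓘(ℝ, E₁) g g) := by
  have := (contMDiffAt_iff.1 hp).2
  simpa [Function.comp_def, contDiffWithinAt_univ] using this

theorem hasFDerivAt_chart_rep {p : N → P} {g : N}
    (hp : MDifferentiableAt 𝓘(ℝ, E₁) 𝓘(ℝ, E₂) p g) :
    HasFDerivAt (fun y => extChartAt 𝓘(ℝ, E₂) (p g) (p ((extChartAt 𝓘(ℝ, E₁) g).symm y)))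
      (dAt p g) (extChartAt 𝓘(ℝ, E₁) g g) := by
  have h : HasFDerivWithinAt (fun y => extChartAt 𝓘(ℝ, E₂) (p g)
    (p ((extChartAt 𝓘(ℝ, E₁) g).symm y))) (dAt p g) (Set.range 𝓘(ℝ, E₁))
    (extChartAt 𝓘(ℝ, E₁) g g) := hp.hasMFDerivAt.2
  simpa only [modelWithCornersSelf_coe, Set.range_id, hasFDerivWithinAt_univ] using h

theorem contMDiffAt_extChartAt_symm_self [IsManifold 𝓘(ℝ, E₁) ∞ N] (g : N) :
    ContMDiffAt 𝓘(ℝ, E₁) 𝓘(ℝ, E₁) ∞ (extChartAt 𝓘(ℝ, E₁) g).symm (extChartAt 𝓘(ℝ, E₁) g g) := by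
  have := contMDiffWithinAt_extChartAt_symm_range_self (I := 𝓘(ℝ, E₁)) (n := ∞) g
  simpa [contMDiffWithinAt_univ] using this

/-- A fibre of a submersion has local parametrizations which are tangent to the identity on the
tangent space of the fibre. -/
theorem exists_fibre_param [CompleteSpace E₁] [FiniteDimensional ℝ E₂]
    [IsManifold 𝓘(ℝ, E₁) ∞ N] {p : N → P} {g : N} (hp : ContMDiffAt 𝓘(ℝ, E₁) 𝓘(ℝ, E₂) ∞ p g)
    (hs : Function.Surjective (dAt p g : E₁ →L[ℝ] E₂)) :
    ∃ φ : E₁ → N, φ 0 = g ∧ ContMDiffAt 𝓘(ℝ, E₁) 𝓘(ℝ, E₁) ∞ φ 0 ∧ (∀ᶠ v in 𝓝 0, p (φ v) = p g) ∧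
      ∀ v : E₁, (dAt p g : E₁ →L[ℝ] E₂) v = 0 → vel φ 0 v = v := by
  have hD := (hasFDerivAt_chart_rep (hp.mdifferentiableAt (by simp))).fderiv
  obtain ⟨φ, hφ, hφ0, hbφ, hφ'⟩ := exists_levelSet_param (contDiffAt_chart_rep hp)
    (by rw [← hD] at hs; exact hs)
  have h0 : (extChartAt 𝓘(ℝ, E₁) g).symm (φ 0) = g := by rw [hφ0]; simp
  have hsm : ContMDiffAt 𝓘(ℝ, E₁) 𝓘(ℝ, E₁) ∞ (fun v => (extChartAt 𝓘(ℝ, E₁) g).symm (φ v)) 0 := by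
    have h1 : ContMDiffAt 𝓘(ℝ, E₁) 𝓘(ℝ, E₁) ∞ (extChartAt 𝓘(ℝ, E₁) g).symm (φ 0) := by
      rw [hφ0]; exact contMDiffAt_extChartAt_symm_self g
    exact h1.comp 0 hφ.contMDiffAt
  refine ⟨fun v => (extChartAt 𝓘(ℝ, E₁) g).symm (φ v), h0, hsm, ?_, ?_⟩
  -- The level set equation is known only after applying the chart at `p g`. Continuity keeps `p` in
  -- the chart domain, where the chart is injective.
  · have hc : ContinuousAt (fun v => p ((extChartAt 𝓘(ℝ, E₁) g).symm (φ v))) 0 := by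
      have hpc : ContinuousAt p ((extChartAt 𝓘(ℝ, E₁) g).symm (φ 0)) := by
        rw [h0]; exact hp.continuousAt
      exact ContinuousAt.comp (g := p) hpc hsm.continuousAt
    have hmem : (extChartAt 𝓘(ℝ, E₂) (p g)).source ∈
        𝓝 (p ((extChartAt 𝓘(ℝ, E₁) g).symm (φ 0))) := by
      rw [h0]; exact extChartAt_source_mem_nhds (p g)
    filter_upwards [hbφ, hc.eventually hmem] with v hv hv'
    refine (extChartAt 𝓘(ℝ, E₂) (p g)).injOn hv' (mem_extChartAt_source (p g)) ?_
    simpa using hv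
  · intro v hv
    have h2 : HasFDerivAt (fun s => extChartAt 𝓘(ℝ, E₁) g ((extChartAt 𝓘(ℝ, E₁) g).symm (φ s)))
        (fderiv ℝ φ 0) 0 := by
      refine (hφ.differentiableAt (by simp)).hasFDerivAt.congr_of_eventuallyEq ?_
      have hmem : (extChartAt 𝓘(ℝ, E₁) g).target ∈ 𝓝 (φ 0) := by
        rw [hφ0]; exact extChartAt_target_mem_nhds g
      filter_upwards [hφ.continuousAt.eventually hmem] with s hs'
      exact (extChartAt 𝓘(ℝ, E₁) g).right_inv hs'
    have h3 := vel_eq_of_hasFDerivAt (φ := fun v => (extChartAt 𝓘(ℝ, E₁) g).symm (φ v)) h0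
      (hsm.mdifferentiableAt (by simp)) h2
    rw [h3]
    exact hφ' v (by rw [hD]; exact hv)

/-- A map which is smooth at a point is differentiable nearby. -/
theorem ContMDiffAt.eventually_mdifferentiableAt [IsManifold 𝓘(ℝ, E₁) ∞ N]
    {φ : E → N} {t : E} (hφ : ContMDiffAt 𝓘(ℝ, E) 𝓘(ℝ, E₁) ∞ φ t) :
    ∀ᶠ s in 𝓝 t, MDifferentiableAt 𝓘(ℝ, E) 𝓘(ℝ, E₁) φ s := by
  have : IsManifold 𝓘(ℝ, E₁) 1 N := IsManifold.of_le (n := ∞) (by simp)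
  have h1 : ContMDiffAt 𝓘(ℝ, E) 𝓘(ℝ, E₁) 1 φ t := hφ.of_le (by simp)
  filter_upwards [(contMDiffAt_iff_contMDiffAt_nhds (by simp)).1 h1] with s hs
  exact hs.mdifferentiableAt (by simp)

theorem ContMDiffAt.contDiffAt_extChartAt_comp [IsManifold 𝓘(ℝ, E₁) ∞ N]
    {φ : E → N} {t : E} {g : N} (hg : φ t = g) (hφ : ContMDiffAt 𝓘(ℝ, E) 𝓘(ℝ, E₁) ∞ φ t) :
    ContDiffAt ℝ ∞ (fun s => extChartAt 𝓘(ℝ, E₁) g (φ s)) t := by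
  subst hg
  have : ContMDiffAt 𝓘(ℝ, E₁) 𝓘(ℝ, E₁) ∞ (extChartAt 𝓘(ℝ, E₁) (φ t)) (φ t) :=
    contMDiffAt_extChartAt
  exact (this.comp t hφ).contDiffAt

end Velocity

/-! ### Groupoid algebra, smoothness of products, tangent maps of translations. -/

namespace LieGroupoid

variable {EG EM G M : Type*}
    [NormedAddCommGroup EG] [NormedSpace ℝ EG] [NormedAddCommGroup EM] [NormedSpace ℝ EM]
    [TopologicalSpace G] [ChartedSpace EG G] [TopologicalSpace M] [ChartedSpace EM M]
    (Γ : LieGroupoid EG EM G M)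

section Algebra

theorem inv_mul_cancel_left {g k : G} (h : Γ.tgt g = Γ.src k) :
    Γ.mul (Γ.inv g) (Γ.mul g k) = k := by
  rw [Γ.mul_assoc _ _ _ (Γ.tgt_inv g) h, Γ.inv_mul, h, Γ.unit_mul]

theorem mul_inv_cancel_left {g k : G} (h : Γ.src g = Γ.src k) :
    Γ.mul g (Γ.mul (Γ.inv g) k) = k := by
  rw [Γ.mul_assoc _ _ _ (Γ.src_inv g).symm ((Γ.tgt_inv g).trans h), Γ.mul_inv, h, Γ.unit_mul]

theorem inv_unit (x : M) : Γ.inv (Γ.unit x) = Γ.unit x := by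
  have h := Γ.mul_unit (Γ.inv (Γ.unit x))
  rw [Γ.tgt_inv, Γ.src_unit, Γ.inv_mul, Γ.tgt_unit] at h
  exact h.symm

theorem eq_inv_of_mul_eq_unit {g h : G} (hgh : Γ.tgt g = Γ.src h)
    (h1 : Γ.mul g h = Γ.unit (Γ.src g)) : h = Γ.inv g := by
  rw [← Γ.inv_mul_cancel_left hgh, h1]
  have := Γ.mul_unit (Γ.inv g)
  rwa [Γ.tgt_inv] at this

theorem inv_mul_rev {g h : G} (hgh : Γ.tgt g = Γ.src h) :
    Γ.inv (Γ.mul g h) = Γ.mul (Γ.inv h) (Γ.inv g) := by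
  have h0 : Γ.tgt (Γ.inv h) = Γ.src (Γ.inv g) := by rw [Γ.tgt_inv, Γ.src_inv, hgh]
  have h1 : Γ.tgt h = Γ.src (Γ.mul (Γ.inv h) (Γ.inv g)) := by
    rw [Γ.src_mul _ _ h0, Γ.src_inv]
  symm
  apply Γ.eq_inv_of_mul_eq_unit
  · rw [Γ.tgt_mul _ _ hgh, h1]
  · rw [← Γ.mul_assoc _ _ _ hgh h1, Γ.mul_inv_cancel_left (by rw [Γ.src_inv, hgh]), Γ.mul_inv,
      Γ.src_mul _ _ hgh]

theorem inv_inv (g : G) : Γ.inv (Γ.inv g) = g :=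
  (Γ.eq_inv_of_mul_eq_unit (Γ.tgt_inv g) (by rw [Γ.inv_mul, Γ.src_inv])).symm

end Algebra

section Smooth

theorem exists_mul_extension {g h : G} (hgh : Γ.tgt g = Γ.src h) :
    ∃ f : G × G → G, ContMDiffAt (𝓘(ℝ, EG).prod 𝓘(ℝ, EG)) 𝓘(ℝ, EG) ∞ f (g, h) ∧
      ∀ᶠ p in 𝓝 (g, h), Γ.tgt p.1 = Γ.src p.2 → f p = Γ.mul p.1 p.2 := by
  obtain ⟨U, f, hU, hmem, hf, hfU⟩ := Γ.smooth_mul g h hgh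
  exact ⟨f, hf.contMDiffAt (hU.mem_nhds hmem),
    (hU.eventually_mem hmem).mono hfU⟩

variable {E H N : Type*} [NormedAddCommGroup E] [NormedSpace ℝ E] [TopologicalSpace H]
  {I : ModelWithCorners ℝ E H} [TopologicalSpace N] [ChartedSpace H N]

/-- Near a composable pair the product agrees, on composable pairs, with a smooth local extension.
Composability of `a` and `b` along `S` allows that extension to be used in its place. -/
theorem contMDiffWithinAt_mul {a b : N → G} {S : Set N} {p : N} (hp : p ∈ S)
    (ha : ContMDiffWithinAt I 𝓘(ℝ, EG) ∞ a S p) (hb : ContMDiffWithinAt I 𝓘(ℝ, EG) ∞ b S p)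
    (h : ∀ᶠ q in 𝓝[S] p, Γ.tgt (a q) = Γ.src (b q)) :
    ContMDiffWithinAt I 𝓘(ℝ, EG) ∞ (fun q => Γ.mul (a q) (b q)) S p := by
  have hp' : Γ.tgt (a p) = Γ.src (b p) := h.self_of_nhdsWithin hp
  obtain ⟨f, hf, hfe⟩ := Γ.exists_mul_extension hp'
  have hab : ContMDiffWithinAt I (𝓘(ℝ, EG).prod 𝓘(ℝ, EG)) ∞ (fun q => (a q, b q)) S p :=
    ha.prodMk hb
  have hfab : ContMDiffWithinAt I 𝓘(ℝ, EG) ∞ (fun q => f (a q, b q)) S p :=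
    ContMDiffAt.comp_contMDiffWithinAt (g := f) p hf hab
  refine hfab.congr_of_eventuallyEq_of_mem ?_ hp
  filter_upwards [h, hab.continuousWithinAt.eventually hfe] with q hq hfq
  exact (hfq hq).symm

theorem contMDiffAt_mul {a b : N → G} {p : N}
    (ha : ContMDiffAt I 𝓘(ℝ, EG) ∞ a p) (hb : ContMDiffAt I 𝓘(ℝ, EG) ∞ b p)
    (h : ∀ᶠ q in 𝓝 p, Γ.tgt (a q) = Γ.src (b q)) :
    ContMDiffAt I 𝓘(ℝ, EG) ∞ (fun q => Γ.mul (a q) (b q)) p := by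
  rw [← contMDiffWithinAt_univ] at *
  exact Γ.contMDiffWithinAt_mul (Set.mem_univ p) ha hb (by rwa [nhdsWithin_univ])

theorem contMDiffAt_inv {a : N → G} {p : N} (ha : ContMDiffAt I 𝓘(ℝ, EG) ∞ a p) :
    ContMDiffAt I 𝓘(ℝ, EG) ∞ (fun q => Γ.inv (a q)) p :=
  Γ.contMDiff_inv.contMDiffAt.comp p ha

theorem contMDiffWithinAt_mul_left {g h : G} (hgh : Γ.tgt g = Γ.src h) :
    ContMDiffWithinAt 𝓘(ℝ, EG) 𝓘(ℝ, EG) ∞ (fun k => Γ.mul g k) (Γ.src ⁻¹' {Γ.tgt g}) h :=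
  Γ.contMDiffWithinAt_mul hgh.symm contMDiffWithinAt_const contMDiffWithinAt_id
    (eventually_nhdsWithin_of_forall fun _ hk => Eq.symm hk)

theorem contMDiffWithinAt_mul_right {g h : G} (hgh : Γ.tgt h = Γ.src g) :
    ContMDiffWithinAt 𝓘(ℝ, EG) 𝓘(ℝ, EG) ∞ (fun k => Γ.mul k g) (Γ.tgt ⁻¹' {Γ.src g}) h :=
  Γ.contMDiffWithinAt_mul hgh contMDiffWithinAt_id contMDiffWithinAt_const
    (eventually_nhdsWithin_of_forall fun _ hk => hk)

theorem contMDiffWithinAt_inv_mul {h k : G} (hk : Γ.src k = Γ.src h) :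
    ContMDiffWithinAt 𝓘(ℝ, EG) 𝓘(ℝ, EG) ∞ (fun k => Γ.mul (Γ.inv k) h)
      (Γ.src ⁻¹' {Γ.src h}) k :=
  Γ.contMDiffWithinAt_mul hk Γ.contMDiff_inv.contMDiffAt.contMDiffWithinAt contMDiffWithinAt_const
    (eventually_nhdsWithin_of_forall fun _ hk => (Γ.tgt_inv _).trans hk)

end Smooth

noncomputable section Translations

variable {E : Type*} [NormedAddCommGroup E] [NormedSpace ℝ E]

/-- `T_h l_g` as a map of the model space. -/
def dl (g h : G) : EG →L[ℝ] EG := Γ.Tl g h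

/-- `T_h r_g` as a map of the model space. -/
def dr (g h : G) : EG →L[ℝ] EG := Γ.Tr g h

/-- `T_{ε(α h)} (r_h ∘ i)` as a map of the model space. -/
def dri (h : G) : EG →L[ℝ] EG := Γ.Tri h

/-- The discrete Euler–Lagrange operator as a functional on the model space. -/
def del (L : G → ℝ) (g h : G) : EG →L[ℝ] ℝ := Γ.DEL L g h

/-- A derivative within a fibre is controlled only on velocities of maps into that fibre. This lemma
and its analogues below turn tangent maps of translations into velocities of explicit products. -/
theorem dl_vel {φ : E → G} {t : E} {g h : G} (hφt : φ t = h) (hgh : Γ.tgt g = Γ.src h)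
    (hφ : MDifferentiableAt 𝓘(ℝ, E) 𝓘(ℝ, EG) φ t) (hS : ∀ᶠ s in 𝓝 t, Γ.src (φ s) = Γ.tgt g)
    (v : E) :
    Γ.dl g h ((vel φ t : E →L[ℝ] EG) v) =
      (vel (fun s => Γ.mul g (φ s)) t : E →L[ℝ] EG) v :=
  mfderivWithin_vel (F := fun k => Γ.mul g k) hφt
    ((Γ.contMDiffWithinAt_mul_left hgh).mdifferentiableWithinAt (by simp)) hφ hS v

theorem dr_vel {φ : E → G} {t : E} {g h : G} (hφt : φ t = h) (hgh : Γ.tgt h = Γ.src g)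
    (hφ : MDifferentiableAt 𝓘(ℝ, E) 𝓘(ℝ, EG) φ t) (hS : ∀ᶠ s in 𝓝 t, Γ.tgt (φ s) = Γ.src g)
    (v : E) :
    Γ.dr g h ((vel φ t : E →L[ℝ] EG) v) =
      (vel (fun s => Γ.mul (φ s) g) t : E →L[ℝ] EG) v :=
  mfderivWithin_vel (F := fun k => Γ.mul k g) hφt
    ((Γ.contMDiffWithinAt_mul_right hgh).mdifferentiableWithinAt (by simp)) hφ hS v

theorem dri_vel {φ : E → G} {t : E} {h : G} (hφt : φ t = Γ.unit (Γ.src h))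
    (hφ : MDifferentiableAt 𝓘(ℝ, E) 𝓘(ℝ, EG) φ t) (hS : ∀ᶠ s in 𝓝 t, Γ.src (φ s) = Γ.src h)
    (v : E) :
    Γ.dri h ((vel φ t : E →L[ℝ] EG) v) =
      (vel (fun s => Γ.mul (Γ.inv (φ s)) h) t : E →L[ℝ] EG) v :=
  mfderivWithin_vel (F := fun k => Γ.mul (Γ.inv k) h) hφt
    ((Γ.contMDiffWithinAt_inv_mul (Γ.src_unit _)).mdifferentiableWithinAt (by simp)) hφ hS v

theorem del_vel {L : G → ℝ} (hL : ContMDiff 𝓘(ℝ, EG) 𝓘(ℝ, ℝ) ∞ L) {φ : E → G} {t : E} {g h : G}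
    (hφt : φ t = Γ.unit (Γ.tgt g)) (hgh : Γ.tgt g = Γ.src h)
    (hφ : MDifferentiableAt 𝓘(ℝ, E) 𝓘(ℝ, EG) φ t) (hS : ∀ᶠ s in 𝓝 t, Γ.src (φ s) = Γ.tgt g)
    (v : E) :
    Γ.del L g h ((vel φ t : E →L[ℝ] EG) v) =
      fderiv ℝ (fun s => L (Γ.mul g (φ s)) + L (Γ.mul (Γ.inv (φ s)) h)) t v := by
  have h1 : ContMDiffWithinAt 𝓘(ℝ, EG) 𝓘(ℝ, ℝ) ∞ (fun k => L (Γ.mul g k))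
      (Γ.src ⁻¹' {Γ.tgt g}) (Γ.unit (Γ.tgt g)) :=
    hL.contMDiffAt.comp_contMDiffWithinAt _
      (Γ.contMDiffWithinAt_mul_left (Γ.src_unit _).symm)
  have h2 : ContMDiffWithinAt 𝓘(ℝ, EG) 𝓘(ℝ, ℝ) ∞ (fun k => L (Γ.mul (Γ.inv k) h))
      (Γ.src ⁻¹' {Γ.tgt g}) (Γ.unit (Γ.tgt g)) := by
    have h3 := Γ.contMDiffWithinAt_inv_mul (k := Γ.unit (Γ.tgt g)) ((Γ.src_unit _).trans hgh)
    rw [← hgh] at h3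
    exact hL.contMDiffAt.comp_contMDiffWithinAt _ h3
  have h4 := mfderivWithin_vel (F := fun k => L (Γ.mul g k) + L (Γ.mul (Γ.inv k) h)) hφt
    ((h1.add h2).mdifferentiableWithinAt (by simp)) hφ hS v
  rw [vel_eq_fderiv] at h4
  exact h4

theorem vel_mem_Vsrc {φ : E → G} {t : E} {g : G} (hφt : φ t = g)
    (hφ : MDifferentiableAt 𝓘(ℝ, E) 𝓘(ℝ, EG) φ t) {x : M} (hS : ∀ᶠ s in 𝓝 t, Γ.src (φ s) = x)
    (v : E) : ((vel φ t : E →L[ℝ] EG) v : EG) ∈ Γ.Vsrc g := by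
  have h := mfderiv_vel (F := Γ.src) (E₂ := EM) hφt
    (Γ.contMDiff_src.contMDiffAt.mdifferentiableAt (by simp)) hφ v
  rw [vel_eq_zero_of_eventually_eq hS] at h
  exact h

theorem vel_mem_Vtgt {φ : E → G} {t : E} {g : G} (hφt : φ t = g)
    (hφ : MDifferentiableAt 𝓘(ℝ, E) 𝓘(ℝ, EG) φ t) {x : M} (hS : ∀ᶠ s in 𝓝 t, Γ.tgt (φ s) = x)
    (v : E) : ((vel φ t : E →L[ℝ] EG) v : EG) ∈ Γ.Vtgt g := by
  have h := mfderiv_vel (F := Γ.tgt) (E₂ := EM) hφt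
    (Γ.contMDiff_tgt.contMDiffAt.mdifferentiableAt (by simp)) hφ v
  rw [vel_eq_zero_of_eventually_eq hS] at h
  exact h

theorem exists_src_param [CompleteSpace EG] [FiniteDimensional ℝ EM] [IsManifold 𝓘(ℝ, EG) ∞ G]
    (g : G) :
    ∃ φ : EG → G, φ 0 = g ∧ ContMDiffAt 𝓘(ℝ, EG) 𝓘(ℝ, EG) ∞ φ 0 ∧
      (∀ᶠ v in 𝓝 0, Γ.src (φ v) = Γ.src g) ∧ ∀ v : EG, v ∈ Γ.Vsrc g → vel φ 0 v = v :=
  exists_fibre_param (E₂ := EM) Γ.contMDiff_src.contMDiffAt (Γ.submersion_src g)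

theorem exists_tgt_param [CompleteSpace EG] [FiniteDimensional ℝ EM] [IsManifold 𝓘(ℝ, EG) ∞ G]
    (g : G) :
    ∃ φ : EG → G, φ 0 = g ∧ ContMDiffAt 𝓘(ℝ, EG) 𝓘(ℝ, EG) ∞ φ 0 ∧
      (∀ᶠ v in 𝓝 0, Γ.tgt (φ v) = Γ.tgt g) ∧ ∀ v : EG, v ∈ Γ.Vtgt g → vel φ 0 v = v :=
  exists_fibre_param (E₂ := EM) Γ.contMDiff_tgt.contMDiffAt (Γ.submersion_tgt g)

end Translations

end LieGroupoid

/-! ### The Euler–Lagrange functional and the pullback of the 1-sections. -/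

namespace LieGroupoid

variable {EG EM G M : Type*}
    [NormedAddCommGroup EG] [NormedSpace ℝ EG] [NormedAddCommGroup EM] [NormedSpace ℝ EM]
    [TopologicalSpace G] [ChartedSpace EG G] [TopologicalSpace M] [ChartedSpace EM M]
    (Γ : LieGroupoid EG EM G M)

section EulerLagrange

variable {E : Type*} [NormedAddCommGroup E] [NormedSpace ℝ E]

theorem fderiv_comp_vel {L : G → ℝ} (hL : ContMDiff 𝓘(ℝ, EG) 𝓘(ℝ, ℝ) ∞ L) {φ : E → G} {t : E}
    {g : G} (hφt : φ t = g) (hφ : MDifferentiableAt 𝓘(ℝ, E) 𝓘(ℝ, EG) φ t) :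
    HasFDerivAt (fun s => L (φ s)) ((dAt L g : EG →L[ℝ] ℝ).comp (vel φ t)) t := by
  subst hφt
  have h : MDifferentiableAt 𝓘(ℝ, E) 𝓘(ℝ, ℝ) (fun s => L (φ s)) t :=
    (hL.contMDiffAt.mdifferentiableAt (by simp)).comp t hφ
  have h1 := h.differentiableAt.hasFDerivAt
  rw [← vel_eq_fderiv] at h1
  refine h1.congr_fderiv (ContinuousLinearMap.ext fun v => Eq.symm ?_)
  exact mfderiv_vel rfl (hL.contMDiffAt.mdifferentiableAt (by simp)) hφ v

/-- The Euler–Lagrange operator along a path in the `α`-fibre through a unit. -/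
theorem del_vel_eq {L : G → ℝ} (hL : ContMDiff 𝓘(ℝ, EG) 𝓘(ℝ, ℝ) ∞ L) {κ : E → G} {t : E}
    {g h : G} (hκt : κ t = Γ.unit (Γ.tgt g)) (hgh : Γ.tgt g = Γ.src h)
    (hκ : ContMDiffAt 𝓘(ℝ, E) 𝓘(ℝ, EG) ∞ κ t) (hS : ∀ᶠ s in 𝓝 t, Γ.src (κ s) = Γ.tgt g)
    (v : E) :
    Γ.del L g h ((vel κ t : E →L[ℝ] EG) v) =
      dAt L g ((vel (fun s => Γ.mul g (κ s)) t : E →L[ℝ] EG) v) +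
      dAt L h (Γ.dri h ((vel κ t : E →L[ℝ] EG) v)) := by
  have hS' : ∀ᶠ s in 𝓝 t, Γ.src (κ s) = Γ.src h := hgh ▸ hS
  rw [Γ.del_vel hL hκt hgh (hκ.mdifferentiableAt (by simp)) hS,
    Γ.dri_vel (by rw [hκt, hgh]) (hκ.mdifferentiableAt (by simp)) hS']
  have h1 : ContMDiffAt 𝓘(ℝ, E) 𝓘(ℝ, EG) ∞ (fun s => Γ.mul g (κ s)) t :=
    Γ.contMDiffAt_mul contMDiffAt_const hκ (hS.mono fun s hs => hs.symm)
  have h2 : ContMDiffAt 𝓘(ℝ, E) 𝓘(ℝ, EG) ∞ (fun s => Γ.mul (Γ.inv (κ s)) h) t :=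
    Γ.contMDiffAt_mul (Γ.contMDiffAt_inv hκ) contMDiffAt_const
      (hS'.mono fun s hs => (Γ.tgt_inv _).trans hs)
  have h3 := fderiv_comp_vel hL (g := g) (by rw [hκt, Γ.mul_unit]) (h1.mdifferentiableAt (by simp))
  have h4 := fderiv_comp_vel hL (g := h) (by rw [hκt, inv_unit, hgh, Γ.unit_mul])
    (h2.mdifferentiableAt (by simp))
  have h5 : fderiv ℝ (fun s => L (Γ.mul g (κ s)) + L (Γ.mul (Γ.inv (κ s)) h)) t = _ :=
    (h3.add h4).fderiv
  rw [h5]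
  rfl

theorem pullback₁_thetaMinus (L : G → ℝ) (ξ : G → G) (g : G) (X Y : EG) :
    Γ.pullback₁ ξ (thetaMinus L) g (X, Y) =
      - dAt L (ξ g) (Γ.dri (ξ g) (Γ.dl (Γ.inv g) g Y)) :=
  rfl

theorem d₀_eq (L : G → ℝ) (g : G)
    (u : TangentSpace 𝓘(ℝ, EG) g × TangentSpace 𝓘(ℝ, EG) g) :
    d₀ L g u = thetaPlus L g u - thetaMinus L g u := by
  have h1 : d₀ L g u = (dAt L g : EG →L[ℝ] ℝ) ((u.1 : EG) + (u.2 : EG)) := rfl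
  have h2 : thetaPlus L g u = (dAt L g : EG →L[ℝ] ℝ) (u.2 : EG) := rfl
  have h3 : thetaMinus L g u = - (dAt L g : EG →L[ℝ] ℝ) (u.1 : EG) := rfl
  have h4 : ((dAt L g : EG →L[ℝ] ℝ) (u.1 + u.2 : EG) : ℝ) = (dAt L g : EG →L[ℝ] ℝ) (u.1 : EG) + (dAt L g : EG →L[ℝ] ℝ) (u.2 : EG) := map_add _ _ _
  rw [h1, h2, h3, h4]
  ring

variable [CompleteSpace EG] [FiniteDimensional ℝ EM] [IsManifold 𝓘(ℝ, EG) ∞ G]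

/-- With `ψ` a parametrization of the `α`-fibre through `g`, the vector `T l_{g⁻¹} Y` is the
velocity of `κ = g⁻¹ ψ`. Since `g κ = ψ`, the first Euler–Lagrange term differentiates `L` along `Y`
itself. -/
theorem del_dl {L : G → ℝ} (hL : ContMDiff 𝓘(ℝ, EG) 𝓘(ℝ, ℝ) ∞ L) {g h : G}
    (hgh : Γ.tgt g = Γ.src h) {Y : EG} (hY : Y ∈ Γ.Vsrc g) :
    Γ.dl (Γ.inv g) g Y ∈ Γ.A (Γ.tgt g) ∧
    Γ.del L g h (Γ.dl (Γ.inv g) g Y) =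
      dAt L g Y + dAt L h (Γ.dri h (Γ.dl (Γ.inv g) g Y)) := by
  obtain ⟨ψ, hψ0, hψ, hψS, hψv⟩ := Γ.exists_src_param g
  have hS1 : ∀ᶠ s in 𝓝 0, Γ.src (ψ s) = Γ.tgt (Γ.inv g) :=
    hψS.mono fun s hs => hs.trans (Γ.tgt_inv g).symm
  have h1 : ContMDiffAt 𝓘(ℝ, EG) 𝓘(ℝ, EG) ∞ (fun s => Γ.mul (Γ.inv g) (ψ s)) 0 :=
    Γ.contMDiffAt_mul contMDiffAt_const hψ (hS1.mono fun s hs => hs.symm)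
  have hS2 : ∀ᶠ s in 𝓝 0, Γ.src (Γ.mul (Γ.inv g) (ψ s)) = Γ.tgt g :=
    hS1.mono fun s hs => by rw [Γ.src_mul _ _ hs.symm, Γ.src_inv]
  have h0 : Γ.mul (Γ.inv g) (ψ 0) = Γ.unit (Γ.tgt g) := by rw [hψ0, Γ.inv_mul]
  have hT := Γ.dl_vel hψ0 (Γ.tgt_inv g) (hψ.mdifferentiableAt (by simp)) hS1 Y
  rw [hψv Y hY] at hT
  have hgψ : (fun s => Γ.mul g (Γ.mul (Γ.inv g) (ψ s))) =ᶠ[𝓝 0] ψ :=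
    hψS.mono fun s hs => Γ.mul_inv_cancel_left hs.symm
  have hD := Γ.del_vel_eq hL (κ := fun s => Γ.mul (Γ.inv g) (ψ s)) h0 hgh h1 hS2 Y
  rw [hgψ.vel_eq, hψv Y hY, ← hT] at hD
  refine ⟨?_, hD⟩
  rw [hT]
  exact Γ.vel_mem_Vsrc (φ := fun s => Γ.mul (Γ.inv g) (ψ s)) h0 (h1.mdifferentiableAt (by simp)) hS2 Y

/-- Left translation by `g` inverts left translation by `g⁻¹`: if `κ` is a parametrization with
velocity `v`, the preimage is the velocity of `g κ`. -/
theorem exists_dl_inv_eq {g : G} {v : EG} (hv : v ∈ Γ.A (Γ.tgt g)) :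
    ∃ Y : EG, Y ∈ Γ.Vsrc g ∧ Γ.dl (Γ.inv g) g Y = v := by
  obtain ⟨κ, hκ0, hκ, hκS, hκv⟩ := Γ.exists_src_param (Γ.unit (Γ.tgt g))
  rw [Γ.src_unit] at hκS
  have h1 : ContMDiffAt 𝓘(ℝ, EG) 𝓘(ℝ, EG) ∞ (fun s => Γ.mul g (κ s)) 0 :=
    Γ.contMDiffAt_mul contMDiffAt_const hκ (hκS.mono fun s hs => hs.symm)
  have hS : ∀ᶠ s in 𝓝 0, Γ.src (Γ.mul g (κ s)) = Γ.src g :=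
    hκS.mono fun s hs => Γ.src_mul _ _ hs.symm
  have h0 : Γ.mul g (κ 0) = g := by rw [hκ0, Γ.mul_unit]
  refine ⟨(vel (fun s => Γ.mul g (κ s)) 0 : EG →L[ℝ] EG) v,
    Γ.vel_mem_Vsrc (φ := fun s => Γ.mul g (κ s)) h0 (h1.mdifferentiableAt (by simp)) hS v, ?_⟩
  rw [Γ.dl_vel (φ := fun s => Γ.mul g (κ s)) h0 (Γ.tgt_inv g) (h1.mdifferentiableAt (by simp))
    (hS.mono fun s hs => hs.trans (Γ.tgt_inv g).symm)]
  have hgκ : (fun s => Γ.mul (Γ.inv g) (Γ.mul g (κ s))) =ᶠ[𝓝 0] κ :=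
    hκS.mono fun s hs => Γ.inv_mul_cancel_left hs.symm
  rw [hgκ.vel_eq, hκv v hv]

/-- A second order operator is an evolution operator if and only if it pulls back `Θ⁻` to `Θ⁺`. -/
theorem isEvolutionOperator_iff_pullback {L : G → ℝ} (hL : ContMDiff 𝓘(ℝ, EG) 𝓘(ℝ, ℝ) ∞ L)
    (ξ : G → G) :
    Γ.IsEvolutionOperator L ξ ↔ Γ.IsSecondOrder ξ ∧ ∀ g, ∀ u ∈ Γ.fibre g,
      Γ.pullback₁ ξ (thetaMinus L) g u = thetaPlus L g u := by
  constructor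
  · intro h
    refine ⟨h.toIsSecondOrder, fun g u hu => ?_⟩
    obtain ⟨X, Y⟩ := u
    have h1 := Γ.del_dl hL (h.composable g) hu.2
    have h2 := h.eulerLagrange g _ h1.1
    have h3 := Γ.pullback₁_thetaMinus L ξ g X Y
    have h4 : thetaPlus L g (X, Y) = (dAt L g : EG →L[ℝ] ℝ) Y := rfl
    have h5 := h1.2.symm.trans h2
    refine h3.trans (Eq.trans ?_ h4.symm)
    linarith
  · rintro ⟨h, hp⟩
    refine { h with eulerLagrange := fun g v hv => ?_ }
    obtain ⟨Y, hY, rfl⟩ := Γ.exists_dl_inv_eq hv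
    have h1 := Γ.del_dl hL (h.composable g) hY
    refine h1.2.trans ?_
    -- Neither side depends on the `β`-vertical component, so it may be taken to be zero.
    have h2 := hp g ((0 : EG), Y) ⟨Submodule.zero_mem _, hY⟩
    have h3 := Γ.pullback₁_thetaMinus L ξ g 0 Y
    have h4 : thetaPlus L g ((0 : EG), Y) = (dAt L g : EG →L[ℝ] ℝ) Y := rfl
    have h5 := h3.symm.trans (h2.trans h4)
    linarith

theorem isEvolutionOperator_iff_pullback_sub {L : G → ℝ}
    (hL : ContMDiff 𝓘(ℝ, EG) 𝓘(ℝ, ℝ) ∞ L) (ξ : G → G) :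
    Γ.IsEvolutionOperator L ξ ↔ Γ.IsSecondOrder ξ ∧ ∀ g, ∀ u ∈ Γ.fibre g,
      Γ.pullback₁ ξ (thetaMinus L) g u - thetaMinus L g u = d₀ L g u := by
  rw [Γ.isEvolutionOperator_iff_pullback hL ξ]
  simp only [d₀_eq, sub_left_inj]

end EulerLagrange

end LieGroupoid

/-! ### Mixed second derivatives with exchanged variables, and the chain rule for velocities. -/

section SecondDerivative

variable {E₁ E₂ F₁ F₂ : Type*} [NormedAddCommGroup E₁] [NormedSpace ℝ E₁]
  [NormedAddCommGroup E₂] [NormedSpace ℝ E₂] [NormedAddCommGroup F₁] [NormedSpace ℝ F₁]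
  [NormedAddCommGroup F₂] [NormedSpace ℝ F₂]

theorem fderiv_fderiv_comp_clm {f : F₁ → ℝ} (T : E₁ →L[ℝ] F₁) {x : E₁}
    (hf : ContDiffAt ℝ ∞ f (T x)) (v w : E₁) :
    fderiv ℝ (fderiv ℝ fun y => f (T y)) x v w = fderiv ℝ (fderiv ℝ f) (T x) (T v) (T w) := by
  have h1 : fderiv ℝ (fun y => f (T y)) =ᶠ[𝓝 x]
      fun y => ((ContinuousLinearMap.compL ℝ E₁ F₁ ℝ).flip T) (fderiv ℝ f (T y)) := by
    filter_upwards [T.continuous.continuousAt.eventually hf.eventually_differentiableAt] with y hy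
    exact (hy.hasFDerivAt.comp y T.hasFDerivAt).fderiv
  have h2 : HasFDerivAt (fun y => ((ContinuousLinearMap.compL ℝ E₁ F₁ ℝ).flip T) (fderiv ℝ f (T y)))
      (((ContinuousLinearMap.compL ℝ E₁ F₁ ℝ).flip T).comp
        ((fderiv ℝ (fderiv ℝ f) (T x)).comp T)) x :=
    ((ContinuousLinearMap.compL ℝ E₁ F₁ ℝ).flip T).hasFDerivAt.comp x
      (hf.hasFDerivAt_fderiv.comp x T.hasFDerivAt)
  rw [(h2.congr_of_eventuallyEq h1).fderiv]
  rfl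

/-- Needed for the term at `ξ g`, where the path variable `t` enters the first slot of `N'` and the
parameters `p` the second. It follows from the unswapped version by symmetry of second derivatives.
-/
theorem fderiv_fderiv_comp_prodMap_swap {N : F₁ × F₂ → ℝ} {φ : E₁ → F₁} {ψ : E₂ → F₂}
    {s₀ : E₁} {t₀ : E₂} (hN : ContDiffAt ℝ ∞ N (φ s₀, ψ t₀)) (hφ : ContDiffAt ℝ ∞ φ s₀)
    (hψ : ContDiffAt ℝ ∞ ψ t₀) (a : E₂) (b : E₁) :
    fderiv ℝ (fderiv ℝ fun p : E₂ × E₁ => N (φ p.2, ψ p.1)) (t₀, s₀) (a, 0) (0, b) =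
      fderiv ℝ (fderiv ℝ N) (φ s₀, ψ t₀) (fderiv ℝ φ s₀ b, 0) (0, fderiv ℝ ψ t₀ a) := by
  have hF : ContDiffAt ℝ ∞ (fun p : E₁ × E₂ => N (φ p.1, ψ p.2)) (s₀, t₀) :=
    hN.comp (f := fun p : E₁ × E₂ => (φ p.1, ψ p.2)) (s₀, t₀)
      ((hφ.comp (s₀, t₀) contDiffAt_fst).prodMk (hψ.comp (s₀, t₀) contDiffAt_snd))
  rw [← fderiv_fderiv_comp_prodMap hN hφ hψ, hF.fderiv_fderiv_comm]
  exact fderiv_fderiv_comp_clm (f := fun p : E₁ × E₂ => N (φ p.1, ψ p.2)) (x := (t₀, s₀))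
    ((ContinuousLinearMap.snd ℝ E₂ E₁).prod (ContinuousLinearMap.fst ℝ E₂ E₁)) hF (a, 0) (0, b)

variable {N : Type*} [TopologicalSpace N] [ChartedSpace F₁ N]

theorem vel_comp {γ : E₂ → N} {f : E₁ → E₂} {t : E₁} {f' : E₁ →L[ℝ] E₂} {x : E₂} (hx : f t = x)
    (hγ : MDifferentiableAt 𝓘(ℝ, E₂) 𝓘(ℝ, F₁) γ x) (hf : HasFDerivAt f f' t) (v : E₁) :
    (vel (fun s => γ (f s)) t : E₁ →L[ℝ] F₁) v = vel γ x (f' v) := by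
  rw [← mfderiv_vel hx hγ hf.differentiableAt.mdifferentiableAt v, vel_eq_fderiv, hf.fderiv]
  rfl

end SecondDerivative

/-! ### Invariance of the mixed second derivatives under an evolution operator. -/

namespace LieGroupoid

variable {EG EM G M : Type*}
    [NormedAddCommGroup EG] [NormedSpace ℝ EG] [NormedAddCommGroup EM] [NormedSpace ℝ EM]
    [TopologicalSpace G] [ChartedSpace EG G] [TopologicalSpace M] [ChartedSpace EM M]
    (Γ : LieGroupoid EG EM G M)

/-- `N` represents, in the chart at `g`, the function `(h, s) ↦ L (h g⁻¹ s)` on the product of the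
`β`-fibre and the `α`-fibre through `g`. -/
structure IsFibreRep (L : G → ℝ) (g : G) (N : EG × EG → ℝ) : Prop where
  smooth : ContDiffAt ℝ ∞ N (extChartAt 𝓘(ℝ, EG) g g, extChartAt 𝓘(ℝ, EG) g g)
  eq : ∀ᶠ p : G × G in 𝓝 (g, g), Γ.tgt p.1 = Γ.tgt g → Γ.src p.2 = Γ.src g →
    N (extChartAt 𝓘(ℝ, EG) g p.1, extChartAt 𝓘(ℝ, EG) g p.2) =
      L (Γ.mul p.1 (Γ.mul (Γ.inv g) p.2))

variable [CompleteSpace EG] [FiniteDimensional ℝ EM] [IsManifold 𝓘(ℝ, EG) ∞ G]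

/-- The prolongation of `ξ` preserves the fibres, and the mixed second derivatives of `(h, s) ↦ L (h g⁻¹ s)` and of `(h, s) ↦ L (h (ξ g)⁻¹ s)` are
related by a discrete evolution operator `ξ`. -/
theorem IsEvolutionOperator.mixed_eq {Γ : LieGroupoid EG EM G M} {L : G → ℝ}
    (hL : ContMDiff 𝓘(ℝ, EG) 𝓘(ℝ, ℝ) ∞ L) {ξ : G → G} (hξ : Γ.IsEvolutionOperator L ξ) {g : G}
    {N N' : EG × EG → ℝ} (hN : Γ.IsFibreRep L g N) (hN' : Γ.IsFibreRep L (ξ g) N')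
    {X Y X' Y' w w' Z Z' : EG} (hX : X ∈ Γ.Vtgt g) (hY : Y ∈ Γ.Vsrc g) (hX' : X' ∈ Γ.Vtgt g)
    (hY' : Y' ∈ Γ.Vsrc g) (hw : w = Γ.dri (ξ g) (Γ.dl (Γ.inv g) g Y))
    (hw' : w' = Γ.dri (ξ g) (Γ.dl (Γ.inv g) g Y')) (hZ : Z = dAt ξ g (X + Y))
    (hZ' : Z' = dAt ξ g (X' + Y')) :
    w ∈ Γ.Vtgt (ξ g) ∧ Z - w ∈ Γ.Vsrc (ξ g) ∧
    fderiv ℝ (fderiv ℝ N') (extChartAt 𝓘(ℝ, EG) (ξ g) (ξ g), extChartAt 𝓘(ℝ, EG) (ξ g) (ξ g))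
        (w', 0) (0, Z - w) -
      fderiv ℝ (fderiv ℝ N') (extChartAt 𝓘(ℝ, EG) (ξ g) (ξ g), extChartAt 𝓘(ℝ, EG) (ξ g) (ξ g))
        (w, 0) (0, Z' - w') =
    fderiv ℝ (fderiv ℝ N) (extChartAt 𝓘(ℝ, EG) g g, extChartAt 𝓘(ℝ, EG) g g) (X', 0) (0, Y) -
      fderiv ℝ (fderiv ℝ N) (extChartAt 𝓘(ℝ, EG) g g, extChartAt 𝓘(ℝ, EG) g g) (X, 0) (0, Y') := by
  obtain ⟨φ, hφ0, hφ, hφS, hφv⟩ := Γ.exists_tgt_param g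
  obtain ⟨ψ, hψ0, hψ, hψS, hψv⟩ := Γ.exists_src_param g
  have hm : Γ.tgt g = Γ.src (ξ g) := hξ.composable g
  -- the path `κ = g⁻¹ ψ` through the unit
  obtain ⟨κ, hκdef⟩ : ∃ κ : EG → G, κ = fun t => Γ.mul (Γ.inv g) (ψ t) := ⟨_, rfl⟩
  have hψS' : ∀ᶠ t in 𝓝 0, Γ.src (ψ t) = Γ.tgt (Γ.inv g) :=
    hψS.mono fun s hs => hs.trans (Γ.tgt_inv g).symm
  have hκ : ContMDiffAt 𝓘(ℝ, EG) 𝓘(ℝ, EG) ∞ κ 0 := by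
    rw [hκdef]
    exact Γ.contMDiffAt_mul contMDiffAt_const hψ (hψS'.mono fun s hs => hs.symm)
  have hκS : ∀ᶠ t in 𝓝 0, Γ.src (κ t) = Γ.tgt g := by
    filter_upwards [hψS'] with t ht
    rw [hκdef, Γ.src_mul _ _ ht.symm, Γ.src_inv]
  have hκ0 : κ 0 = Γ.unit (Γ.tgt g) := by rw [hκdef]; simp only [hψ0, Γ.inv_mul]
  have hκv : ∀ v : EG, v ∈ Γ.Vsrc g → vel κ 0 v = Γ.dl (Γ.inv g) g v := by
    intro v hv
    have h := Γ.dl_vel hψ0 (Γ.tgt_inv g) (hψ.mdifferentiableAt (by simp)) hψS' v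
    rw [hψv v hv] at h
    rw [h, hκdef]
  have fst_tendsto : Tendsto (Prod.fst : EG × EG → EG) (𝓝 0) (𝓝 0) :=
    continuous_fst.tendsto (0 : EG × EG)
  have snd_tendsto : Tendsto (Prod.snd : EG × EG → EG) (𝓝 0) (𝓝 0) :=
    continuous_snd.tendsto (0 : EG × EG)
  have hφ1 : ContMDiffAt 𝓘(ℝ, EG × EG) 𝓘(ℝ, EG) ∞ (fun p : EG × EG => φ p.1) 0 :=
    ContMDiffAt.comp (g := φ) (f := Prod.fst) (0 : EG × EG) hφ contDiff_fst.contDiffAt.contMDiffAt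
  have hκ2 : ContMDiffAt 𝓘(ℝ, EG × EG) 𝓘(ℝ, EG) ∞ (fun p : EG × EG => κ p.2) 0 :=
    ContMDiffAt.comp (g := κ) (f := Prod.snd) (0 : EG × EG) hκ contDiff_snd.contDiffAt.contMDiffAt
  have hκ1 : ContMDiffAt 𝓘(ℝ, EG × EG) 𝓘(ℝ, EG) ∞ (fun p : EG × EG => κ p.1) 0 :=
    ContMDiffAt.comp (g := κ) (f := Prod.fst) (0 : EG × EG) hκ contDiff_fst.contDiffAt.contMDiffAt
  -- the surface `γ = φ κ` through `g`
  obtain ⟨γ, hγdef⟩ : ∃ γ : EG × EG → G, γ = fun p => Γ.mul (φ p.1) (κ p.2) := ⟨_, rfl⟩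
  have hγc : ∀ᶠ p : EG × EG in 𝓝 0, Γ.tgt (φ p.1) = Γ.src (κ p.2) := by
    filter_upwards [fst_tendsto.eventually hφS, snd_tendsto.eventually hκS] with p h1 h2
    rw [h1, h2]
  have hγ : ContMDiffAt 𝓘(ℝ, EG × EG) 𝓘(ℝ, EG) ∞ γ 0 := by
    rw [hγdef]; exact Γ.contMDiffAt_mul hφ1 hκ2 hγc
  have hγt : ∀ᶠ p : EG × EG in 𝓝 0, Γ.tgt (γ p) = Γ.tgt (κ p.2) := by
    filter_upwards [hγc] with p h1
    rw [hγdef, Γ.tgt_mul _ _ h1]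
  have hγ0 : γ 0 = g := by
    rw [hγdef]; simp only [Prod.fst_zero, Prod.snd_zero, hφ0, hκ0, Γ.mul_unit]
  have hγv : ∀ a b : EG, a ∈ Γ.Vtgt g → b ∈ Γ.Vsrc g → vel γ 0 (a, b) = a + b := by
    intro a b ha hb
    have h1 := vel_comp (γ := γ) (f := fun s : EG => (s, (0 : EG))) (t := 0) rfl
      (hγ.mdifferentiableAt (by simp))
      ((hasFDerivAt_id (𝕜 := ℝ) (0 : EG)).prodMk (hasFDerivAt_const (0 : EG) (0 : EG))) a
    have h2 := vel_comp (γ := γ) (f := fun s : EG => ((0 : EG), s)) (t := 0) rfl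
      (hγ.mdifferentiableAt (by simp))
      ((hasFDerivAt_const (0 : EG) (0 : EG)).prodMk (hasFDerivAt_id (𝕜 := ℝ) (0 : EG))) b
    have h3 : (fun s : EG => γ (s, 0)) =ᶠ[𝓝 0] φ := by
      filter_upwards [hφS] with s hs
      rw [hγdef]
      simp only [hκ0]
      rw [← hs, Γ.mul_unit]
    have h4 : (fun s : EG => γ (0, s)) =ᶠ[𝓝 0] ψ := by
      filter_upwards [hψS] with s hs
      rw [hγdef, hκdef]
      simp only [hφ0]
      exact Γ.mul_inv_cancel_left hs.symm
    rw [h3.vel_eq, hφv a ha] at h1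
    rw [h4.vel_eq, hψv b hb] at h2
    have h5 : ((a, b) : EG × EG) = (a, 0) + (0, b) := by simp
    rw [h5, map_add]
    exact congrArg₂ (· + ·) h1.symm h2.symm
  -- its image `χ` under `ξ`, and `χ₂ = κ χ` in the `α`-fibre of `ξ g`
  have hχ : ContMDiffAt 𝓘(ℝ, EG × EG) 𝓘(ℝ, EG) ∞ (fun p => ξ (γ p)) 0 :=
    hξ.smooth.contMDiffAt.comp 0 hγ
  have hχv : ∀ a b : EG, a ∈ Γ.Vtgt g → b ∈ Γ.Vsrc g →
      (vel (fun p : EG × EG => ξ (γ p)) 0 : EG × EG →L[ℝ] EG) (a, b) = dAt ξ g (a + b) := by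
    intro a b ha hb
    rw [← hγv a b ha hb]
    exact (mfderiv_vel hγ0 (hξ.smooth.contMDiffAt.mdifferentiableAt (by simp))
      (hγ.mdifferentiableAt (by simp)) (a, b)).symm
  obtain ⟨χ₂, hχ₂def⟩ : ∃ χ₂ : EG × EG → G, χ₂ = fun p => Γ.mul (κ p.2) (ξ (γ p)) := ⟨_, rfl⟩
  have hχ₂c : ∀ᶠ p : EG × EG in 𝓝 0, Γ.tgt (κ p.2) = Γ.src (ξ (γ p)) :=
    hγt.mono fun p hp => by rw [← hp, hξ.composable]
  have hχ₂ : ContMDiffAt 𝓘(ℝ, EG × EG) 𝓘(ℝ, EG) ∞ χ₂ 0 := by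
    rw [hχ₂def]; exact Γ.contMDiffAt_mul hκ2 hχ hχ₂c
  have hχ₂S : ∀ᶠ p : EG × EG in 𝓝 0, Γ.src (χ₂ p) = Γ.tgt g := by
    filter_upwards [hχ₂c, snd_tendsto.eventually hκS] with p h1 h2
    rw [hχ₂def, Γ.src_mul _ _ h1, h2]
  have hχ₂0 : χ₂ 0 = ξ g := by
    rw [hχ₂def]; simp only [Prod.snd_zero, hκ0, hγ0]; rw [hm, Γ.unit_mul]
  -- This map stays in the `β`-fibre of `ξ g`, and by construction its velocity on `Y` is the
  -- prolongation component `w`.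
  obtain ⟨φ₂, hφ₂def⟩ : ∃ φ₂ : EG → G, φ₂ = fun t => Γ.mul (Γ.inv (κ t)) (ξ g) := ⟨_, rfl⟩
  have hφ₂c : ∀ᶠ t in 𝓝 0, Γ.tgt (Γ.inv (κ t)) = Γ.src (ξ g) :=
    hκS.mono fun t ht => by rw [Γ.tgt_inv, ht, hm]
  have hφ₂ : ContMDiffAt 𝓘(ℝ, EG) 𝓘(ℝ, EG) ∞ φ₂ 0 := by
    rw [hφ₂def]; exact Γ.contMDiffAt_mul (Γ.contMDiffAt_inv hκ) contMDiffAt_const hφ₂c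
  have hφ₂t : ∀ᶠ t in 𝓝 0, Γ.tgt (φ₂ t) = Γ.tgt (ξ g) :=
    hφ₂c.mono fun t ht => by rw [hφ₂def, Γ.tgt_mul _ _ ht]
  have hφ₂0 : φ₂ 0 = ξ g := by
    rw [hφ₂def]; simp only [hκ0, inv_unit]; rw [hm, Γ.unit_mul]
  have hφ₂v : ∀ v : EG, v ∈ Γ.Vsrc g → vel φ₂ 0 v = Γ.dri (ξ g) (Γ.dl (Γ.inv g) g v) := by
    intro v hv
    rw [← hκv v hv, Γ.dri_vel (by rw [hκ0, hm]) (hκ.mdifferentiableAt (by simp)) (hm ▸ hκS), hφ₂def]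
  have hχ₂v : ∀ a b : EG, a ∈ Γ.Vtgt g → b ∈ Γ.Vsrc g →
      vel χ₂ 0 (a, b) = dAt ξ g (a + b) - Γ.dri (ξ g) (Γ.dl (Γ.inv g) g b) := by
    intro a b ha hb
    -- The velocity of `χ₂` comes from differentiating `κ(p₂)⁻¹ χ₂(p) = ξ(γ p)`. By the product rule
    -- the left side gives `w` plus the velocity of `χ₂`, and the right side gives `Tξ(a + b)`.
    have hq : ContMDiffAt 𝓘(ℝ, EG × (EG × EG)) 𝓘(ℝ, EG) ∞
        (fun q : EG × (EG × EG) => Γ.mul (Γ.inv (κ q.1)) (χ₂ q.2)) 0 := by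
      refine Γ.contMDiffAt_mul (Γ.contMDiffAt_inv (ContMDiffAt.comp (g := κ) (f := Prod.fst)
        (0 : EG × (EG × EG)) hκ contDiff_fst.contDiffAt.contMDiffAt)) (ContMDiffAt.comp (g := χ₂)
        (f := Prod.snd) (0 : EG × (EG × EG)) hχ₂ contDiff_snd.contDiffAt.contMDiffAt) ?_
      filter_upwards [(continuous_fst.tendsto (0 : EG × (EG × EG))).eventually hκS,
        (continuous_snd.tendsto (0 : EG × (EG × EG))).eventually hχ₂S] with q h1 h2
      rw [Γ.tgt_inv, h1, h2]
    have hq' := hq.mdifferentiableAt (by simp)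
    have h1 := vel_comp (f := fun s : EG => (s, (0 : EG × EG))) (t := 0) rfl hq'
      ((hasFDerivAt_id (𝕜 := ℝ) (0 : EG)).prodMk (hasFDerivAt_const (0 : EG × EG) (0 : EG))) b
    have h2 := vel_comp (f := fun s : EG × EG => ((0 : EG), s)) (t := 0) rfl hq'
      ((hasFDerivAt_const (0 : EG) (0 : EG × EG)).prodMk
        (hasFDerivAt_id (𝕜 := ℝ) (0 : EG × EG))) (a, b)
    have h3 := vel_comp (f := fun s : EG × EG => (s.2, s)) (t := 0) rfl hq'
      ((hasFDerivAt_snd (𝕜 := ℝ) (p := (0 : EG × EG))).prodMk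
        (hasFDerivAt_id (𝕜 := ℝ) (0 : EG × EG))) (a, b)
    have h4 : (fun s : EG => Γ.mul (Γ.inv (κ s)) (χ₂ 0)) = φ₂ := by
      rw [hχ₂0, hφ₂def]
    have h5 : (fun s : EG × EG => Γ.mul (Γ.inv (κ 0)) (χ₂ s)) =ᶠ[𝓝 0] χ₂ := by
      filter_upwards [hχ₂S] with s hs
      rw [hκ0, inv_unit, ← hs, Γ.unit_mul]
    have h6 : (fun s : EG × EG => Γ.mul (Γ.inv (κ s.2)) (χ₂ s)) =ᶠ[𝓝 0] fun p => ξ (γ p) := by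
      filter_upwards [hχ₂c] with s hs
      rw [hχ₂def]
      exact Γ.inv_mul_cancel_left hs
    simp only at h1 h2 h3
    rw [h4, hφ₂v b hb] at h1
    rw [h5.vel_eq] at h2
    rw [h6.vel_eq, hχv a b ha hb] at h3
    have h7 : ((b, (a, b)) : EG × (EG × EG)) = (b, 0) + (0, (a, b)) := by simp
    rw [h1, h2, h3, eq_sub_iff_add_eq']
    exact (map_add _ _ _).symm.trans (congrArg _ h7.symm)
  -- the function with critical points along the diagonal
  obtain ⟨Φ₁, hΦ₁def⟩ : ∃ Φ₁ : (EG × EG) × EG → ℝ, Φ₁ = fun q =>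
    N (extChartAt 𝓘(ℝ, EG) g (φ q.1.1), extChartAt 𝓘(ℝ, EG) g (ψ q.2)) := ⟨_, rfl⟩
  obtain ⟨Φ₂, hΦ₂def⟩ : ∃ Φ₂ : (EG × EG) × EG → ℝ, Φ₂ = fun q =>
    N' (extChartAt 𝓘(ℝ, EG) (ξ g) (φ₂ q.2), extChartAt 𝓘(ℝ, EG) (ξ g) (χ₂ q.1)) := ⟨_, rfl⟩
  have cφ : ContDiffAt ℝ ∞ (fun p : EG × EG => extChartAt 𝓘(ℝ, EG) g (φ p.1)) 0 :=
    ContMDiffAt.contDiffAt_extChartAt_comp hφ0 hφ1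
  have cψ := ContMDiffAt.contDiffAt_extChartAt_comp hψ0 hψ
  have cφ₂ := ContMDiffAt.contDiffAt_extChartAt_comp hφ₂0 hφ₂
  have cχ₂ := ContMDiffAt.contDiffAt_extChartAt_comp hχ₂0 hχ₂
  have hNs : ContDiffAt ℝ ∞ N (extChartAt 𝓘(ℝ, EG) g (φ (0 : EG × EG).1),
      extChartAt 𝓘(ℝ, EG) g (ψ 0)) := by
    rw [Prod.fst_zero, hφ0, hψ0]; exact hN.smooth
  have hN's : ContDiffAt ℝ ∞ N' (extChartAt 𝓘(ℝ, EG) (ξ g) (φ₂ 0),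
      extChartAt 𝓘(ℝ, EG) (ξ g) (χ₂ 0)) := by
    rw [hφ₂0, hχ₂0]; exact hN'.smooth
  have hΦ₁ : ContDiffAt ℝ ∞ Φ₁ 0 := by
    rw [hΦ₁def]
    exact hNs.comp (f := fun q : (EG × EG) × EG => (extChartAt 𝓘(ℝ, EG) g (φ q.1.1),
      extChartAt 𝓘(ℝ, EG) g (ψ q.2))) 0 ((cφ.comp (0 : (EG × EG) × EG) contDiffAt_fst).prodMk
        (cψ.comp (0 : (EG × EG) × EG) contDiffAt_snd))
  have hΦ₂ : ContDiffAt ℝ ∞ Φ₂ 0 := by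
    rw [hΦ₂def]
    exact hN's.comp (f := fun q : (EG × EG) × EG => (extChartAt 𝓘(ℝ, EG) (ξ g) (φ₂ q.2),
      extChartAt 𝓘(ℝ, EG) (ξ g) (χ₂ q.1))) 0
        ((cφ₂.comp (0 : (EG × EG) × EG) contDiffAt_snd).prodMk
        (cχ₂.comp (0 : (EG × EG) × EG) contDiffAt_fst))
  have fst_tendsto' : Tendsto (Prod.fst : (EG × EG) × EG → EG × EG) (𝓝 0) (𝓝 0) :=
    continuous_fst.tendsto (0 : (EG × EG) × EG)
  have snd_tendsto' : Tendsto (Prod.snd : (EG × EG) × EG → EG) (𝓝 0) (𝓝 0) :=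
    continuous_snd.tendsto (0 : (EG × EG) × EG)
  -- In both representatives the middle factor cancels: `φ g⁻¹ ψ = φ κ`, and `φ₂ (ξ g)⁻¹ χ₂ = κ⁻¹
  -- χ₂`.
  have hrep : ∀ᶠ q : (EG × EG) × EG in 𝓝 0, Φ₁ q + Φ₂ q =
      L (Γ.mul (φ q.1.1) (κ q.2)) + L (Γ.mul (Γ.inv (κ q.2)) (χ₂ q.1)) := by
    have t1 : Tendsto (fun q : (EG × EG) × EG => (φ q.1.1, ψ q.2)) (𝓝 0) (𝓝 (g, g)) := by
      have h1 := hφ1.continuousAt.tendsto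
      have h2 := hψ.continuousAt.tendsto
      rw [Prod.fst_zero, hφ0] at h1
      rw [hψ0] at h2
      exact (h1.comp fst_tendsto').prodMk_nhds (h2.comp snd_tendsto')
    have t2 : Tendsto (fun q : (EG × EG) × EG => (φ₂ q.2, χ₂ q.1)) (𝓝 0) (𝓝 (ξ g, ξ g)) := by
      have h1 := hφ₂.continuousAt.tendsto
      have h2 := hχ₂.continuousAt.tendsto
      rw [hφ₂0] at h1
      rw [hχ₂0] at h2
      exact (h1.comp snd_tendsto').prodMk_nhds (h2.comp fst_tendsto')
    filter_upwards [t1.eventually hN.eq, t2.eventually hN'.eq,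
      (fst_tendsto.comp fst_tendsto').eventually hφS, snd_tendsto'.eventually hψS,
      snd_tendsto'.eventually hφ₂t, snd_tendsto'.eventually hφ₂c,
      fst_tendsto'.eventually hχ₂S] with q e1 e2 h1 h2 h3 h4 h5
    have h6 : Γ.src (χ₂ q.1) = Γ.src (ξ g) := h5.trans hm
    rw [hΦ₁def, hΦ₂def]
    simp only
    rw [e1 h1 h2, e2 h3 h6, hκdef, hφ₂def]
    simp only [hκdef] at h4 ⊢
    rw [← Γ.mul_assoc _ _ _ h4 (by rw [Γ.src_mul _ _ ((Γ.tgt_inv _).trans h6.symm), Γ.src_inv]),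
      Γ.mul_inv_cancel_left h6.symm]
  -- The Euler–Lagrange equation is used at `γ p`, along `t ↦ κ(p₂)⁻¹ κ(t)`, which passes through
  -- the unit at `t = p₂`. Left translation by `γ p` gives `φ(p₁) κ(t)`. Inverting and multiplying
  -- by `ξ(γ p)` gives `κ(t)⁻¹ χ₂(p)`.
  have hcrit : ∀ᶠ p : EG × EG in 𝓝 0, ∀ b : EG,
      fderiv ℝ (fun q => Φ₁ q + Φ₂ q) (p, ContinuousLinearMap.snd ℝ EG EG p) (0, b) = 0 := by
    have tdiag : Tendsto (fun p : EG × EG => (p, p.2)) (𝓝 0) (𝓝 (0 : (EG × EG) × EG)) :=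
      (continuous_id.prodMk continuous_snd).tendsto (0 : EG × EG)
    have tdiag' : Tendsto (fun p : EG × EG => (p.2, p.2)) (𝓝 0) (𝓝 (0 : EG × EG)) :=
      (continuous_snd.prodMk continuous_snd).tendsto (0 : EG × EG)
    have hk : ContMDiffAt 𝓘(ℝ, EG × EG) 𝓘(ℝ, EG) ∞
        (fun p : EG × EG => Γ.mul (Γ.inv (κ p.1)) (κ p.2)) 0 := by
      refine Γ.contMDiffAt_mul (Γ.contMDiffAt_inv hκ1) hκ2 ?_
      filter_upwards [fst_tendsto.eventually hκS, snd_tendsto.eventually hκS] with p h1 h2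
      rw [Γ.tgt_inv, h1, h2]
    filter_upwards [tdiag.eventually hrep.eventually_nhds,
      tdiag.eventually (hΦ₁.add hΦ₂).eventually_differentiableAt,
      tdiag'.eventually hk.eventually_mdifferentiableAt,
      snd_tendsto.eventually hκS.eventually_nhds, fst_tendsto.eventually hφS, hγt, hχ₂c]
      with p hp1 hp2 hp3 hp4 hp5 hp6 hp7 b
    have hpS : Γ.src (κ p.2) = Γ.tgt g := hp4.self_of_nhds
    have hι : HasFDerivAt (fun t : EG => (p, t)) (ContinuousLinearMap.inr ℝ (EG × EG) EG) p.2 :=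
      (hasFDerivAt_const p p.2).prodMk (hasFDerivAt_id p.2)
    have hd : HasFDerivAt (fun t => Φ₁ (p, t) + Φ₂ (p, t))
        ((fderiv ℝ (fun q => Φ₁ q + Φ₂ q) (p, p.2)).comp
          (ContinuousLinearMap.inr ℝ (EG × EG) EG)) p.2 :=
      HasFDerivAt.comp (g := fun q => Φ₁ q + Φ₂ q) p.2 hp2.hasFDerivAt hι
    have hkt : MDifferentiableAt 𝓘(ℝ, EG) 𝓘(ℝ, EG)
        (fun t => Γ.mul (Γ.inv (κ p.2)) (κ t)) p.2 := by
      have hι' : HasFDerivAt (fun t : EG => (p.2, t)) (ContinuousLinearMap.inr ℝ EG EG) p.2 :=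
        (hasFDerivAt_const p.2 p.2).prodMk (hasFDerivAt_id p.2)
      exact MDifferentiableAt.comp (g := fun p : EG × EG => Γ.mul (Γ.inv (κ p.1)) (κ p.2)) p.2 hp3
        hι'.differentiableAt.mdifferentiableAt
    have hkc : ∀ᶠ t in 𝓝 p.2, Γ.tgt (Γ.inv (κ p.2)) = Γ.src (κ t) :=
      hp4.mono fun t ht => by rw [Γ.tgt_inv, ht, hpS]
    have hk0 : Γ.mul (Γ.inv (κ p.2)) (κ p.2) = Γ.unit (Γ.tgt (γ p)) := by
      rw [Γ.inv_mul, hp6]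
    have hkS : ∀ᶠ t in 𝓝 p.2, Γ.src (Γ.mul (Γ.inv (κ p.2)) (κ t)) = Γ.tgt (γ p) :=
      hkc.mono fun t ht => by rw [Γ.src_mul _ _ ht, Γ.src_inv, hp6]
    have hdel := Γ.del_vel (φ := fun t => Γ.mul (Γ.inv (κ p.2)) (κ t)) hL hk0
      (hξ.composable (γ p)) hkt hkS b
    have hzero : Γ.del L (γ p) (ξ (γ p))
        ((vel (fun t => Γ.mul (Γ.inv (κ p.2)) (κ t)) p.2 : EG →L[ℝ] EG) b) = 0 :=
      hξ.eulerLagrange (γ p) _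
        (Γ.vel_mem_Vsrc (φ := fun t => Γ.mul (Γ.inv (κ p.2)) (κ t)) hk0 hkt hkS b)
    have hcongr : (fun t => Φ₁ (p, t) + Φ₂ (p, t)) =ᶠ[𝓝 p.2]
        fun t => L (Γ.mul (γ p) (Γ.mul (Γ.inv (κ p.2)) (κ t))) +
          L (Γ.mul (Γ.inv (Γ.mul (Γ.inv (κ p.2)) (κ t))) (ξ (γ p))) := by
      have hrep' := hι.continuousAt.eventually hp1
      filter_upwards [hrep', hkc, hp4] with t h1 h2 h3
      rw [h1]
      have h4 : Γ.mul (γ p) (Γ.mul (Γ.inv (κ p.2)) (κ t)) = Γ.mul (φ p.1) (κ t) := by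
        rw [hγdef]
        simp only
        rw [← Γ.mul_assoc _ _ _ (by rw [hp5, hpS])
          (by rw [Γ.src_mul _ _ h2, Γ.src_inv]), Γ.mul_inv_cancel_left (by rw [hpS, h3])]
      have h5 : Γ.mul (Γ.inv (Γ.mul (Γ.inv (κ p.2)) (κ t))) (ξ (γ p)) =
          Γ.mul (Γ.inv (κ t)) (χ₂ p) := by
        rw [Γ.inv_mul_rev h2, Γ.inv_inv, hχ₂def,
          Γ.mul_assoc _ _ _ (by rw [Γ.tgt_inv, hpS, h3]) hp7]
      rw [h4, h5]
    rw [hzero, ← hcongr.fderiv_eq, hd.fderiv] at hdel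
    exact hdel.symm
  have hsymm := fderiv_fderiv_symm_of_critical (ContinuousLinearMap.snd ℝ EG EG) (hΦ₁.add hΦ₂)
    hcrit (X, Y) (X', Y')
  have hsum : ∀ a b, fderiv ℝ (fderiv ℝ fun q => Φ₁ q + Φ₂ q) 0 a b =
      fderiv ℝ (fderiv ℝ Φ₁) 0 a b + fderiv ℝ (fderiv ℝ Φ₂) 0 a b := by
    intro a b
    have h1 : fderiv ℝ (fun q => Φ₁ q + Φ₂ q) =ᶠ[𝓝 0] fun q => fderiv ℝ Φ₁ q + fderiv ℝ Φ₂ q := by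
      filter_upwards [hΦ₁.eventually_differentiableAt, hΦ₂.eventually_differentiableAt] with q h1 h2
      exact (h1.hasFDerivAt.add h2.hasFDerivAt).fderiv
    have h2 := (hΦ₁.hasFDerivAt_fderiv.add hΦ₂.hasFDerivAt_fderiv).congr_of_eventuallyEq h1
    rw [h2.fderiv]
    rfl
  -- The parameter `b` disappears because `Φ₁` sees the pair `p` only through `φ(p₁)`.
  have hD₁ : ∀ a b b' : EG, a ∈ Γ.Vtgt g → b' ∈ Γ.Vsrc g →
      fderiv ℝ (fderiv ℝ Φ₁) 0 ((a, b), 0) (0, b') =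
        fderiv ℝ (fderiv ℝ N) (extChartAt 𝓘(ℝ, EG) g g, extChartAt 𝓘(ℝ, EG) g g)
          (a, 0) (0, b') := by
    intro a b b' ha hb'
    have h := fderiv_fderiv_comp_prodMap
      (φ := fun p : EG × EG => extChartAt 𝓘(ℝ, EG) g (φ p.1))
      (ψ := fun s => extChartAt 𝓘(ℝ, EG) g (ψ s)) hNs cφ cψ (a, b) b'
    have h1 := (hasFDerivAt_extChartAt_comp hφ0 (hφ.mdifferentiableAt (by simp)))
    have h2 : HasFDerivAt (fun p : EG × EG => extChartAt 𝓘(ℝ, EG) g (φ p.1))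
        ((vel φ 0).comp (ContinuousLinearMap.fst ℝ EG EG)) 0 :=
      HasFDerivAt.comp (g := fun s => extChartAt 𝓘(ℝ, EG) g (φ s)) (0 : EG × EG) h1 hasFDerivAt_fst
    rw [h2.fderiv, (hasFDerivAt_extChartAt_comp hψ0 (hψ.mdifferentiableAt (by simp))).fderiv,
      hψv b' hb', ContinuousLinearMap.comp_apply, ContinuousLinearMap.coe_fst', hφv a ha,
      Prod.fst_zero, hφ0, hψ0] at h
    rw [hΦ₁def]
    exact h
  have hD₂ : ∀ a b b' : EG, a ∈ Γ.Vtgt g → b ∈ Γ.Vsrc g → b' ∈ Γ.Vsrc g →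
      fderiv ℝ (fderiv ℝ Φ₂) 0 ((a, b), 0) (0, b') =
        fderiv ℝ (fderiv ℝ N') (extChartAt 𝓘(ℝ, EG) (ξ g) (ξ g), extChartAt 𝓘(ℝ, EG) (ξ g) (ξ g))
          (Γ.dri (ξ g) (Γ.dl (Γ.inv g) g b'), 0)
          (0, dAt ξ g (a + b) - Γ.dri (ξ g) (Γ.dl (Γ.inv g) g b)) := by
    intro a b b' ha hb hb'
    have h := fderiv_fderiv_comp_prodMap_swap
      (φ := fun s => extChartAt 𝓘(ℝ, EG) (ξ g) (φ₂ s))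
      (ψ := fun s => extChartAt 𝓘(ℝ, EG) (ξ g) (χ₂ s)) hN's cφ₂ cχ₂ (a, b) b'
    rw [(hasFDerivAt_extChartAt_comp hφ₂0 (hφ₂.mdifferentiableAt (by simp))).fderiv,
      (hasFDerivAt_extChartAt_comp hχ₂0 (hχ₂.mdifferentiableAt (by simp))).fderiv,
      hφ₂v b' hb', hχ₂v a b ha hb, hφ₂0, hχ₂0] at h
    rw [hΦ₂def]
    exact h
  rw [hsum, hsum] at hsymm
  simp only [ContinuousLinearMap.coe_snd'] at hsymm
  rw [hD₁ X Y Y' hX hY', hD₁ X' Y' Y hX' hY, hD₂ X Y Y' hX hY hY', hD₂ X' Y' Y hX' hY' hY] at hsymm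
  -- The components of the prolongation are vertical because they are velocities: `w` of `φ₂`, which
  -- stays in a `β`-fibre, and `Z - w` of `χ₂`, which stays in an `α`-fibre.
  have hwm := Γ.vel_mem_Vtgt hφ₂0 (hφ₂.mdifferentiableAt (by simp)) hφ₂t Y
  have hZm := Γ.vel_mem_Vsrc hχ₂0 (hχ₂.mdifferentiableAt (by simp)) hχ₂S (X, Y)
  rw [hφ₂v Y hY, ← hw] at hwm
  rw [hχ₂v X Y hX hY, ← hw, ← hZ] at hZm
  refine ⟨hwm, hZm, ?_⟩
  subst hw hw' hZ hZ'
  linarith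

end LieGroupoid

/-! ### Extension of vertical vectors to global smooth sections. -/

section TangentSections

variable {E₁ E₂ N P : Type*}
  [NormedAddCommGroup E₁] [NormedSpace ℝ E₁] [NormedAddCommGroup E₂] [NormedSpace ℝ E₂]
  [TopologicalSpace N] [ChartedSpace E₁ N] [TopologicalSpace P] [ChartedSpace E₂ P]

theorem eventually_contDiffAt_chart_rep [IsManifold 𝓘(ℝ, E₁) ∞ N] [IsManifold 𝓘(ℝ, E₂) ∞ P]
    {p : N → P} (hp : ContMDiff 𝓘(ℝ, E₁) 𝓘(ℝ, E₂) ∞ p) (g : N) :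
    ∀ᶠ k in 𝓝 g, k ∈ (extChartAt 𝓘(ℝ, E₁) g).source ∧ p k ∈ (extChartAt 𝓘(ℝ, E₂) (p g)).source ∧
      ContDiffAt ℝ ∞ (fun y => extChartAt 𝓘(ℝ, E₂) (p g) (p ((extChartAt 𝓘(ℝ, E₁) g).symm y)))
        (extChartAt 𝓘(ℝ, E₁) g k) := by
  filter_upwards [extChartAt_source_mem_nhds (I := 𝓘(ℝ, E₁)) g,
    hp.continuous.continuousAt.eventually (extChartAt_source_mem_nhds (I := 𝓘(ℝ, E₂)) (p g))]
    with k hk hpk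
  refine ⟨hk, hpk, ?_⟩
  have h1 : ContMDiffAt 𝓘(ℝ, E₁) 𝓘(ℝ, E₁) ∞ (extChartAt 𝓘(ℝ, E₁) g).symm
      (extChartAt 𝓘(ℝ, E₁) g k) :=
    (contMDiffOn_extChartAt_symm g).contMDiffAt
      ((isOpen_extChartAt_target g).mem_nhds ((extChartAt 𝓘(ℝ, E₁) g).map_source hk))
  have h2 : ContMDiffAt 𝓘(ℝ, E₂) 𝓘(ℝ, E₂) ∞ (extChartAt 𝓘(ℝ, E₂) (p g))
      (p ((extChartAt 𝓘(ℝ, E₁) g).symm (extChartAt 𝓘(ℝ, E₁) g k))) := by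
    rw [(extChartAt 𝓘(ℝ, E₁) g).left_inv hk]
    exact contMDiffAt_extChartAt' (by rwa [extChartAt_source] at hpk)
  exact (ContMDiffAt.comp (g := extChartAt 𝓘(ℝ, E₂) (p g))
    (f := fun y => p ((extChartAt 𝓘(ℝ, E₁) g).symm y)) _ h2 (hp.contMDiffAt.comp _ h1)).contDiffAt

theorem mdifferentiableAt_extChartAt_symm [IsManifold 𝓘(ℝ, E₁) ∞ N] {g k : N}
    (hk : k ∈ (extChartAt 𝓘(ℝ, E₁) g).source) :
    MDifferentiableAt 𝓘(ℝ, E₁) 𝓘(ℝ, E₁) (extChartAt 𝓘(ℝ, E₁) g).symm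
      (extChartAt 𝓘(ℝ, E₁) g k) :=
  ((contMDiffOn_extChartAt_symm (n := ∞) g).contMDiffAt
      ((isOpen_extChartAt_target g).mem_nhds ((extChartAt 𝓘(ℝ, E₁) g).map_source hk))
      ).mdifferentiableAt (by simp)

theorem symmL_trivializationAt_eq_vel [IsManifold 𝓘(ℝ, E₁) ∞ N] [IsManifold 𝓘(ℝ, E₁) 1 N] {g k : N}
    (hk : k ∈ (extChartAt 𝓘(ℝ, E₁) g).source) (w : E₁) :
    (trivializationAt E₁ (TangentSpace 𝓘(ℝ, E₁)) g).symmL ℝ k w =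
      (vel (extChartAt 𝓘(ℝ, E₁) g).symm (extChartAt 𝓘(ℝ, E₁) g k) : E₁ →L[ℝ] E₁) w := by
  rw [TangentBundle.symmL_trivializationAt (by rwa [extChartAt_source] at hk)]
  simp only [modelWithCornersSelf_coe, Set.range_id, mfderivWithin_univ]
  rfl

theorem vel_extChartAt_symm_self [IsManifold 𝓘(ℝ, E₁) ∞ N] (g : N) (w : E₁) :
    (vel (extChartAt 𝓘(ℝ, E₁) g).symm (extChartAt 𝓘(ℝ, E₁) g g) : E₁ →L[ℝ] E₁) w = w := by
  have h : HasFDerivAt (fun y => extChartAt 𝓘(ℝ, E₁) g ((extChartAt 𝓘(ℝ, E₁) g).symm y))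
      (ContinuousLinearMap.id ℝ E₁) (extChartAt 𝓘(ℝ, E₁) g g) := by
    refine (hasFDerivAt_id _).congr_of_eventuallyEq ?_
    filter_upwards [extChartAt_target_mem_nhds (I := 𝓘(ℝ, E₁)) g] with y hy
    exact (extChartAt 𝓘(ℝ, E₁) g).right_inv hy
  rw [vel_eq_of_hasFDerivAt (by simp)
    (mdifferentiableAt_extChartAt_symm (mem_extChartAt_source g)) h]
  rfl

theorem dAt_extChartAt_injective [IsManifold 𝓘(ℝ, E₂) ∞ P] {x y : P}
    (hy : y ∈ (extChartAt 𝓘(ℝ, E₂) x).source) {w : E₂}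
    (h : dAt (E₂ := E₂) (extChartAt 𝓘(ℝ, E₂) x) y w = 0) : w = 0 := by
  have : IsManifold 𝓘(ℝ, E₂) 1 P := IsManifold.of_le (n := ∞) (by simp)
  have h1 := (isInvertible_mfderiv_extChartAt (I := 𝓘(ℝ, E₂)) hy).injective
  exact h1 (h.trans (map_zero _).symm)

/-- A vector tangent to a fibre of a submersion extends to a global smooth vector field tangent to
the fibres. -/
theorem exists_section_tangent_fibres [FiniteDimensional ℝ E₁] [FiniteDimensional ℝ E₂] [T2Space N]
    [IsManifold 𝓘(ℝ, E₁) ∞ N] [IsManifold 𝓘(ℝ, E₂) ∞ P] {p : N → P}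
    (hp : ContMDiff 𝓘(ℝ, E₁) 𝓘(ℝ, E₂) ∞ p) {g : N}
    (hs : Function.Surjective (dAt p g : E₁ →L[ℝ] E₂)) {v : E₁}
    (hv : (dAt p g : E₁ →L[ℝ] E₂) v = 0) :
    ∃ X : ∀ k : N, TangentSpace 𝓘(ℝ, E₁) k,
      ContMDiff 𝓘(ℝ, E₁) 𝓘(ℝ, E₁).tangent ∞ (fun k => (⟨k, X k⟩ : TangentBundle 𝓘(ℝ, E₁) N)) ∧
      X g = v ∧ ∀ k, (dAt p k : E₁ →L[ℝ] E₂) (X k) = 0 := by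
  have : IsManifold 𝓘(ℝ, E₁) 1 N := IsManifold.of_le (n := ∞) (by simp)
  set c := extChartAt 𝓘(ℝ, E₁) g with hc
  set e := trivializationAt E₁ (TangentSpace 𝓘(ℝ, E₁)) g with he
  have hD := (hasFDerivAt_chart_rep (hp.contMDiffAt.mdifferentiableAt (x := g) (by simp))).fderiv
  have hev := eventually_contDiffAt_chart_rep hp g
  have hb : ∀ᶠ y in 𝓝 (c g), ContDiffAt ℝ ∞ (fun y => extChartAt 𝓘(ℝ, E₂) (p g)
      (p (c.symm y))) y := by
    have h1 : Tendsto c.symm (𝓝 (c g)) (𝓝 g) := by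
      have := (continuousAt_extChartAt_symm (I := 𝓘(ℝ, E₁)) g).tendsto
      rwa [extChartAt_to_inv] at this
    filter_upwards [h1.eventually hev, extChartAt_target_mem_nhds (I := 𝓘(ℝ, E₁)) g] with y hy hyt
    have h2 := hy.2.2
    rwa [(extChartAt 𝓘(ℝ, E₁) g).right_inv hyt] at h2
  obtain ⟨Xc, hXc0, hXc⟩ := exists_tangent_levelSet_extension hb
    (by rw [← hD] at hs; exact hs) (v := v) (by rw [← hD] at hv; exact hv)
  have hW : ∀ᶠ k in 𝓝 g, (k ∈ c.source ∧ p k ∈ (extChartAt 𝓘(ℝ, E₂) (p g)).source ∧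
      ContDiffAt ℝ ∞ (fun y => extChartAt 𝓘(ℝ, E₂) (p g) (p (c.symm y))) (c k)) ∧
      ContDiffAt ℝ ∞ Xc (c k) ∧
      fderiv ℝ (fun y => extChartAt 𝓘(ℝ, E₂) (p g) (p (c.symm y))) (c k) (Xc (c k)) = 0 :=
    hev.and ((continuousAt_extChartAt (I := 𝓘(ℝ, E₁)) g).eventually hXc)
  obtain ⟨f, -, hf⟩ := (SmoothBumpFunction.nhds_basis_tsupport (I := 𝓘(ℝ, E₁)) g).mem_iff.1 hW
  have hbase : ∀ k ∈ tsupport f, k ∈ e.baseSet := by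
    intro k hk
    have := (hf hk).1.1
    rw [hc, extChartAt_source] at this
    rwa [he, TangentBundle.trivializationAt_baseSet]
  -- The local tangent field of the chart is cut off by the bump function `f`, which equals `1` at
  -- `g` and is supported where the field is smooth and tangent. Tangency to the fibres is a linear
  -- condition, so it survives scaling.
  refine ⟨fun k => e.symmL ℝ k (f k • Xc (c k)), ?_, ?_, ?_⟩
  · intro k
    by_cases hk : k ∈ tsupport f
    · have hkW := hf hk
      refine (e.contMDiffAt_section_iff (hbase k hk)).2 ?_
      have h1 : ContMDiffAt 𝓘(ℝ, E₁) 𝓘(ℝ, E₁) ∞ (fun x => f x • Xc (c x)) k := by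
        refine f.contMDiffAt.smul ?_
        refine hkW.2.1.contMDiffAt.comp k ?_
        exact contMDiffAt_extChartAt' (by have := hkW.1.1; rwa [hc, extChartAt_source] at this)
      refine h1.congr_of_eventuallyEq ?_
      filter_upwards [e.open_baseSet.mem_nhds (hbase k hk)] with x hx
      have h3 := e.apply_mk_symm hx (f x • Xc (c x))
      rw [← e.symmL_apply (R := ℝ) hx] at h3
      exact congrArg Prod.snd h3
    · have h0 : (fun x => (⟨x, e.symmL ℝ x (f x • Xc (c x))⟩ : TangentBundle 𝓘(ℝ, E₁) N)) =ᶠ[𝓝 k]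
          fun x => ⟨x, 0⟩ := by
        filter_upwards [(isClosed_tsupport f).isOpen_compl.mem_nhds hk] with x hx
        rw [image_eq_zero_of_notMem_tsupport hx, zero_smul, map_zero]
      refine ContMDiffAt.congr_of_eventuallyEq ?_ h0
      exact (Bundle.contMDiff_zeroSection ℝ (TangentSpace 𝓘(ℝ, E₁))).contMDiffAt
  · simp only
    rw [f.eq_one, one_smul, symmL_trivializationAt_eq_vel (mem_extChartAt_source g),
      vel_extChartAt_symm_self, hXc0]
  · intro k
    by_cases hk : k ∈ tsupport f
    · have hkW := hf hk
      have hkc : k ∈ c.source := hkW.1.1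
      have hck : c.symm (c k) = k := c.left_inv hkc
      have h0 : @Eq E₁ (e.symmL ℝ k (f k • Xc (c k)))
          ((vel c.symm (c k) : E₁ →L[ℝ] E₁) (f k • Xc (c k))) := symmL_trivializationAt_eq_vel hkc _
      refine (congrArg (dAt p k : E₁ →L[ℝ] E₂) h0).trans ?_
      rw [map_smul, map_smul]
      rw [mfderiv_vel hck (hp.contMDiffAt.mdifferentiableAt (by simp))
        (mdifferentiableAt_extChartAt_symm hkc)]
      -- Tangency is known for the expression of `p` in both charts. The chart on the target has
      -- injective derivative, so it can be removed.
      have h1 : MDifferentiableAt 𝓘(ℝ, E₁) 𝓘(ℝ, E₂) (fun y => p (c.symm y)) (c k) :=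
        MDifferentiableAt.comp (g := p) (c k)
          (hp.contMDiffAt.mdifferentiableAt (by simp)) (mdifferentiableAt_extChartAt_symm hkc)
      have h2 := mfderiv_vel (F := extChartAt 𝓘(ℝ, E₂) (p g)) (g := p k) (by rw [hck])
        (mdifferentiableAt_extChartAt (by have := hkW.1.2.1; rwa [extChartAt_source] at this))
        h1 (Xc (c k))
      rw [vel_eq_fderiv, hkW.2.2] at h2
      rw [dAt_extChartAt_injective hkW.1.2.1 h2, smul_zero]
    · have h0 : @Eq E₁ (e.symmL ℝ k (f k • Xc (c k))) 0 := by
        rw [image_eq_zero_of_notMem_tsupport hk, zero_smul, map_zero]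
        rfl
      exact (congrArg (dAt p k : E₁ →L[ℝ] E₂) h0).trans (map_zero _)

end TangentSections

namespace LieGroupoid

variable {EG EM G M : Type*}
    [NormedAddCommGroup EG] [NormedSpace ℝ EG] [NormedAddCommGroup EM] [NormedSpace ℝ EM]
    [TopologicalSpace G] [ChartedSpace EG G] [TopologicalSpace M] [ChartedSpace EM M]
    [FiniteDimensional ℝ EG] [FiniteDimensional ℝ EM] [T2Space G]
    [IsManifold 𝓘(ℝ, EG) ∞ G] [IsManifold 𝓘(ℝ, EM) ∞ M]
    (Γ : LieGroupoid EG EM G M)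

/-- `extend` is an epsilon choice and has the desired property once some section through `u` exists.
The two components are extended separately, one along the `β`-fibres and one along the `α`-fibres.
-/
theorem extend_spec {g : G} {u : TangentSpace 𝓘(ℝ, EG) g × TangentSpace 𝓘(ℝ, EG) g}
    (hu : u ∈ Γ.fibre g) : Γ.IsSection (Γ.extend g u) ∧ Γ.extend g u g = u := by
  refine Classical.epsilon_spec (p := fun σ => Γ.IsSection σ ∧ σ g = u) ?_
  obtain ⟨X, hX, hXg, hXv⟩ := exists_section_tangent_fibres Γ.contMDiff_tgt (g := g)
    (Γ.submersion_tgt g) hu.1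
  obtain ⟨Y, hY, hYg, hYv⟩ := exists_section_tangent_fibres Γ.contMDiff_src (g := g)
    (Γ.submersion_src g) hu.2
  exact ⟨fun k => (X k, Y k), ⟨fun k => ⟨hXv k, hYv k⟩, hX, hY⟩, Prod.ext hXg hYg⟩

end LieGroupoid

/-! ### Coordinate calculus for `dΘ⁻`; `transported` is the middle component of a left-invariant
field. -/

section BracketCalculus

variable {E : Type*} [NormedAddCommGroup E] [NormedSpace ℝ E]

/-- The field `(y₂, y₃) ↦ D₁ m (y₃, y₃, y₂) X(y₃)`. -/
noncomputable def transported (m : E × E × E → E) (X : E → E) (q : E × E) : E :=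
  fderiv ℝ m (q.2, q.2, q.1) (X q.2, 0, 0)

variable {m : E × E × E → E} {X Y X' Y' : E → E} {y₀ : E} {ℓ : E → ℝ}

theorem contDiffAt_transported (hm : ContDiffAt ℝ ∞ m (y₀, y₀, y₀)) (hX : ContDiffAt ℝ ∞ X y₀) :
    ContDiffAt ℝ ∞ (transported m X) (y₀, y₀) := by
  have h1 : ContDiffAt ℝ ∞ (fun q : E × E => fderiv ℝ m (q.2, q.2, q.1)) (y₀, y₀) :=
    ContDiffAt.comp (g := fderiv ℝ m) (f := fun q : E × E => (q.2, q.2, q.1)) (y₀, y₀)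
      (hm.fderiv_right (by simp))
      (contDiffAt_snd.prodMk (contDiffAt_snd.prodMk contDiffAt_fst))
  have h2 : ContDiffAt ℝ ∞ (fun q : E × E => X q.2) (y₀, y₀) :=
    ContDiffAt.comp (g := X) (y₀, y₀) hX contDiffAt_snd
  exact h1.clm_apply (h2.prodMk (contDiffAt_const.prodMk contDiffAt_const))

/-- The first-slot derivative of `ℓ (m (·, y₀, y))` at `y₀` along `X y₀` is `Dℓ` applied to
`transported m X (y, y₀)`. The product rule in `y` then gives the two terms. -/
theorem fderiv_fderiv_comp_triple (hm : ContDiffAt ℝ ∞ m (y₀, y₀, y₀)) (hX : ContDiffAt ℝ ∞ X y₀)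
    (hℓ : ContDiffAt ℝ ∞ ℓ y₀) (hm0 : m (y₀, y₀, y₀) = y₀)
    (hX0 : transported m X (y₀, y₀) = X y₀) {v : E}
    (hv : fderiv ℝ m (y₀, y₀, y₀) (0, 0, v) = v) :
    fderiv ℝ (fderiv ℝ fun q : E × E => ℓ (m (q.1, y₀, q.2))) (y₀, y₀) (X y₀, 0) (0, v) =
      fderiv ℝ (fderiv ℝ ℓ) y₀ v (X y₀) +
        fderiv ℝ ℓ y₀ (fderiv ℝ (transported m X) (y₀, y₀) (v, 0)) := by
  have hι : ContDiff ℝ ∞ (fun q : E × E => (q.1, y₀, q.2)) :=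
    contDiff_fst.prodMk (contDiff_const.prodMk contDiff_snd)
  have hmι : ContDiffAt ℝ ∞ (fun q : E × E => m (q.1, y₀, q.2)) (y₀, y₀) :=
    ContDiffAt.comp (g := m) (y₀, y₀) hm hι.contDiffAt
  have hℓ' : ContDiffAt ℝ ∞ ℓ (m (y₀, y₀, y₀)) := by rw [hm0]; exact hℓ
  have hN : ContDiffAt ℝ ∞ (fun q : E × E => ℓ (m (q.1, y₀, q.2))) (y₀, y₀) :=
    ContDiffAt.comp (g := ℓ) (y₀, y₀) hℓ' hmι
  rw [hN.fderiv_fderiv_comm]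
  have hj : HasFDerivAt (fun y : E => (y₀, y)) (ContinuousLinearMap.inr ℝ E E) y₀ :=
    (hasFDerivAt_const y₀ y₀).prodMk (hasFDerivAt_id y₀)
  have hj' : HasFDerivAt (fun y : E => (y, y₀)) (ContinuousLinearMap.inl ℝ E E) y₀ :=
    (hasFDerivAt_id y₀).prodMk (hasFDerivAt_const y₀ y₀)
  have hk : HasFDerivAt (fun y : E => (y₀, y₀, y))
      ((ContinuousLinearMap.inr ℝ E (E × E)).comp (ContinuousLinearMap.inr ℝ E E)) y₀ :=
    HasFDerivAt.congr_fderiv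
      ((hasFDerivAt_const y₀ y₀).prodMk ((hasFDerivAt_const y₀ y₀).prodMk (hasFDerivAt_id y₀))) rfl
  have h1 : HasFDerivAt
      (fun y => fderiv ℝ (fun q : E × E => ℓ (m (q.1, y₀, q.2))) (y₀, y) (X y₀, 0))
      ((ContinuousLinearMap.apply ℝ ℝ ((X y₀, 0) : E × E)).comp
        ((fderiv ℝ (fderiv ℝ fun q : E × E => ℓ (m (q.1, y₀, q.2))) (y₀, y₀)).comp
          (ContinuousLinearMap.inr ℝ E E))) y₀ :=
    (ContinuousLinearMap.apply ℝ ℝ ((X y₀, 0) : E × E)).hasFDerivAt.comp y₀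
      (hN.hasFDerivAt_fderiv.comp y₀ hj)
  have h2 : HasFDerivAt (fun y => fderiv ℝ ℓ (m (y₀, y₀, y)))
      ((fderiv ℝ (fderiv ℝ ℓ) (m (y₀, y₀, y₀))).comp ((fderiv ℝ m (y₀, y₀, y₀)).comp
        ((ContinuousLinearMap.inr ℝ E (E × E)).comp (ContinuousLinearMap.inr ℝ E E)))) y₀ :=
    HasFDerivAt.comp (g := fderiv ℝ ℓ) y₀ hℓ'.hasFDerivAt_fderiv
      (HasFDerivAt.comp (g := m) y₀ (hm.differentiableAt (by simp)).hasFDerivAt hk)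
  have h3 : HasFDerivAt (fun y => transported m X (y, y₀))
      ((fderiv ℝ (transported m X) (y₀, y₀)).comp (ContinuousLinearMap.inl ℝ E E)) y₀ :=
    HasFDerivAt.comp (g := transported m X) y₀
      ((contDiffAt_transported hm hX).differentiableAt (by simp)).hasFDerivAt hj'
  have h4 := h2.clm_apply h3
  have h5 : (fun y => fderiv ℝ (fun q : E × E => ℓ (m (q.1, y₀, q.2))) (y₀, y) (X y₀, 0)) =ᶠ[𝓝 y₀]
      fun y => fderiv ℝ ℓ (m (y₀, y₀, y)) (transported m X (y, y₀)) := by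
    have t1 : ContinuousAt (fun y => m (y₀, y₀, y)) y₀ :=
      ContinuousAt.comp (g := m) hm.continuousAt hk.continuousAt
    filter_upwards [t1.eventually hℓ'.eventually_differentiableAt,
      hk.continuousAt.eventually hm.eventually_differentiableAt] with y hy1 hy2
    have hι' : HasFDerivAt (fun q : E × E => (q.1, y₀, q.2))
        ((ContinuousLinearMap.fst ℝ E E).prod
          ((0 : E × E →L[ℝ] E).prod (ContinuousLinearMap.snd ℝ E E))) (y₀, y) :=
      hasFDerivAt_fst.prodMk ((hasFDerivAt_const y₀ (y₀, y)).prodMk hasFDerivAt_snd)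
    have h6 : HasFDerivAt (fun q : E × E => ℓ (m (q.1, y₀, q.2))) _ (y₀, y) :=
      HasFDerivAt.comp (g := ℓ) (y₀, y) hy1.hasFDerivAt
        (HasFDerivAt.comp (g := m) (y₀, y) hy2.hasFDerivAt hι')
    rw [h6.fderiv]
    rfl
  have h7 := (h1.congr_of_eventuallyEq h5.symm).unique h4
  have h8 := congrArg (fun T : E →L[ℝ] ℝ => T v) h7
  simp only [ContinuousLinearMap.comp_apply, ContinuousLinearMap.inr_apply,
    ContinuousLinearMap.inl_apply, ContinuousLinearMap.apply_apply, add_apply,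
    ContinuousLinearMap.flip_apply, hv, hX0, hm0] at h8
  rw [h8, add_comm]

/-- The computation of the differential of `Θ⁻` in coordinates. -/
theorem mixed_eq_of_transported (hm : ContDiffAt ℝ ∞ m (y₀, y₀, y₀))
    (hℓ : ContDiffAt ℝ ∞ ℓ y₀) (hm0 : m (y₀, y₀, y₀) = y₀)
    (hX : ContDiffAt ℝ ∞ X y₀) (hX' : ContDiffAt ℝ ∞ X' y₀)
    (hXd : ∀ᶠ y in 𝓝 y₀, transported m X (y, y) = X y)
    (hXd' : ∀ᶠ y in 𝓝 y₀, transported m X' (y, y) = X' y) {v v' : E}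
    (hv : fderiv ℝ m (y₀, y₀, y₀) (0, 0, v) = v)
    (hv' : fderiv ℝ m (y₀, y₀, y₀) (0, 0, v') = v') :
    fderiv ℝ (fun y => fderiv ℝ ℓ y (X' y)) y₀ (X y₀ + v) -
      fderiv ℝ (fun y => fderiv ℝ ℓ y (X y)) y₀ (X' y₀ + v') -
      fderiv ℝ ℓ y₀ (fderiv ℝ (transported m X') (y₀, y₀) (X y₀, X y₀ + v) -
        fderiv ℝ (transported m X) (y₀, y₀) (X' y₀, X' y₀ + v')) =
    fderiv ℝ (fderiv ℝ fun q : E × E => ℓ (m (q.1, y₀, q.2))) (y₀, y₀) (X' y₀, 0) (0, v) -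
      fderiv ℝ (fderiv ℝ fun q : E × E => ℓ (m (q.1, y₀, q.2))) (y₀, y₀) (X y₀, 0) (0, v') := by
  -- On the diagonal the transported field is `X` itself, so the derivative of `X` along `z` is that
  -- of `transported m X` along `(z, z)`.
  have key : ∀ {X : E → E}, ContDiffAt ℝ ∞ X y₀ →
      (∀ᶠ y in 𝓝 y₀, transported m X (y, y) = X y) → ∀ z,
      fderiv ℝ (fun y => fderiv ℝ ℓ y (X y)) y₀ z = fderiv ℝ (fderiv ℝ ℓ) y₀ z (X y₀) +
        fderiv ℝ ℓ y₀ (fderiv ℝ (transported m X) (y₀, y₀) (z, z)) := by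
    intro X hX hXd z
    have hd : HasFDerivAt (fun y : E => (y, y))
        ((ContinuousLinearMap.id ℝ E).prod (ContinuousLinearMap.id ℝ E)) y₀ :=
      (hasFDerivAt_id y₀).prodMk (hasFDerivAt_id y₀)
    have h1 : HasFDerivAt (fun y => transported m X (y, y))
        ((fderiv ℝ (transported m X) (y₀, y₀)).comp
          ((ContinuousLinearMap.id ℝ E).prod (ContinuousLinearMap.id ℝ E))) y₀ :=
      HasFDerivAt.comp (g := transported m X) y₀
        ((contDiffAt_transported hm hX).differentiableAt (by simp)).hasFDerivAt hd
    have h2 := h1.congr_of_eventuallyEq (hXd.mono fun y hy => hy.symm)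
    rw [(hℓ.hasFDerivAt_fderiv.clm_apply h2).fderiv]
    simp [add_comm]
  rw [key hX' hXd', key hX hXd,
    fderiv_fderiv_comp_triple hm hX' hℓ hm0 hXd'.self_of_nhds hv,
    fderiv_fderiv_comp_triple hm hX hℓ hm0 hXd.self_of_nhds hv']
  -- In this splitting the part `(a, a + b)` cancels against the bracket, and `(b, 0)` is the term
  -- occurring in the mixed second derivative. The remaining second derivatives of `ℓ` cancel by
  -- symmetry.
  have e : ∀ a b : E, ((a + b, a + b) : E × E) = (a, a + b) + (b, 0) := by intro a b; simp
  rw [e, e]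
  simp only [map_add, map_sub, add_apply]
  rw [hℓ.fderiv_fderiv_comm (X' y₀) (X y₀)]
  ring

/-- The derivative within a set, evaluated on the velocity of a path in that set. -/
theorem fderivWithin_apply_of_path {F : Type*} [NormedAddCommGroup F] [NormedSpace ℝ F]
    {E' : Type*} [NormedAddCommGroup E'] [NormedSpace ℝ E']
    {f : E → F} {S : Set E} {x : E} (hf : DifferentiableAt ℝ f x) {γ : E' → E} {γ' : E' →L[ℝ] E}
    {t : E'} (hγt : γ t = x) (hγ : HasFDerivAt γ γ' t) (hS : ∀ᶠ s in 𝓝 t, γ s ∈ S) (a : E') :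
    fderivWithin ℝ f S x (γ' a) = fderiv ℝ f x (γ' a) := by
  subst hγt
  have h1 : HasFDerivWithinAt γ γ' (γ ⁻¹' S) t := hγ.hasFDerivWithinAt
  have h2 := (hf.differentiableWithinAt (s := S)).hasFDerivWithinAt.comp t h1 (fun _ h => h)
  have h3 := (h2.hasFDerivAt hS).unique (hf.hasFDerivAt.comp t hγ)
  exact congrArg (fun T : E' →L[ℝ] F => T a) h3

end BracketCalculus

/-! ### The triple product `h' s⁻¹ h` in a chart. -/

namespace LieGroupoid

variable {EG EM G M : Type*}
    [NormedAddCommGroup EG] [NormedSpace ℝ EG] [NormedAddCommGroup EM] [NormedSpace ℝ EM]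
    [TopologicalSpace G] [ChartedSpace EG G] [TopologicalSpace M] [ChartedSpace EM M]
    [IsManifold 𝓘(ℝ, EG) ∞ G]
    (Γ : LieGroupoid EG EM G M)

/-- A smooth extension of `(h', s, h) ↦ h' (s⁻¹ h)`, in the chart at `g`. -/
theorem exists_chart_triple_mul (g : G) :
    ∃ m : EG × EG × EG → EG,
      ContDiffAt ℝ ∞ m (extChartAt 𝓘(ℝ, EG) g g, extChartAt 𝓘(ℝ, EG) g g, extChartAt 𝓘(ℝ, EG) g g) ∧
      ∀ᶠ p : G × G × G in 𝓝 (g, g, g), Γ.tgt p.1 = Γ.tgt p.2.1 → Γ.src p.2.1 = Γ.src p.2.2 →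
        Γ.mul p.1 (Γ.mul (Γ.inv p.2.1) p.2.2) ∈ (extChartAt 𝓘(ℝ, EG) g).source ∧
        m (extChartAt 𝓘(ℝ, EG) g p.1, extChartAt 𝓘(ℝ, EG) g p.2.1, extChartAt 𝓘(ℝ, EG) g p.2.2) =
          extChartAt 𝓘(ℝ, EG) g (Γ.mul p.1 (Γ.mul (Γ.inv p.2.1) p.2.2)) := by
  have hg1 : Γ.tgt (Γ.inv g) = Γ.src g := Γ.tgt_inv g
  have hg2 : Γ.tgt g = Γ.src (Γ.mul (Γ.inv g) g) := by rw [Γ.src_mul _ _ hg1, Γ.src_inv]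
  -- Two local extensions of the product are composed, one near `(g⁻¹, g)` and one near `(g, g⁻¹
  -- g)`.
  obtain ⟨f₁, hf₁, he₁⟩ := Γ.exists_mul_extension hg1
  obtain ⟨f₂, hf₂, he₂⟩ := Γ.exists_mul_extension hg2
  have hf₁g : f₁ (Γ.inv g, g) = Γ.mul (Γ.inv g) g := he₁.self_of_nhds hg1
  have hf₂g : f₂ (g, Γ.mul (Γ.inv g) g) = g := by
    rw [he₂.self_of_nhds hg2, Γ.mul_inv_cancel_left rfl]
  set c := extChartAt 𝓘(ℝ, EG) g with hc
  have hcs : ContMDiffAt 𝓘(ℝ, EG) 𝓘(ℝ, EG) ∞ c.symm (c g) := contMDiffAt_extChartAt_symm_self g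
  have hcg : c.symm (c g) = g := extChartAt_to_inv g
  have a1 : ContMDiffAt 𝓘(ℝ, EG × EG × EG) 𝓘(ℝ, EG) ∞
      (fun y : EG × EG × EG => c.symm y.1) (c g, c g, c g) :=
    ContMDiffAt.comp (g := c.symm) (c g, c g, c g) hcs contDiff_fst.contDiffAt.contMDiffAt
  have a2 : ContMDiffAt 𝓘(ℝ, EG × EG × EG) 𝓘(ℝ, EG) ∞
      (fun y : EG × EG × EG => Γ.inv (c.symm y.2.1)) (c g, c g, c g) :=
    Γ.contMDiffAt_inv (ContMDiffAt.comp (g := c.symm) (f := fun y : EG × EG × EG => y.2.1)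
      (c g, c g, c g) hcs (contDiff_fst.comp contDiff_snd).contDiffAt.contMDiffAt)
  have a3 : ContMDiffAt 𝓘(ℝ, EG × EG × EG) 𝓘(ℝ, EG) ∞
      (fun y : EG × EG × EG => c.symm y.2.2) (c g, c g, c g) :=
    ContMDiffAt.comp (g := c.symm) (f := fun y : EG × EG × EG => y.2.2)
      (c g, c g, c g) hcs (contDiff_snd.comp contDiff_snd).contDiffAt.contMDiffAt
  have b1 : ContMDiffAt 𝓘(ℝ, EG × EG × EG) 𝓘(ℝ, EG) ∞
      (fun y : EG × EG × EG => f₁ (Γ.inv (c.symm y.2.1), c.symm y.2.2)) (c g, c g, c g) := by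
    refine ContMDiffAt.comp (g := f₁) (c g, c g, c g) ?_ (a2.prodMk a3)
    simp only [hcg]; exact hf₁
  have b2 : ContMDiffAt 𝓘(ℝ, EG × EG × EG) 𝓘(ℝ, EG) ∞
      (fun y : EG × EG × EG => f₂ (c.symm y.1, f₁ (Γ.inv (c.symm y.2.1), c.symm y.2.2)))
      (c g, c g, c g) := by
    refine ContMDiffAt.comp (g := f₂) (c g, c g, c g) ?_ (a1.prodMk b1)
    simp only [hcg, hf₁g]; exact hf₂
  refine ⟨fun y => c (f₂ (c.symm y.1, f₁ (Γ.inv (c.symm y.2.1), c.symm y.2.2))),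
    ContMDiffAt.contDiffAt_extChartAt_comp (by simp only [hcg, hf₁g, hf₂g]) b2, ?_⟩
  have t1 : Tendsto (fun p : G × G × G => (Γ.inv p.2.1, p.2.2)) (𝓝 (g, g, g)) (𝓝 (Γ.inv g, g)) :=
    ((Γ.contMDiff_inv.continuous.comp (continuous_fst.comp continuous_snd)).prodMk
      (continuous_snd.comp continuous_snd)).tendsto (g, g, g)
  have t1' : Tendsto (fun p : G × G × G => f₁ (Γ.inv p.2.1, p.2.2)) (𝓝 (g, g, g))
      (𝓝 (Γ.mul (Γ.inv g) g)) := by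
    rw [← hf₁g]; exact hf₁.continuousAt.tendsto.comp t1
  have t2 : Tendsto (fun p : G × G × G => (p.1, f₁ (Γ.inv p.2.1, p.2.2))) (𝓝 (g, g, g))
      (𝓝 (g, Γ.mul (Γ.inv g) g)) :=
    (continuous_fst.tendsto (g, g, g)).prodMk_nhds t1'
  have t2' : Tendsto (fun p : G × G × G => f₂ (p.1, f₁ (Γ.inv p.2.1, p.2.2))) (𝓝 (g, g, g))
      (𝓝 g) := by
    have := hf₂.continuousAt.tendsto.comp t2
    rwa [hf₂g] at this
  have hsrc : ∀ᶠ k in 𝓝 g, k ∈ c.source := extChartAt_source_mem_nhds g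
  filter_upwards [t1.eventually he₁, t2.eventually he₂, t2'.eventually hsrc,
    (continuous_fst.tendsto (g, g, g)).eventually hsrc,
    ((continuous_fst.comp continuous_snd).tendsto (g, g, g)).eventually hsrc,
    ((continuous_snd.comp continuous_snd).tendsto (g, g, g)).eventually hsrc]
    with p e1 e2 h0 h1 h2 h3 ht hs
  have i1 := e1 ((Γ.tgt_inv _).trans hs)
  have i2 := e2 (by
    rw [i1, Γ.src_mul _ _ ((Γ.tgt_inv _).trans hs), Γ.src_inv, ht])
  simp only [i1] at i2 h0
  rw [i2] at h0
  refine ⟨h0, ?_⟩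
  simp only [Function.comp_apply] at h2 h3
  rw [c.left_inv h1, c.left_inv h2, c.left_inv h3, i1, i2]

end LieGroupoid

/-! ### Vector fields and derivatives along them, read in a chart. -/

section ChartField

variable {E₁ E₂ E₃ N P Q : Type*}
  [NormedAddCommGroup E₁] [NormedSpace ℝ E₁] [NormedAddCommGroup E₂] [NormedSpace ℝ E₂]
  [NormedAddCommGroup E₃] [NormedSpace ℝ E₃]
  [TopologicalSpace N] [ChartedSpace E₁ N] [TopologicalSpace P] [ChartedSpace E₂ P]
  [TopologicalSpace Q] [ChartedSpace E₃ Q]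

theorem dAt_comp {F : P → Q} {p : N → P} {g : N}
    (hF : MDifferentiableAt 𝓘(ℝ, E₂) 𝓘(ℝ, E₃) F (p g))
    (hp : MDifferentiableAt 𝓘(ℝ, E₁) 𝓘(ℝ, E₂) p g) (v : E₁) :
    (dAt (fun k => F (p k)) g : E₁ →L[ℝ] E₃) v =
      (dAt F (p g) : E₂ →L[ℝ] E₃) ((dAt p g : E₁ →L[ℝ] E₂) v) := by
  have h := (hF.hasMFDerivAt.comp g hp.hasMFDerivAt).mfderiv
  exact congrArg (fun T : E₁ →L[ℝ] E₃ => T v) h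

theorem Filter.EventuallyEq.dAt_eq {p q : N → P} {g : N} (h : p =ᶠ[𝓝 g] q) :
    (dAt p g : E₁ →L[ℝ] E₂) = dAt q g :=
  h.mfderiv_eq (I := 𝓘(ℝ, E₁)) (I' := 𝓘(ℝ, E₂))

/-- A vector field in the chart at `g`. -/
noncomputable def chartField (X : ∀ k : N, TangentSpace 𝓘(ℝ, E₁) k) (g : N) (y : E₁) : E₁ :=
  (dAt (extChartAt 𝓘(ℝ, E₁) g) ((extChartAt 𝓘(ℝ, E₁) g).symm y) : E₁ →L[ℝ] E₁)
    (X ((extChartAt 𝓘(ℝ, E₁) g).symm y))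

theorem chartField_apply {X : ∀ k : N, TangentSpace 𝓘(ℝ, E₁) k} {g k : N}
    (hk : k ∈ (extChartAt 𝓘(ℝ, E₁) g).source) :
    chartField X g (extChartAt 𝓘(ℝ, E₁) g k) =
      (dAt (extChartAt 𝓘(ℝ, E₁) g) k : E₁ →L[ℝ] E₁) (X k) := by
  unfold chartField
  rw [(extChartAt 𝓘(ℝ, E₁) g).left_inv hk]

variable [IsManifold 𝓘(ℝ, E₁) ∞ N]

theorem dAt_extChartAt_self (g : N) (v : E₁) :
    (dAt (extChartAt 𝓘(ℝ, E₁) g) g : E₁ →L[ℝ] E₁) v = v := by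
  have : IsManifold 𝓘(ℝ, E₁) 1 N := IsManifold.of_le (n := ∞) (by simp)
  have h := mfderiv_extChartAt_self (I := 𝓘(ℝ, E₁)) (x := g)
  exact congrArg (fun T : E₁ →L[ℝ] E₁ => T v) h

theorem chartField_self {X : ∀ k : N, TangentSpace 𝓘(ℝ, E₁) k} {g : N} :
    @Eq E₁ (chartField X g (extChartAt 𝓘(ℝ, E₁) g g)) (X g) :=
  (chartField_apply (mem_extChartAt_source g)).trans (dAt_extChartAt_self (E₁ := E₁) g (X g))

/-- Smoothness of a section is tested in the tangent bundle trivialization at `g`, whose fibre maps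
are the derivatives of the chart at `g`. -/
theorem contDiffAt_chartField {X : ∀ k : N, TangentSpace 𝓘(ℝ, E₁) k}
    (hX : ContMDiff 𝓘(ℝ, E₁) 𝓘(ℝ, E₁).tangent ∞ (fun k => (⟨k, X k⟩ : TangentBundle 𝓘(ℝ, E₁) N)))
    (g : N) : ContDiffAt ℝ ∞ (chartField X g) (extChartAt 𝓘(ℝ, E₁) g g) := by
  have : IsManifold 𝓘(ℝ, E₁) 1 N := IsManifold.of_le (n := ∞) (by simp)
  have h1 := (Bundle.contMDiffAt_section g).1 (hX.contMDiffAt (x := g))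
  have h2 : (fun k => (trivializationAt E₁ (TangentSpace 𝓘(ℝ, E₁)) g
      (⟨k, X k⟩ : TangentBundle 𝓘(ℝ, E₁) N)).2) =ᶠ[𝓝 g]
      fun k => (dAt (extChartAt 𝓘(ℝ, E₁) g) k : E₁ →L[ℝ] E₁) (X k) := by
    filter_upwards [(chartAt E₁ g).open_source.mem_nhds (mem_chart_source E₁ g)] with k hk
    have h3 := TangentBundle.continuousLinearMapAt_trivializationAt (I := 𝓘(ℝ, E₁)) hk
    have h4 := congrFun ((trivializationAt E₁ (TangentSpace 𝓘(ℝ, E₁)) g).coe_linearMapAt_of_mem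
      (R := ℝ) (b := k) (by rwa [TangentBundle.trivializationAt_baseSet])) (X k)
    exact h4.symm.trans (congrArg (fun T : TangentSpace 𝓘(ℝ, E₁) k →L[ℝ] E₁ => T (X k)) h3)
  have h5 := h1.congr_of_eventuallyEq h2.symm
  have h6 : ContMDiffAt 𝓘(ℝ, E₁) 𝓘(ℝ, E₁) ∞
      (fun k => (dAt (extChartAt 𝓘(ℝ, E₁) g) k : E₁ →L[ℝ] E₁) (X k))
      ((extChartAt 𝓘(ℝ, E₁) g).symm (extChartAt 𝓘(ℝ, E₁) g g)) := by
    rw [extChartAt_to_inv]; exact h5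
  exact (h6.comp _ (contMDiffAt_extChartAt_symm_self g)).contDiffAt

theorem fderiv_comp_extChartAt_symm {L : N → ℝ} (hL : ContMDiff 𝓘(ℝ, E₁) 𝓘(ℝ, ℝ) ∞ L) {g k : N}
    (hk : k ∈ (extChartAt 𝓘(ℝ, E₁) g).source) (v : E₁) :
    fderiv ℝ (fun y => L ((extChartAt 𝓘(ℝ, E₁) g).symm y)) (extChartAt 𝓘(ℝ, E₁) g k)
      ((dAt (extChartAt 𝓘(ℝ, E₁) g) k : E₁ →L[ℝ] E₁) v) = (dAt L k : E₁ →L[ℝ] ℝ) v := by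
  have h1 : MDifferentiableAt 𝓘(ℝ, E₁) 𝓘(ℝ, ℝ) (fun y => L ((extChartAt 𝓘(ℝ, E₁) g).symm y))
      (extChartAt 𝓘(ℝ, E₁) g k) :=
    MDifferentiableAt.comp (g := L) _ (hL.contMDiffAt.mdifferentiableAt (by simp))
      (mdifferentiableAt_extChartAt_symm hk)
  have : IsManifold 𝓘(ℝ, E₁) 1 N := IsManifold.of_le (n := ∞) (by simp)
  have h2 := dAt_comp h1
    (mdifferentiableAt_extChartAt (I := 𝓘(ℝ, E₁)) (by rwa [extChartAt_source] at hk)) v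
  have h3 : L =ᶠ[𝓝 k]
      fun k => L ((extChartAt 𝓘(ℝ, E₁) g).symm (extChartAt 𝓘(ℝ, E₁) g k)) := by
    filter_upwards [(isOpen_extChartAt_source (I := 𝓘(ℝ, E₁)) g).mem_nhds hk] with k hk
    rw [(extChartAt 𝓘(ℝ, E₁) g).left_inv hk]
  rw [h3.dAt_eq, h2, ← vel_eq_fderiv]
  rfl

/-- The derivative of `k ↦ X_k(L)` at `g` is the derivative of its expression in the chart. -/
theorem dAt_derivative_along {L : N → ℝ} (hL : ContMDiff 𝓘(ℝ, E₁) 𝓘(ℝ, ℝ) ∞ L)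
    {X : ∀ k : N, TangentSpace 𝓘(ℝ, E₁) k}
    (hX : ContMDiff 𝓘(ℝ, E₁) 𝓘(ℝ, E₁).tangent ∞ (fun k => (⟨k, X k⟩ : TangentBundle 𝓘(ℝ, E₁) N)))
    (g : N) (v : E₁) :
    (dAt (fun k => (dAt L k : E₁ →L[ℝ] ℝ) (X k)) g : E₁ →L[ℝ] ℝ) v =
      fderiv ℝ (fun y => fderiv ℝ (fun y => L ((extChartAt 𝓘(ℝ, E₁) g).symm y)) y
        (chartField X g y)) (extChartAt 𝓘(ℝ, E₁) g g) v := by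
  have : IsManifold 𝓘(ℝ, E₁) 1 N := IsManifold.of_le (n := ∞) (by simp)
  have hℓ : ContDiffAt ℝ ∞ (fun y => L ((extChartAt 𝓘(ℝ, E₁) g).symm y))
      (extChartAt 𝓘(ℝ, E₁) g g) := contDiffAt_chart_rep hL.contMDiffAt
  have h1 := ((hℓ.fderiv_right (m := ∞) (by simp)).clm_apply
    (contDiffAt_chartField hX g)).differentiableAt (by simp)
  have h2 : (fun k => (dAt L k : E₁ →L[ℝ] ℝ) (X k)) =ᶠ[𝓝 g] fun k =>
      fderiv ℝ (fun y => L ((extChartAt 𝓘(ℝ, E₁) g).symm y)) (extChartAt 𝓘(ℝ, E₁) g k)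
        (chartField X g (extChartAt 𝓘(ℝ, E₁) g k)) := by
    filter_upwards [extChartAt_source_mem_nhds (I := 𝓘(ℝ, E₁)) g] with k hk
    rw [chartField_apply hk]
    exact (fderiv_comp_extChartAt_symm hL hk (X k)).symm
  rw [h2.dAt_eq, dAt_comp (F := fun y => fderiv ℝ (fun y => L ((extChartAt 𝓘(ℝ, E₁) g).symm y)) y
      (chartField X g y)) h1.mdifferentiableAt
      (mdifferentiableAt_extChartAt (I := 𝓘(ℝ, E₁)) (mem_chart_source E₁ g)),
    dAt_extChartAt_self, ← vel_eq_fderiv]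
  rfl

end ChartField

/-! ### The triple product encodes right translations. -/

namespace LieGroupoid

variable {EG EM G M : Type*}
    [NormedAddCommGroup EG] [NormedSpace ℝ EG] [NormedAddCommGroup EM] [NormedSpace ℝ EM]
    [TopologicalSpace G] [ChartedSpace EG G] [TopologicalSpace M] [ChartedSpace EM M]
    (Γ : LieGroupoid EG EM G M)

/-- `m` represents `(h', s, h) ↦ h' (s⁻¹ h)` in the chart at `g`. -/
structure IsTripleMulRep (g : G) (m : EG × EG × EG → EG) : Prop where
  smooth : ContDiffAt ℝ ∞ m
    (extChartAt 𝓘(ℝ, EG) g g, extChartAt 𝓘(ℝ, EG) g g, extChartAt 𝓘(ℝ, EG) g g)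
  eq : ∀ᶠ p : G × G × G in 𝓝 (g, g, g), Γ.tgt p.1 = Γ.tgt p.2.1 → Γ.src p.2.1 = Γ.src p.2.2 →
    Γ.mul p.1 (Γ.mul (Γ.inv p.2.1) p.2.2) ∈ (extChartAt 𝓘(ℝ, EG) g).source ∧
    m (extChartAt 𝓘(ℝ, EG) g p.1, extChartAt 𝓘(ℝ, EG) g p.2.1, extChartAt 𝓘(ℝ, EG) g p.2.2) =
      extChartAt 𝓘(ℝ, EG) g (Γ.mul p.1 (Γ.mul (Γ.inv p.2.1) p.2.2))

namespace IsTripleMulRep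

variable {Γ} {g : G} {m : EG × EG × EG → EG}

theorem apply_self (hm : Γ.IsTripleMulRep g m) :
    m (extChartAt 𝓘(ℝ, EG) g g, extChartAt 𝓘(ℝ, EG) g g, extChartAt 𝓘(ℝ, EG) g g) =
      extChartAt 𝓘(ℝ, EG) g g := by
  rw [(hm.eq.self_of_nhds rfl rfl).2, Γ.mul_inv_cancel_left rfl]

/-- Freezing the middle argument of the triple product at `g` leaves `(h, s) ↦ h g⁻¹ s`. -/
theorem isFibreRep (hm : Γ.IsTripleMulRep g m) {L : G → ℝ}
    (hL : ContMDiff 𝓘(ℝ, EG) 𝓘(ℝ, ℝ) ∞ L) :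
    Γ.IsFibreRep L g fun q => L ((extChartAt 𝓘(ℝ, EG) g).symm
      (m (q.1, extChartAt 𝓘(ℝ, EG) g g, q.2))) := by
  constructor
  · have hℓ : ContDiffAt ℝ ∞ (fun y => L ((extChartAt 𝓘(ℝ, EG) g).symm y))
      (m (extChartAt 𝓘(ℝ, EG) g g, extChartAt 𝓘(ℝ, EG) g g, extChartAt 𝓘(ℝ, EG) g g)) := by
      rw [hm.apply_self]; exact contDiffAt_chart_rep hL.contMDiffAt
    have hι : ContDiff ℝ ∞ (fun q : EG × EG => (q.1, extChartAt 𝓘(ℝ, EG) g g, q.2)) :=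
      contDiff_fst.prodMk (contDiff_const.prodMk contDiff_snd)
    exact ContDiffAt.comp (g := fun y => L ((extChartAt 𝓘(ℝ, EG) g).symm y))
      (f := fun q : EG × EG => m (q.1, extChartAt 𝓘(ℝ, EG) g g, q.2)) _ hℓ
      (ContDiffAt.comp (g := m) _ hm.smooth hι.contDiffAt)
  · have t : Tendsto (fun p : G × G => (p.1, g, p.2)) (𝓝 (g, g)) (𝓝 (g, g, g)) :=
      (continuous_fst.prodMk (continuous_const.prodMk continuous_snd)).tendsto (g, g)
    filter_upwards [t.eventually hm.eq] with p hp h1 h2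
    have h3 := hp h1 h2.symm
    rw [h3.2, (extChartAt 𝓘(ℝ, EG) g).left_inv h3.1]

variable [IsManifold 𝓘(ℝ, EG) ∞ G] [CompleteSpace EG] [FiniteDimensional ℝ EM]

/-- On the `α`-fibre through `g` the triple product satisfies `g g⁻¹ s = s`, so it differentiates to
the identity there. -/
theorem fderiv_third (hm : Γ.IsTripleMulRep g m) {v : EG} (hv : v ∈ Γ.Vsrc g) :
    fderiv ℝ m (extChartAt 𝓘(ℝ, EG) g g, extChartAt 𝓘(ℝ, EG) g g, extChartAt 𝓘(ℝ, EG) g g)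
      (0, 0, v) = v := by
  obtain ⟨ψ, hψ0, hψ, hψS, hψv⟩ := Γ.exists_src_param g
  have h1 := hasFDerivAt_extChartAt_comp hψ0 (hψ.mdifferentiableAt (by simp))
  have hk := (hasFDerivAt_const (extChartAt 𝓘(ℝ, EG) g g) (0 : EG)).prodMk
    ((hasFDerivAt_const (extChartAt 𝓘(ℝ, EG) g g) (0 : EG)).prodMk h1)
  have hm' : HasFDerivAt m (fderiv ℝ m (extChartAt 𝓘(ℝ, EG) g g, extChartAt 𝓘(ℝ, EG) g g,
      extChartAt 𝓘(ℝ, EG) g g)) (extChartAt 𝓘(ℝ, EG) g g, extChartAt 𝓘(ℝ, EG) g g,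
      extChartAt 𝓘(ℝ, EG) g (ψ 0)) := by
    rw [hψ0]; exact (hm.smooth.differentiableAt (by simp)).hasFDerivAt
  have h2 := HasFDerivAt.comp (g := m) (0 : EG) hm' hk
  have h3 : (fun s => m (extChartAt 𝓘(ℝ, EG) g g, extChartAt 𝓘(ℝ, EG) g g,
      extChartAt 𝓘(ℝ, EG) g (ψ s))) =ᶠ[𝓝 0] fun s => extChartAt 𝓘(ℝ, EG) g (ψ s) := by
    have t : Tendsto (fun s => (g, g, ψ s)) (𝓝 0) (𝓝 (g, g, g)) := by
      have := hψ.continuousAt.tendsto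
      rw [hψ0] at this
      exact tendsto_const_nhds.prodMk_nhds (tendsto_const_nhds.prodMk_nhds this)
    filter_upwards [t.eventually hm.eq, hψS] with s hs hs'
    rw [(hs rfl hs'.symm).2, Γ.mul_inv_cancel_left hs'.symm]
  have h4 := congrArg (fun T : EG →L[ℝ] EG => T v) ((h2.congr_of_eventuallyEq h3.symm).unique h1)
  simpa [hψv v hv] using h4

/-- With `q = (h, s)`, right translation by `s⁻¹ h` is the triple product with its last two
arguments fixed at `s` and `h`. Its tangent map at `s` is therefore the first partial derivative of
`m` at `(s, s, h)`. -/
theorem dAt_dr (hm : Γ.IsTripleMulRep g m) :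
    ∀ᶠ q : G × G in 𝓝 (g, g), Γ.src q.1 = Γ.src q.2 → ∀ v : EG, v ∈ Γ.Vtgt q.2 →
      (dAt (extChartAt 𝓘(ℝ, EG) g) q.1 : EG →L[ℝ] EG)
        (Γ.dr (Γ.mul (Γ.inv q.2) q.1) q.2 v) =
      fderiv ℝ m (extChartAt 𝓘(ℝ, EG) g q.2, extChartAt 𝓘(ℝ, EG) g q.2, extChartAt 𝓘(ℝ, EG) g q.1)
        ((dAt (extChartAt 𝓘(ℝ, EG) g) q.2 : EG →L[ℝ] EG) v, 0, 0) := by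
  have : IsManifold 𝓘(ℝ, EG) 1 G := IsManifold.of_le (n := ∞) (by simp)
  have t1 : Tendsto (fun q : G × G => (q.2, q.2, q.1)) (𝓝 (g, g)) (𝓝 (g, g, g)) :=
    (continuous_snd.prodMk (continuous_snd.prodMk continuous_fst)).tendsto (g, g)
  have hc := (continuousAt_extChartAt (I := 𝓘(ℝ, EG)) g).tendsto
  have t2 : Tendsto (fun q : G × G => (extChartAt 𝓘(ℝ, EG) g q.2, extChartAt 𝓘(ℝ, EG) g q.2,
      extChartAt 𝓘(ℝ, EG) g q.1)) (𝓝 (g, g)) (𝓝 (extChartAt 𝓘(ℝ, EG) g g,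
      extChartAt 𝓘(ℝ, EG) g g, extChartAt 𝓘(ℝ, EG) g g)) :=
    (hc.comp (continuous_snd.tendsto (g, g))).prodMk_nhds
      ((hc.comp (continuous_snd.tendsto (g, g))).prodMk_nhds
        (hc.comp (continuous_fst.tendsto (g, g))))
  have hsrc : ∀ᶠ k in 𝓝 g, k ∈ (chartAt EG g).source :=
    (chartAt EG g).open_source.mem_nhds (mem_chart_source EG g)
  filter_upwards [t1.eventually hm.eq.eventually_nhds,
    t2.eventually hm.smooth.eventually_differentiableAt,
    (continuous_fst.tendsto (g, g)).eventually hsrc,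
    (continuous_snd.tendsto (g, g)).eventually hsrc] with q hq1 hq2 hq3 hq4 hq5 v hv
  obtain ⟨φ, hφ0, hφ, hφS, hφv⟩ := Γ.exists_tgt_param q.2
  have hφd := hφ.mdifferentiableAt (by simp)
  have hq6 : Γ.tgt (Γ.inv q.2) = Γ.src q.1 := (Γ.tgt_inv _).trans hq5.symm
  have hq7 : Γ.tgt q.2 = Γ.src (Γ.mul (Γ.inv q.2) q.1) := by rw [Γ.src_mul _ _ hq6, Γ.src_inv]
  have hφS' : ∀ᶠ s in 𝓝 0, Γ.tgt (φ s) = Γ.src (Γ.mul (Γ.inv q.2) q.1) :=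
    hφS.mono fun s hs => hs.trans hq7
  have h1 := Γ.dr_vel hφ0 hq7 hφd hφS' v
  rw [hφv v hv] at h1
  have hφ2 : ContMDiffAt 𝓘(ℝ, EG) 𝓘(ℝ, EG) ∞ (fun s => Γ.mul (φ s) (Γ.mul (Γ.inv q.2) q.1)) 0 :=
    Γ.contMDiffAt_mul hφ contMDiffAt_const hφS'
  have h2 := mfderiv_vel (F := extChartAt 𝓘(ℝ, EG) g) (g := q.1)
    (φ := fun s => Γ.mul (φ s) (Γ.mul (Γ.inv q.2) q.1))
    (by rw [hφ0, Γ.mul_inv_cancel_left hq5.symm])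
    (mdifferentiableAt_extChartAt hq3) (hφ2.mdifferentiableAt (by simp)) v
  have h3 := mfderiv_vel (F := extChartAt 𝓘(ℝ, EG) g) hφ0 (mdifferentiableAt_extChartAt hq4) hφd v
  have h4 : MDifferentiableAt 𝓘(ℝ, EG) 𝓘(ℝ, EG) (fun s => extChartAt 𝓘(ℝ, EG) g (φ s)) 0 := by
    refine MDifferentiableAt.comp (g := extChartAt 𝓘(ℝ, EG) g) 0 ?_ hφd
    rw [hφ0]; exact mdifferentiableAt_extChartAt hq4
  have h5 := h4.differentiableAt.hasFDerivAt
  rw [hφv v hv, vel_eq_fderiv] at h3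
  rw [h1, h2, h3, vel_eq_fderiv]
  have h6 : (fun s => extChartAt 𝓘(ℝ, EG) g (Γ.mul (φ s) (Γ.mul (Γ.inv q.2) q.1))) =ᶠ[𝓝 0]
      fun s => m (extChartAt 𝓘(ℝ, EG) g (φ s), extChartAt 𝓘(ℝ, EG) g q.2,
        extChartAt 𝓘(ℝ, EG) g q.1) := by
    have t : Tendsto (fun s => (φ s, q.2, q.1)) (𝓝 0) (𝓝 (q.2, q.2, q.1)) := by
      have := hφ.continuousAt.tendsto
      rw [hφ0] at this
      exact this.prodMk_nhds tendsto_const_nhds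
    filter_upwards [t.eventually hq1, hφS] with s hs hs'
    exact (hs hs' hq5.symm).2.symm
  have h7 := h5.prodMk
    (hasFDerivAt_const (extChartAt 𝓘(ℝ, EG) g q.2, extChartAt 𝓘(ℝ, EG) g q.1) (0 : EG))
  have hm' : HasFDerivAt m (fderiv ℝ m (extChartAt 𝓘(ℝ, EG) g q.2, extChartAt 𝓘(ℝ, EG) g q.2,
      extChartAt 𝓘(ℝ, EG) g q.1)) (extChartAt 𝓘(ℝ, EG) g (φ 0), extChartAt 𝓘(ℝ, EG) g q.2,
      extChartAt 𝓘(ℝ, EG) g q.1) := by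
    rw [hφ0]; exact hq2.hasFDerivAt
  have h8 : HasFDerivAt (fun s => m (extChartAt 𝓘(ℝ, EG) g (φ s), extChartAt 𝓘(ℝ, EG) g q.2,
        extChartAt 𝓘(ℝ, EG) g q.1)) _ 0 := HasFDerivAt.comp (g := m) (0 : EG) hm' h7
  rw [h6.fderiv_eq, h8.fderiv]
  rfl

theorem _root_.LieGroupoid.dr_unit {s : G} {v : EG} (hv : v ∈ Γ.Vtgt s) :
    Γ.dr (Γ.unit (Γ.tgt s)) s v = v := by
  obtain ⟨φ, hφ0, hφ, hφS, hφv⟩ := Γ.exists_tgt_param s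
  have h := Γ.dr_vel (g := Γ.unit (Γ.tgt s)) hφ0 (Γ.src_unit _).symm
    (hφ.mdifferentiableAt (by simp)) (hφS.mono fun s hs => hs.trans (Γ.src_unit _).symm) v
  have h1 : (fun t => Γ.mul (φ t) (Γ.unit (Γ.tgt s))) =ᶠ[𝓝 0] φ :=
    hφS.mono fun t ht => by simp only; rw [← ht, Γ.mul_unit]
  rwa [h1.vel_eq, hφv v hv] at h

/-- For `h = s` the translation is by the unit `s⁻¹ s`, which acts as the identity on `β`-vertical
vectors. -/
theorem transported_diag (hm : Γ.IsTripleMulRep g m) {X : ∀ k : G, TangentSpace 𝓘(ℝ, EG) k}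
    (hX : ∀ k, X k ∈ Γ.Vtgt k) :
    ∀ᶠ y in 𝓝 (extChartAt 𝓘(ℝ, EG) g g), transported m (chartField X g) (y, y) =
      chartField X g y := by
  have t : Tendsto (fun y => ((extChartAt 𝓘(ℝ, EG) g).symm y, (extChartAt 𝓘(ℝ, EG) g).symm y))
      (𝓝 (extChartAt 𝓘(ℝ, EG) g g)) (𝓝 (g, g)) := by
    have := (continuousAt_extChartAt_symm (I := 𝓘(ℝ, EG)) g).tendsto
    rw [extChartAt_to_inv] at this
    exact this.prodMk_nhds this
  filter_upwards [t.eventually hm.dAt_dr, extChartAt_target_mem_nhds (I := 𝓘(ℝ, EG)) g]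
    with y hy hyt
  have h := hy rfl _ (hX _)
  simp only [Γ.inv_mul, (extChartAt 𝓘(ℝ, EG) g).right_inv hyt] at h
  rw [Γ.dr_unit (hX _)] at h
  exact h.symm

end IsTripleMulRep

end LieGroupoid

/-- The derivatives of the chart and of its inverse are mutually inverse, so the `inverse` in the
pullback is the derivative of the chart. -/
theorem mpullbackWithin_extChartAt_symm_apply {E H N : Type*} [NormedAddCommGroup E]
    [NormedSpace ℝ E] [TopologicalSpace H] (I : ModelWithCorners ℝ E H) [TopologicalSpace N]
    [ChartedSpace H N] [IsManifold I 1 N] (V : ∀ p : N, TangentSpace I p) {x : N} {y : E}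
    (hy : y ∈ (extChartAt I x).target) :
    VectorField.mpullbackWithin 𝓘(ℝ, E) I (extChartAt I x).symm V (Set.range I) y =
      mfderiv I 𝓘(ℝ, E) (extChartAt I x) ((extChartAt I x).symm y) (V ((extChartAt I x).symm y)) := by
  rw [VectorField.mpullbackWithin_apply]
  have h1 := mfderivWithin_extChartAt_symm_comp_mfderiv_extChartAt (I := I) hy
  have h2 := mfderiv_extChartAt_comp_mfderivWithin_extChartAt_symm (I := I) hy
  rw [ContinuousLinearMap.inverse_eq h1 h2]
  rfl

section Triple

variable {E₁ N : Type*} [NormedAddCommGroup E₁] [NormedSpace ℝ E₁]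
  [TopologicalSpace N] [ChartedSpace E₁ N] [IsManifold 𝓘(ℝ, E₁) ∞ N]

theorem mfderiv_extChartAt_triple {g : N} {p : N × N × N} (h1 : p.1 ∈ (chartAt E₁ g).source)
    (h2 : p.2.1 ∈ (chartAt E₁ g).source) (h3 : p.2.2 ∈ (chartAt E₁ g).source) (a b d : E₁) :
    (mfderiv (𝓘(ℝ, E₁).prod (𝓘(ℝ, E₁).prod 𝓘(ℝ, E₁))) 𝓘(ℝ, E₁ × E₁ × E₁)
      (extChartAt (𝓘(ℝ, E₁).prod (𝓘(ℝ, E₁).prod 𝓘(ℝ, E₁))) (g, g, g)) p :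
        E₁ × E₁ × E₁ →L[ℝ] E₁ × E₁ × E₁) (a, b, d) =
      ((dAt (extChartAt 𝓘(ℝ, E₁) g) p.1 : E₁ →L[ℝ] E₁) a,
        (dAt (extChartAt 𝓘(ℝ, E₁) g) p.2.1 : E₁ →L[ℝ] E₁) b,
        (dAt (extChartAt 𝓘(ℝ, E₁) g) p.2.2 : E₁ →L[ℝ] E₁) d) := by
  have : IsManifold 𝓘(ℝ, E₁) 1 N := IsManifold.of_le (n := ∞) (by simp)
  have e1 := (mdifferentiableAt_extChartAt (I := 𝓘(ℝ, E₁)) h1).hasMFDerivAt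
  have e2 := (mdifferentiableAt_extChartAt (I := 𝓘(ℝ, E₁)) h2).hasMFDerivAt
  have e3 := (mdifferentiableAt_extChartAt (I := 𝓘(ℝ, E₁)) h3).hasMFDerivAt
  have s := hasMFDerivAt_snd (I := 𝓘(ℝ, E₁)) (I' := 𝓘(ℝ, E₁).prod 𝓘(ℝ, E₁)) p
  have f1 := e1.comp p (hasMFDerivAt_fst (I := 𝓘(ℝ, E₁)) (I' := 𝓘(ℝ, E₁).prod 𝓘(ℝ, E₁)) p)
  have f2 := (e2.comp p.2 (hasMFDerivAt_fst (I := 𝓘(ℝ, E₁)) (I' := 𝓘(ℝ, E₁)) p.2)).comp p s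
  have f3 := (e3.comp p.2 (hasMFDerivAt_snd (I := 𝓘(ℝ, E₁)) (I' := 𝓘(ℝ, E₁)) p.2)).comp p s
  have h : HasMFDerivAt (𝓘(ℝ, E₁).prod (𝓘(ℝ, E₁).prod 𝓘(ℝ, E₁))) 𝓘(ℝ, E₁ × E₁ × E₁)
      (extChartAt (𝓘(ℝ, E₁).prod (𝓘(ℝ, E₁).prod 𝓘(ℝ, E₁))) (g, g, g)) p _ :=
    ⟨f1.1.prodMk (f2.1.prodMk f3.1), f1.2.prodMk (f2.2.prodMk f3.2)⟩
  replace h := h.mfderiv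
  exact congrArg (fun T : E₁ × E₁ × E₁ →L[ℝ] E₁ × E₁ × E₁ => T (a, b, d)) h

end Triple

/-! ### Left-invariant fields on `G_β ⋆ G_α` and their bracket in a chart. -/

namespace LieGroupoid

variable {EG EM G M : Type*}
    [NormedAddCommGroup EG] [NormedSpace ℝ EG] [NormedAddCommGroup EM] [NormedSpace ℝ EM]
    [TopologicalSpace G] [ChartedSpace EG G] [TopologicalSpace M] [ChartedSpace EM M]
    [IsManifold 𝓘(ℝ, EG) ∞ G] [CompleteSpace EG] [FiniteDimensional ℝ EM]
    {Γ : LieGroupoid EG EM G M}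

/-- A left-invariant vector field on `G_β ⋆ G_α` in the chart at a unit. -/
theorem IsSection.mpullbackWithin_leftInvariant
    {σ : ∀ g : G, TangentSpace 𝓘(ℝ, EG) g × TangentSpace 𝓘(ℝ, EG) g}
    (hσ : Γ.IsSection σ) {g : G} {m : EG × EG × EG → EG} (hm : Γ.IsTripleMulRep g m) :
    VectorField.mpullbackWithin 𝓘(ℝ, EG × EG × EG) (𝓘(ℝ, EG).prod (𝓘(ℝ, EG).prod 𝓘(ℝ, EG)))
        (extChartAt (𝓘(ℝ, EG).prod (𝓘(ℝ, EG).prod 𝓘(ℝ, EG))) (g, g, g)).symm (Γ.leftInvariant σ)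
        (Set.range (𝓘(ℝ, EG).prod (𝓘(ℝ, EG).prod 𝓘(ℝ, EG))))
      =ᶠ[𝓝[(extChartAt (𝓘(ℝ, EG).prod (𝓘(ℝ, EG).prod 𝓘(ℝ, EG))) (g, g, g)).symm ⁻¹' Γ.star ∩
          Set.range (𝓘(ℝ, EG).prod (𝓘(ℝ, EG).prod 𝓘(ℝ, EG)))]
        (extChartAt (𝓘(ℝ, EG).prod (𝓘(ℝ, EG).prod 𝓘(ℝ, EG))) (g, g, g) (g, g, g))]
      fun y : EG × EG × EG => ((0 : EG), transported m (chartField (fun k => (σ k).1) g) y.2,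
        chartField (fun k => (σ k).1) g y.2.2 + chartField (fun k => (σ k).2) g y.2.2) := by
  have : IsManifold 𝓘(ℝ, EG) 1 G := IsManifold.of_le (n := ∞) (by simp)
  have hc : Tendsto (fun y => (extChartAt 𝓘(ℝ, EG) g).symm y) (𝓝 (extChartAt 𝓘(ℝ, EG) g g))
      (𝓝 g) := by
    have := (continuousAt_extChartAt_symm (I := 𝓘(ℝ, EG)) g).tendsto
    rwa [extChartAt_to_inv] at this
  have t1 : Tendsto (fun y : EG × EG × EG => y.1) (𝓝 (extChartAt 𝓘(ℝ, EG) g g,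
      extChartAt 𝓘(ℝ, EG) g g, extChartAt 𝓘(ℝ, EG) g g)) (𝓝 (extChartAt 𝓘(ℝ, EG) g g)) :=
    continuous_fst.tendsto _
  have t2 : Tendsto (fun y : EG × EG × EG => y.2.1) (𝓝 (extChartAt 𝓘(ℝ, EG) g g,
      extChartAt 𝓘(ℝ, EG) g g, extChartAt 𝓘(ℝ, EG) g g)) (𝓝 (extChartAt 𝓘(ℝ, EG) g g)) :=
    (continuous_fst.comp continuous_snd).tendsto _
  have t3 : Tendsto (fun y : EG × EG × EG => y.2.2) (𝓝 (extChartAt 𝓘(ℝ, EG) g g,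
      extChartAt 𝓘(ℝ, EG) g g, extChartAt 𝓘(ℝ, EG) g g)) (𝓝 (extChartAt 𝓘(ℝ, EG) g g)) :=
    (continuous_snd.comp continuous_snd).tendsto _
  have ht : ∀ᶠ y in 𝓝 (extChartAt 𝓘(ℝ, EG) g g), y ∈ (extChartAt 𝓘(ℝ, EG) g).target :=
    extChartAt_target_mem_nhds g
  have hev : ∀ᶠ y : EG × EG × EG in 𝓝 (extChartAt 𝓘(ℝ, EG) g g, extChartAt 𝓘(ℝ, EG) g g,
      extChartAt 𝓘(ℝ, EG) g g), _ :=
    (t1.eventually ht).and ((t2.eventually ht).and ((t3.eventually ht).and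
      (((hc.comp t2).prodMk_nhds (hc.comp t3)).eventually hm.dAt_dr)))
  filter_upwards [mem_nhdsWithin_of_mem_nhds hev, self_mem_nhdsWithin] with y hy hyS
  obtain ⟨hy1, hy2, hy3, hy4⟩ := hy
  -- Right translation by `s⁻¹ h` needs `α h = α s`. This is why the two fields are compared only
  -- within `Γ.star`.
  have hst := hyS.1.2
  have s1 := (extChartAt 𝓘(ℝ, EG) g).map_target hy1
  have s2 := (extChartAt 𝓘(ℝ, EG) g).map_target hy2
  have s3 := (extChartAt 𝓘(ℝ, EG) g).map_target hy3
  rw [extChartAt_source] at s1 s2 s3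
  have h1 := mpullbackWithin_extChartAt_symm_apply (𝓘(ℝ, EG).prod (𝓘(ℝ, EG).prod 𝓘(ℝ, EG)))
    (Γ.leftInvariant σ) (x := (g, g, g)) (y := y)
    (by rw [extChartAt_prod, extChartAt_prod]; exact ⟨hy1, hy2, hy3⟩)
  have h2 := mfderiv_extChartAt_triple (g := g)
    (p := (extChartAt (𝓘(ℝ, EG).prod (𝓘(ℝ, EG).prod 𝓘(ℝ, EG))) (g, g, g)).symm y) s1 s2 s3 0
    (Γ.dr (Γ.mul (Γ.inv ((extChartAt 𝓘(ℝ, EG) g).symm y.2.2)) ((extChartAt 𝓘(ℝ, EG) g).symm y.2.1))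
      ((extChartAt 𝓘(ℝ, EG) g).symm y.2.2) (σ ((extChartAt 𝓘(ℝ, EG) g).symm y.2.2)).1)
    ((σ ((extChartAt 𝓘(ℝ, EG) g).symm y.2.2)).1 + (σ ((extChartAt 𝓘(ℝ, EG) g).symm y.2.2)).2 : EG)
  refine h1.trans (h2.trans ?_)
  have h3 := hy4 hst _ (hσ.mem _).1
  simp only [Function.comp_apply] at h3
  rw [(extChartAt 𝓘(ℝ, EG) g).right_inv hy2, (extChartAt 𝓘(ℝ, EG) g).right_inv hy3] at h3
  exact Prod.ext (map_zero _) (Prod.ext h3 (map_add _ _ _))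

end LieGroupoid

namespace LieGroupoid

variable {EG EM G M : Type*}
    [NormedAddCommGroup EG] [NormedSpace ℝ EG] [NormedAddCommGroup EM] [NormedSpace ℝ EM]
    [TopologicalSpace G] [ChartedSpace EG G] [TopologicalSpace M] [ChartedSpace EM M]
    [IsManifold 𝓘(ℝ, EG) ∞ G] [CompleteSpace EG] [FiniteDimensional ℝ EM]
    {Γ : LieGroupoid EG EM G M}

/-- On vectors tangent to the `α`-fibre of a unit, derivatives within `G_β ⋆ G_α` (in a chart) agree
with derivatives. -/
theorem fderivWithin_star_apply (Γ : LieGroupoid EG EM G M) {F : Type*} [NormedAddCommGroup F]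
    [NormedSpace ℝ F] {g : G} {W : EG × EG × EG → F}
    (hW : DifferentiableAt ℝ W (extChartAt 𝓘(ℝ, EG) g g, extChartAt 𝓘(ℝ, EG) g g,
      extChartAt 𝓘(ℝ, EG) g g)) {X Y : EG} (hX : X ∈ Γ.Vtgt g) (hY : Y ∈ Γ.Vsrc g) :
    fderivWithin ℝ W ((extChartAt (𝓘(ℝ, EG).prod (𝓘(ℝ, EG).prod 𝓘(ℝ, EG))) (g, g, g)).symm ⁻¹'
        Γ.star ∩ Set.range (𝓘(ℝ, EG).prod (𝓘(ℝ, EG).prod 𝓘(ℝ, EG))))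
        (extChartAt 𝓘(ℝ, EG) g g, extChartAt 𝓘(ℝ, EG) g g, extChartAt 𝓘(ℝ, EG) g g)
        (0, X, X + Y) =
      fderiv ℝ W (extChartAt 𝓘(ℝ, EG) g g, extChartAt 𝓘(ℝ, EG) g g, extChartAt 𝓘(ℝ, EG) g g)
        (0, X, X + Y) := by
  obtain ⟨φ, hφ0, hφ, hφS, hφv⟩ := Γ.exists_tgt_param g
  obtain ⟨ψ, hψ0, hψ, hψS, hψv⟩ := Γ.exists_src_param g
  have hs : ∀ᶠ k in 𝓝 g, k ∈ (extChartAt 𝓘(ℝ, EG) g).source := extChartAt_source_mem_nhds g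
  have hφ' := hasFDerivAt_extChartAt_comp hφ0 (hφ.mdifferentiableAt (by simp))
  have hψ' := hasFDerivAt_extChartAt_comp hψ0 (hψ.mdifferentiableAt (by simp))
  have tφ := hφ.continuousAt.tendsto
  have tψ := hψ.continuousAt.tendsto
  rw [hφ0] at tφ
  rw [hψ0] at tψ
  have mem : ∀ {a b d : G}, a ∈ (extChartAt 𝓘(ℝ, EG) g).source →
      b ∈ (extChartAt 𝓘(ℝ, EG) g).source → d ∈ (extChartAt 𝓘(ℝ, EG) g).source →
      Γ.tgt a = Γ.tgt b → Γ.src b = Γ.src d →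
      ((extChartAt 𝓘(ℝ, EG) g a, extChartAt 𝓘(ℝ, EG) g b, extChartAt 𝓘(ℝ, EG) g d) : EG × EG × EG) ∈
        ((extChartAt (𝓘(ℝ, EG).prod (𝓘(ℝ, EG).prod 𝓘(ℝ, EG))) (g, g, g)).symm ⁻¹'
        Γ.star ∩ Set.range (𝓘(ℝ, EG).prod (𝓘(ℝ, EG).prod 𝓘(ℝ, EG)))) := by
    intro a b d ha hb hd h1 h2
    refine ⟨?_, ⟨(extChartAt 𝓘(ℝ, EG) g a, extChartAt 𝓘(ℝ, EG) g b, extChartAt 𝓘(ℝ, EG) g d),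
      rfl⟩⟩
    have h3 : (extChartAt (𝓘(ℝ, EG).prod (𝓘(ℝ, EG).prod 𝓘(ℝ, EG))) (g, g, g)).symm
        (extChartAt 𝓘(ℝ, EG) g a, extChartAt 𝓘(ℝ, EG) g b, extChartAt 𝓘(ℝ, EG) g d) = (a, b, d) :=
      Prod.ext ((extChartAt 𝓘(ℝ, EG) g).left_inv ha) (Prod.ext
        ((extChartAt 𝓘(ℝ, EG) g).left_inv hb) ((extChartAt 𝓘(ℝ, EG) g).left_inv hd))
    rw [Set.mem_preimage, h3]
    exact ⟨h1, h2⟩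
  have hgs : g ∈ (extChartAt 𝓘(ℝ, EG) g).source := mem_extChartAt_source g
  -- The vector splits as `(0, X, X) + (0, 0, Y)`. The summands are velocities of `(g, φ, φ)` and
  -- `(g, g, ψ)`, both of which stay in `Γ.star`.
  have h1 := fderivWithin_apply_of_path hW
    (γ := fun t => (extChartAt 𝓘(ℝ, EG) g g, extChartAt 𝓘(ℝ, EG) g (φ t),
      extChartAt 𝓘(ℝ, EG) g (φ t))) (t := 0) (by simp only [hφ0])
    ((hasFDerivAt_const (extChartAt 𝓘(ℝ, EG) g g) (0 : EG)).prodMk (hφ'.prodMk hφ'))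
    (S := (extChartAt (𝓘(ℝ, EG).prod (𝓘(ℝ, EG).prod 𝓘(ℝ, EG))) (g, g, g)).symm ⁻¹'
        Γ.star ∩ Set.range (𝓘(ℝ, EG).prod (𝓘(ℝ, EG).prod 𝓘(ℝ, EG)))) (by
      filter_upwards [tφ.eventually hs, hφS] with t e1 e2
      exact mem hgs e1 e1 e2.symm rfl) X
  have h2 := fderivWithin_apply_of_path hW
    (γ := fun t => (extChartAt 𝓘(ℝ, EG) g g, extChartAt 𝓘(ℝ, EG) g g,
      extChartAt 𝓘(ℝ, EG) g (ψ t))) (t := 0) (by simp only [hψ0])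
    ((hasFDerivAt_const (extChartAt 𝓘(ℝ, EG) g g) (0 : EG)).prodMk
      ((hasFDerivAt_const (extChartAt 𝓘(ℝ, EG) g g) (0 : EG)).prodMk hψ'))
    (S := (extChartAt (𝓘(ℝ, EG).prod (𝓘(ℝ, EG).prod 𝓘(ℝ, EG))) (g, g, g)).symm ⁻¹'
        Γ.star ∩ Set.range (𝓘(ℝ, EG).prod (𝓘(ℝ, EG).prod 𝓘(ℝ, EG)))) (by
      filter_upwards [tψ.eventually hs, hψS] with t e1 e2
      exact mem hgs hgs e1 rfl e2.symm) Y
  simp only [ContinuousLinearMap.prod_apply, zero_apply, hφv X hX, hψv Y hY] at h1 h2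
  have h3 : ((0, X, X + Y) : EG × EG × EG) = (0, X, X) + (0, 0, Y) := by simp
  rw [h3, map_add, map_add, h1, h2]

theorem fderivWithin_star_transported (Γ : LieGroupoid EG EM G M) {g : G} {m : EG × EG × EG → EG}
    (hm : Γ.IsTripleMulRep g m) {X Y : EG → EG} (hX : ContDiffAt ℝ ∞ X (extChartAt 𝓘(ℝ, EG) g g))
    (hY : ContDiffAt ℝ ∞ Y (extChartAt 𝓘(ℝ, EG) g g)) {a b : EG} (ha : a ∈ Γ.Vtgt g)
    (hb : b ∈ Γ.Vsrc g) :
    (fderivWithin ℝ (fun y : EG × EG × EG => ((0 : EG), transported m X y.2, X y.2.2 + Y y.2.2))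
      ((extChartAt (𝓘(ℝ, EG).prod (𝓘(ℝ, EG).prod 𝓘(ℝ, EG))) (g, g, g)).symm ⁻¹'
        Γ.star ∩ Set.range (𝓘(ℝ, EG).prod (𝓘(ℝ, EG).prod 𝓘(ℝ, EG))))
        (extChartAt 𝓘(ℝ, EG) g g, extChartAt 𝓘(ℝ, EG) g g, extChartAt 𝓘(ℝ, EG) g g)
        (0, a, a + b)).2.1 =
      fderiv ℝ (transported m X) (extChartAt 𝓘(ℝ, EG) g g, extChartAt 𝓘(ℝ, EG) g g) (a, a + b) := by
  have h1 : HasFDerivAt (fun y : EG × EG × EG => transported m X y.2)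
      ((fderiv ℝ (transported m X) (extChartAt 𝓘(ℝ, EG) g g, extChartAt 𝓘(ℝ, EG) g g)).comp
        (ContinuousLinearMap.snd ℝ EG (EG × EG)))
      (extChartAt 𝓘(ℝ, EG) g g, extChartAt 𝓘(ℝ, EG) g g, extChartAt 𝓘(ℝ, EG) g g) :=
    HasFDerivAt.comp (g := transported m X) _
      ((contDiffAt_transported hm.smooth hX).differentiableAt (by simp)).hasFDerivAt hasFDerivAt_snd
  have h2 : DifferentiableAt ℝ (fun y : EG × EG × EG => X y.2.2 + Y y.2.2)
      (extChartAt 𝓘(ℝ, EG) g g, extChartAt 𝓘(ℝ, EG) g g, extChartAt 𝓘(ℝ, EG) g g) :=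
    DifferentiableAt.comp (g := fun y => X y + Y y) (f := fun y : EG × EG × EG => y.2.2) _
      ((hX.differentiableAt (by simp)).add (hY.differentiableAt (by simp)))
      (differentiableAt_snd.comp _ differentiableAt_snd)
  have h := (hasFDerivAt_const (0 : EG) ((extChartAt 𝓘(ℝ, EG) g g, extChartAt 𝓘(ℝ, EG) g g,
    extChartAt 𝓘(ℝ, EG) g g) : EG × EG × EG)).prodMk (h1.prodMk h2.hasFDerivAt)
  rw [Γ.fderivWithin_star_apply h.differentiableAt ha hb, h.fderiv]
  rfl

/-- The first component of the bracket of sections in a chart. -/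
theorem IsSection.bracket_fst
    {σ σ' : ∀ g : G, TangentSpace 𝓘(ℝ, EG) g × TangentSpace 𝓘(ℝ, EG) g}
    (hσ : Γ.IsSection σ) (hσ' : Γ.IsSection σ') {g : G} {m : EG × EG × EG → EG}
    (hm : Γ.IsTripleMulRep g m) {X Y X' Y' : EG} (hX : @Eq EG (σ g).1 X) (hY : @Eq EG (σ g).2 Y)
    (hX' : @Eq EG (σ' g).1 X') (hY' : @Eq EG (σ' g).2 Y') :
    @Eq EG (Γ.bracket σ σ' g).1
      (fderiv ℝ (transported m (chartField (fun k => (σ' k).1) g))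
          (extChartAt 𝓘(ℝ, EG) g g, extChartAt 𝓘(ℝ, EG) g g) (X, X + Y) -
        fderiv ℝ (transported m (chartField (fun k => (σ k).1) g))
          (extChartAt 𝓘(ℝ, EG) g g, extChartAt 𝓘(ℝ, EG) g g) (X', X' + Y')) := by
  have : IsManifold 𝓘(ℝ, EG) 1 G := IsManifold.of_le (n := ∞) (by simp)
  obtain ⟨V, hV⟩ : ∃ V : (∀ g : G, TangentSpace 𝓘(ℝ, EG) g × TangentSpace 𝓘(ℝ, EG) g) →
    EG × EG × EG → EG × EG × EG, V = fun σ y => ((0 : EG),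
      transported m (chartField (fun k => (σ k).1) g) y.2,
      chartField (fun k => (σ k).1) g y.2.2 + chartField (fun k => (σ k).2) g y.2.2) := ⟨_, rfl⟩
  have hVg : ∀ {σ}, Γ.IsSection σ → ∀ {X Y : EG}, @Eq EG (σ g).1 X → @Eq EG (σ g).2 Y →
      V σ (extChartAt 𝓘(ℝ, EG) g g, extChartAt 𝓘(ℝ, EG) g g, extChartAt 𝓘(ℝ, EG) g g) =
        (0, X, X + Y) := by
    intro σ hσ X Y hX hY
    rw [hV]
    refine Prod.ext rfl (Prod.ext ?_ (congrArg₂ (· + ·) (chartField_self.trans hX)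
      (chartField_self.trans hY)))
    exact ((hm.transported_diag fun k => (hσ.mem k).1).self_of_nhds).trans
      (chartField_self.trans hX)
  have hB : @Eq (EG × EG × EG)
      (VectorField.mlieBracketWithin (𝓘(ℝ, EG).prod (𝓘(ℝ, EG).prod 𝓘(ℝ, EG)))
        (Γ.leftInvariant σ) (Γ.leftInvariant σ') Γ.star (g, g, g))
      (VectorField.lieBracketWithin ℝ (V σ) (V σ')
        ((extChartAt (𝓘(ℝ, EG).prod (𝓘(ℝ, EG).prod 𝓘(ℝ, EG))) (g, g, g)).symm ⁻¹'
          Γ.star ∩ Set.range (𝓘(ℝ, EG).prod (𝓘(ℝ, EG).prod 𝓘(ℝ, EG))))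
        (extChartAt 𝓘(ℝ, EG) g g, extChartAt 𝓘(ℝ, EG) g g, extChartAt 𝓘(ℝ, EG) g g)) := by
    -- At its own centre the chart has identity derivative, so the manifold bracket at the unit is
    -- the bracket of the coordinate fields.
    have h1 : (ContinuousLinearMap.inverse
        (mfderiv (𝓘(ℝ, EG).prod (𝓘(ℝ, EG).prod 𝓘(ℝ, EG))) 𝓘(ℝ, EG × EG × EG)
        (extChartAt (𝓘(ℝ, EG).prod (𝓘(ℝ, EG).prod 𝓘(ℝ, EG))) (g, g, g)) (g, g, g)) :
          EG × EG × EG →L[ℝ] EG × EG × EG) = ContinuousLinearMap.id ℝ (EG × EG × EG) :=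
      (congrArg (fun T : EG × EG × EG →L[ℝ] EG × EG × EG => T.inverse)
        (mfderiv_extChartAt_self (I := 𝓘(ℝ, EG).prod (𝓘(ℝ, EG).prod 𝓘(ℝ, EG)))
          (x := (g, g, g)))).trans ContinuousLinearMap.inverse_id
    have h2 := Filter.EventuallyEq.lieBracketWithin_vectorField_eq_of_mem (𝕜 := ℝ)
      (E := EG × EG × EG) (hσ.mpullbackWithin_leftInvariant hm)
      (hσ'.mpullbackWithin_leftInvariant hm) (by
        refine ⟨?_, ⟨(extChartAt 𝓘(ℝ, EG) g g, extChartAt 𝓘(ℝ, EG) g g, extChartAt 𝓘(ℝ, EG) g g),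
          rfl⟩⟩
        rw [Set.mem_preimage, extChartAt_to_inv]
        exact ⟨rfl, rfl⟩)
    refine (VectorField.mlieBracketWithin_apply (I := 𝓘(ℝ, EG).prod (𝓘(ℝ, EG).prod 𝓘(ℝ, EG)))
      (x₀ := (g, g, g))).trans ?_
    refine (congrArg (fun T : EG × EG × EG →L[ℝ] EG × EG × EG => T _) h1).trans ?_
    rw [hV]
    exact h2
  -- Only the middle component matters, because `Θ⁻` sees only the first entry of the bracket.
  refine (congrArg (fun v : EG × EG × EG => v.2.1) hB).trans ?_
  rw [VectorField.lieBracketWithin, hVg hσ hX hY, hVg hσ' hX' hY', hV]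
  refine congrArg₂ (fun a b : EG => a - b)
    (Γ.fderivWithin_star_transported hm (contDiffAt_chartField hσ'.smooth_fst g)
      (contDiffAt_chartField hσ'.smooth_snd g) (hX ▸ (hσ.mem g).1) (hY ▸ (hσ.mem g).2))
    (Γ.fderivWithin_star_transported hm (contDiffAt_chartField hσ.smooth_fst g)
      (contDiffAt_chartField hσ.smooth_snd g) (hX' ▸ (hσ'.mem g).1) (hY' ▸ (hσ'.mem g).2))

end LieGroupoid

/-! ### The Poincaré–Cartan 2-section and its invariance. -/

namespace LieGroupoid

variable {EG EM G M : Type*}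
    [NormedAddCommGroup EG] [NormedSpace ℝ EG] [NormedAddCommGroup EM] [NormedSpace ℝ EM]
    [TopologicalSpace G] [ChartedSpace EG G] [TopologicalSpace M] [ChartedSpace EM M]
    (Γ : LieGroupoid EG EM G M)

/-- `Ω_L = -d Θ⁻` evaluated on sections. -/
theorem dSections_thetaMinus {L : G → ℝ}
    {σ σ' : ∀ g : G, TangentSpace 𝓘(ℝ, EG) g × TangentSpace 𝓘(ℝ, EG) g} {g : G}
    {X Y X' Y' B : EG}
    (hX : @Eq EG (σ g).1 X) (hY : @Eq EG (σ g).2 Y)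
    (hX' : @Eq EG (σ' g).1 X') (hY' : @Eq EG (σ' g).2 Y')
    (hB : @Eq EG (Γ.bracket σ σ' g).1 B) :
    -Γ.dSections (thetaMinus L) σ σ' g =
      (dAt (fun k => (dAt L k : EG →L[ℝ] ℝ) (σ' k).1) g : EG →L[ℝ] ℝ) (X + Y) -
        (dAt (fun k => (dAt L k : EG →L[ℝ] ℝ) (σ k).1) g : EG →L[ℝ] ℝ) (X' + Y') -
        (dAt L g : EG →L[ℝ] ℝ) B := by
  subst hX hY hX' hY' hB
  have key : ∀ (σ : ∀ g : G, TangentSpace 𝓘(ℝ, EG) g × TangentSpace 𝓘(ℝ, EG) g)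
      (u : TangentSpace 𝓘(ℝ, EG) g × TangentSpace 𝓘(ℝ, EG) g),
      d₀ (fun k => thetaMinus L k (σ k)) g u =
        -((dAt (fun k => (dAt L k : EG →L[ℝ] ℝ) (σ k).1) g : EG →L[ℝ] ℝ) (u.1 + u.2 : EG)) := by
    intro σ u
    have h := mfderiv_neg (I := 𝓘(ℝ, EG)) (f := fun k => (dAt L k : EG →L[ℝ] ℝ) (σ k).1) (x := g)
    exact congrArg (fun T : EG →L[ℝ] ℝ => T (u.1 + u.2 : EG)) h
  have h2 : thetaMinus L g (Γ.bracket σ σ' g) = -((dAt L g : EG →L[ℝ] ℝ) (Γ.bracket σ σ' g).1) :=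
    rfl
  have h3 : ∀ a b c : ℝ, -(-a - -b - -c) = a - b - c := by intros; ring
  rw [dSections, key, key, h2]
  exact h3 _ _ _

variable [FiniteDimensional ℝ EG] [FiniteDimensional ℝ EM] [T2Space G] [IsManifold 𝓘(ℝ, EG) ∞ G]
    [IsManifold 𝓘(ℝ, EM) ∞ M]

/-- The Poincaré–Cartan 2-section is a mixed second derivative of `(h, s) ↦ L (h g⁻¹ s)`. -/
theorem exists_fibreRep_omega_eq {L : G → ℝ} (hL : ContMDiff 𝓘(ℝ, EG) 𝓘(ℝ, ℝ) ∞ L) (g : G) :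
    ∃ N, Γ.IsFibreRep L g N ∧ ∀ X Y X' Y' : EG, X ∈ Γ.Vtgt g → Y ∈ Γ.Vsrc g → X' ∈ Γ.Vtgt g →
      Y' ∈ Γ.Vsrc g → Γ.omega L g (X, Y) (X', Y') =
      fderiv ℝ (fderiv ℝ N) (extChartAt 𝓘(ℝ, EG) g g, extChartAt 𝓘(ℝ, EG) g g) (X', 0) (0, Y) -
      fderiv ℝ (fderiv ℝ N) (extChartAt 𝓘(ℝ, EG) g g, extChartAt 𝓘(ℝ, EG) g g) (X, 0) (0, Y') := by
  have : CompleteSpace EG := FiniteDimensional.complete ℝ EG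
  obtain ⟨m, hms, hme⟩ := Γ.exists_chart_triple_mul g
  have hm : Γ.IsTripleMulRep g m := ⟨hms, hme⟩
  refine ⟨_, hm.isFibreRep hL, ?_⟩
  intro X Y X' Y' hX hY hX' hY'
  obtain ⟨hσ, hσg⟩ := Γ.extend_spec (g := g) (u := (X, Y)) ⟨hX, hY⟩
  obtain ⟨hσ', hσg'⟩ := Γ.extend_spec (g := g) (u := (X', Y')) ⟨hX', hY'⟩
  have e1 : @Eq EG (Γ.extend g (X, Y) g).1 X := congrArg Prod.fst hσg
  have e2 : @Eq EG (Γ.extend g (X, Y) g).2 Y := congrArg Prod.snd hσg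
  have e1' : @Eq EG (Γ.extend g (X', Y') g).1 X' := congrArg Prod.fst hσg'
  have e2' : @Eq EG (Γ.extend g (X', Y') g).2 Y' := congrArg Prod.snd hσg'
  have hdL : ∀ v : EG, (dAt L g : EG →L[ℝ] ℝ) v =
      fderiv ℝ (fun y => L ((extChartAt 𝓘(ℝ, EG) g).symm y)) (extChartAt 𝓘(ℝ, EG) g g) v := by
    intro v
    rw [← fderiv_comp_extChartAt_symm hL (mem_extChartAt_source g) v, dAt_extChartAt_self]
  have h := mixed_eq_of_transported
    (ℓ := fun y => L ((extChartAt 𝓘(ℝ, EG) g).symm y)) hm.smooth (contDiffAt_chart_rep hL.contMDiffAt) hm.apply_self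
    (contDiffAt_chartField hσ.smooth_fst g) (contDiffAt_chartField hσ'.smooth_fst g)
    (hm.transported_diag fun k => (hσ.mem k).1) (hm.transported_diag fun k => (hσ'.mem k).1)
    (hm.fderiv_third hY) (hm.fderiv_third hY')
  have c1 := (chartField_self (X := fun k => (Γ.extend g (X, Y) k).1) (g := g)).trans e1
  have c2 := (chartField_self (X := fun k => (Γ.extend g (X', Y') k).1) (g := g)).trans e1'
  rw [c1, c2] at h
  refine Eq.trans ?_ h
  have hd := Γ.dSections_thetaMinus (L := L) e1 e2 e1' e2' (hσ.bracket_fst hσ' hm e1 e2 e1' e2')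
  rw [dAt_derivative_along hL hσ'.smooth_fst, dAt_derivative_along hL hσ.smooth_fst, hdL] at hd
  exact hd

theorem IsEvolutionOperator.pullback_omega {Γ : LieGroupoid EG EM G M} {L : G → ℝ}
    (hL : ContMDiff 𝓘(ℝ, EG) 𝓘(ℝ, ℝ) ∞ L) {ξ : G → G} (hξ : Γ.IsEvolutionOperator L ξ) {g : G}
    {u v : TangentSpace 𝓘(ℝ, EG) g × TangentSpace 𝓘(ℝ, EG) g} (hu : u ∈ Γ.fibre g)
    (hv : v ∈ Γ.fibre g) : Γ.pullback₂ ξ (Γ.omega L) g u v = Γ.omega L g u v := by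
  have : CompleteSpace EG := FiniteDimensional.complete ℝ EG
  obtain ⟨N, hN, hNω⟩ := Γ.exists_fibreRep_omega_eq hL g
  obtain ⟨N', hN', hNω'⟩ := Γ.exists_fibreRep_omega_eq hL (ξ g)
  obtain ⟨X, Y⟩ := u
  obtain ⟨X', Y'⟩ := v
  obtain ⟨m1, m2, e⟩ := hξ.mixed_eq hL hN hN' hu.1 hu.2 hv.1 hv.2 rfl rfl rfl rfl
  -- The exchanged roles serve only to show that the image of `v` lies in the fibre over `ξ g`,
  -- which the formula for `Ω_L` requires.
  obtain ⟨m1', m2', -⟩ := hξ.mixed_eq hL hN hN' hv.1 hv.2 hu.1 hu.2 rfl rfl rfl rfl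
  exact (hNω' _ _ _ _ m1 m2 m1' m2').trans (e.trans (hNω X Y X' Y' hu.1 hu.2 hv.1 hv.2).symm)

end LieGroupoid

end

theorem mainTheorem2 {EG EM G M : Type*}
    [NormedAddCommGroup EG] [NormedSpace ℝ EG] [FiniteDimensional ℝ EG]
    [NormedAddCommGroup EM] [NormedSpace ℝ EM] [FiniteDimensional ℝ EM]
    [TopologicalSpace G] [T2Space G] [SecondCountableTopology G]
    [ChartedSpace EG G] [IsManifold 𝓘(ℝ, EG) ∞ G]
    [TopologicalSpace M] [T2Space M] [SecondCountableTopology M]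
    [ChartedSpace EM M] [IsManifold 𝓘(ℝ, EM) ∞ M]
    (Γ : LieGroupoid EG EM G M)
    (L : G → ℝ) (hL : ContMDiff 𝓘(ℝ, EG) 𝓘(ℝ, ℝ) ∞ L) (ξ : G → G) :
    (Γ.IsEvolutionOperator L ξ ↔ Γ.IsSecondOrder ξ ∧
      ∀ g, ∀ u ∈ Γ.fibre g,
        Γ.pullback₁ ξ (LieGroupoid.thetaMinus L) g u = LieGroupoid.thetaPlus L g u) ∧
    (Γ.IsEvolutionOperator L ξ ↔ Γ.IsSecondOrder ξ ∧
      ∀ g, ∀ u ∈ Γ.fibre g,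
        Γ.pullback₁ ξ (LieGroupoid.thetaMinus L) g u - LieGroupoid.thetaMinus L g u =
          LieGroupoid.d₀ L g u) ∧
    (Γ.IsEvolutionOperator L ξ →
      ∀ g, ∀ u ∈ Γ.fibre g, ∀ v ∈ Γ.fibre g,
        Γ.pullback₂ ξ (Γ.omega L) g u v = Γ.omega L g u v) := by
  have : CompleteSpace EG := FiniteDimensional.complete ℝ EG
  exact ⟨Γ.isEvolutionOperator_iff_pullback hL ξ, Γ.isEvolutionOperator_iff_pullback_sub hL ξ,
    fun hξ _ _ hu _ hv => hξ.pullback_omega hL hu hv⟩
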